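/- Let $\mathbb{T}_L=\mathbb{R}/L\mathbb{Z}$. Let $U\in C^2(\mathbb{R})$ be bilipschitz with constant $\kappa$, that is, $\kappa^{-1}|y-y'|\le |U(y)-U(y')|\le \kappa|y-y'|$ for all $y,y'$, and put $f(z)=U''(U^{-1}(z))$ and $g(z)=U'(U^{-1}(z))$. On $\mathbb{T}_L\times\mathbb{R}$ consider the linearized Euler equations around the shear flow $(U(y),0)$ in Lagrangian coordinates, $$\partial_t\omega+f\,\partial_xL_t\omega=0,\qquad L_t=\bigl(\partial_x^2+(g(\partial_z-t\partial_x))^2\bigr)^{-1},\qquad t\ge 0,$$ for $\omega\in C^1([0,\infty);L^2(\mathbb{T}_L\times\mathbb{R}))$ (real or complex valued), where $L_t\omega\in H^1$ is the weak solution of the elliptic problem, and where $\omega_0=\omega(0)$ has zero mean in $x$. Write $\|h\|_{\mathcal{C}^j}=\sum_{i\le j}\sup|h^{(i)}|$ and $\|u\|_{H^j}^2=\sum_{a+b\le j}\|\partial_x^a\partial_z^bu\|_{L^2}^2$. For all $\kappa$ and $L_0>0$ there is $c=c(\kappa,L_0)>0$ such that the following holds for all $s\in[1,\infty)$ and $D_1,D_2>0$.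 There is $C=C(D_1,D_2,s,\kappa,L_0)>0$ such that, whenever $0<L\le L_0$, $U$ is bilipschitz with constant $\kappa$, $$\|f\|_{W^{1,\infty}}\,L<c,$$ and $$\|f\|_{\mathcal{C}^j}+\|g\|_{\mathcal{C}^j}\le D_1^{1+j}(1+j)^{js},\qquad \|\omega_0\|_{H^j}\le D_2^{1+j}(1+j)^{js}\qquad\text{for all } j\in\mathbb{N}=\{0,1,2,\dots\},$$ every solution $\omega$ with initial datum $\omega_0$ satisfies $$\|\omega(t)\|_{H^j}\le C^{1+j}(1+j)^{js}\qquad\text{for all } j\in\mathbb{N} \text{ and all } t\ge 0.$$ -/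

import Mathlib

open MeasureTheory
open scoped NNReal ENNReal ContDiff

namespace InviscidDamping

/-! ### Coefficients of the shear flow and their norms -/

/-- `f(z) = U''(U⁻¹(z))`. -/
noncomputable def coeffF (U : ℝ → ℝ) (z : ℝ) : ℝ := iteratedDeriv 2 U (Function.invFun U z)

/-- `g(z) = U'(U⁻¹(z))`. -/
noncomputable def coeffG (U : ℝ → ℝ) (z : ℝ) : ℝ := deriv U (Function.invFun U z)

/-- `U` is bilipschitz with constant `κ`: `κ⁻¹ |y - y'| ≤ |U y - U y'| ≤ κ |y - y'|`. -/
def IsBilipschitz (κ : ℝ≥0) (U : ℝ → ℝ) : Prop := LipschitzWith κ U ∧ AntilipschitzWith κ U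

/-- The norm `‖h‖_{C^j} = ∑_{i ≤ j} sup |h⁽ⁱ⁾|`, equal to `∞` if `h` is not `C^j`
(an infimum over an empty family is `∞`) or if one of these derivatives is unbounded. -/
noncomputable def cNorm (j : ℕ) (h : ℝ → ℝ) : ℝ≥0∞ :=
  ⨅ _ : ContDiff ℝ j h, ∑ i ∈ Finset.range (j + 1), ⨆ z, ‖iteratedDeriv i h z‖ₑ

/-- The norm `‖h‖_{W^{1,∞}} = ‖h‖_{L^∞} + ‖h'‖_{L^∞}` (used only for `h` of class `C^1`). -/
noncomputable def wOneInftyNorm (h : ℝ → ℝ) : ℝ≥0∞ :=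
  eLpNorm h ∞ volume + eLpNorm (deriv h) ∞ volume

/-! ### The channel `𝕋_L × ℝ`, weak derivatives and Sobolev norms -/

/-- The infinite periodic channel `𝕋_L × ℝ`, where `𝕋_L = ℝ / Lℤ` has total length `L`. -/
abbrev Channel (L : ℝ) : Type := AddCircle L × ℝ

/-- The space `L²(𝕋_L × ℝ; ℂ)`. -/
abbrev L2 (L : ℝ) [Fact (0 < L)] : Type := Lp ℂ 2 (volume : Measure (Channel L))

/-- The classical partial derivative in the periodic variable `x`. -/
noncomputable def pdx {L : ℝ} (φ : Channel L → ℝ) (p : Channel L) : ℝ :=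
  deriv (fun h : ℝ => φ (p.1 + (h : AddCircle L), p.2)) 0

/-- The classical partial derivative in the variable `z ∈ ℝ`. -/
noncomputable def pdz {L : ℝ} (φ : Channel L → ℝ) (p : Channel L) : ℝ :=
  deriv (fun z : ℝ => φ (p.1, z)) p.2

/-- Test functions: smooth functions of compact support on `𝕋_L × ℝ`. -/
def IsTest {L : ℝ} (φ : Channel L → ℝ) : Prop :=
  ContDiff ℝ ∞ (fun q : ℝ × ℝ => φ ((q.1 : AddCircle L), q.2)) ∧ HasCompactSupport φ

/-- `v` is the weak derivative `∂ₓᵃ ∂_zᵇ u`. -/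
def HasWeakDeriv {L : ℝ} [Fact (0 < L)] (a b : ℕ) (u v : L2 L) : Prop :=
  ∀ φ : Channel L → ℝ, IsTest φ →
    ∫ p, (pdx^[a] (pdz^[b] φ)) p • u p = (-1 : ℝ) ^ (a + b) • ∫ p, φ p • v p

/-- The norm `‖u‖_{H^j} = (∑_{a + b ≤ j} ‖∂ₓᵃ ∂_zᵇ u‖²_{L²})^{1/2}`. Each infimum ranges over the
at most one weak derivative in `L²`; it is `∞` if there is none. -/
noncomputable def sobolevNorm {L : ℝ} [Fact (0 < L)] (j : ℕ) (u : L2 L) : ℝ≥0∞ :=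
  (∑ m ∈ Finset.range (j + 1), ∑ ab ∈ Finset.HasAntidiagonal.antidiagonal m,
    ⨅ v : L2 L, ⨅ _ : HasWeakDeriv ab.1 ab.2 u v, ‖v‖ₑ ^ 2) ^ (1 / 2 : ℝ)

/-- `u` has zero mean in `x`. -/
def HasZeroMean {L : ℝ} [Fact (0 < L)] (u : L2 L) : Prop :=
  ∀ᵐ z : ℝ, ∫ x : AddCircle L, u (x, z) = 0

/-! ### The linearized Euler equations in Lagrangian coordinates -/

/-- `ψ = L_t w`, that is, `ψ ∈ H¹` is the weak solution of
`(∂ₓ² + (g (∂_z - t ∂ₓ))²) ψ = w`, where `L²` functions `ψx`, `ψz` are its weak derivatives. -/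
def IsStreamFunction {L : ℝ} [Fact (0 < L)] (g : ℝ → ℝ) (t : ℝ) (w ψ ψx ψz : L2 L) : Prop :=
  HasWeakDeriv 1 0 ψ ψx ∧ HasWeakDeriv 0 1 ψ ψz ∧
    ∀ φ : Channel L → ℝ, IsTest φ →
      ∫ p, (pdx φ p • ψx p +
          (pdz (fun q => g q.2 * φ q) p - t * pdx (fun q => g q.2 * φ q) p) •
            (g p.2 • (ψz p - t • ψx p)))
        = -∫ p, φ p • w p

/-- `w ∈ C¹([0, ∞); L²)` solves `∂ₜ w + f ∂ₓ L_t w = 0` for all times `t ≥ 0`;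
here `w` is the vorticity. -/
def IsSolution {L : ℝ} [Fact (0 < L)] (f g : ℝ → ℝ) (w : ℝ → L2 L) : Prop :=
  ∀ t : ℝ, 0 ≤ t → ∃ ψ ψx ψz dw : L2 L,
    IsStreamFunction g t (w t) ψ ψx ψz ∧
    HasDerivWithinAt w dw (Set.Ici 0) t ∧
    ∀ᵐ p : Channel L, dw p + f p.2 • ψx p = 0

end InviscidDamping

/-!
The vorticity is expanded in Fourier modes `e^{ikx}`, `k = 2πn/L`, and each mode is controlled by
an energy estimate in Gevrey norms which is uniform in time and in `n`.

**The modes.** The coefficients satisfy `g g' = f` (`IsBilipschitz.coeffG_mul_deriv`), so that with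
`m = g²` and `D = ∂_z - ikt` the `k`-th mode `w` of the vorticity and `ψ` of the stream function
satisfy `-k²ψ + D(m Dψ) - f Dψ = w` and `∂ₜ w = -ikfψ` (`IsSolution.mode`). The mode `k = 0` is
constant in time, hence zero (`IsSolution.modeProj_zero`). All other modes have `1/|k| ≤ L`.

**The energy.** In the Fourier variable `ξ` of `z`, the operator `D` is multiplication by
`-ik(t - 2πξ/k)`. The weight `π - arctan(t - 2πξ/k)` lies between two positive constants, and its
time derivative `-(1 + (t - 2πξ/k)²)⁻¹` makes the weighted energy of `w` dissipate a squared norm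
`q²` of `w` (`hasDerivWithinAt_weighted_energy`). Up to a power of `k`, that norm is dual to the
elliptic norm `p = |k| ‖ψ‖ + ‖Dψ‖` (`HasD.norm_inner_le`). The elliptic equation therefore gives
`p ≲ q / |k|` (`IsModeStream.elliptic`), and the forcing `-ikfψ` contributes at most a multiple of
`‖f‖_{W^{1,∞}} q p` to the energy (`IsModeStream.forcing`). Since `‖f‖_{W^{1,∞}} / |k|` is at most
`‖f‖_{W^{1,∞}} L < c`, the dissipation wins.

**Regularity.** The estimate is applied to vertical difference quotients `δʲw` instead of
derivatives, so no regularity of the solution has to be known beforehand. The orders are summed with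
the Gevrey weights `W_j = ρʲ / (j!)ˢ`. Because `s ≥ 1`, these satisfy
`(i + l choose i) W_{i + l} ≤ W_i W_l` (`choose_mul_gevreyWeight_le`), which turns the Leibniz rule
into a convolution inequality. The terms in which a coefficient is differenced carry a weight `W_i`
with `i ≥ 1` and are small if `ρ` is (`exists_radius`). The terms of order zero are those treated
above, and this is why `c` does not depend on `s`, `D₁`, `D₂` (`smallness`). The result is
`IsModeSolution.sum_norm_dq_le`.

**Conclusion.** A horizontal derivative multiplies the `n`-th mode by `ik`, which commutes with the
evolution. Parseval's identity thus bounds all mixed difference quotients of `w(t)` by weak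
derivatives of `w(0)` (`norm_sq_dq_dq_le`). Weak compactness converts bounds that are uniform in the
step into weak derivatives of `w(t)` with the same bounds (`exists_hasWeakDeriv_of_norm_dq_le`).
-/

namespace InviscidDamping

/-! ### Multiplication and translation operators on `L²` -/

section Operators

variable {α : Type*} [MeasurableSpace α] {μ : Measure α}

open Classical in
/-- Multiplication by an essentially bounded function `a`, as an operator on `L²(μ)`; it is `0` if
`a` is not in `L^∞(μ)`. -/
noncomputable def mulOp (μ : Measure α) (a : α → ℂ) : Lp ℂ 2 μ →L[ℂ] Lp ℂ 2 μ :=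
  if h : MemLp a ∞ μ then (ContinuousLinearMap.mul ℂ ℂ).holderL μ ∞ 2 2 (h.toLp a) else 0

lemma mulOp_coe {a : α → ℂ} (ha : MemLp a ∞ μ) (u : Lp ℂ 2 μ) :
    mulOp μ a u =ᵐ[μ] fun x => a x * u x := by
  rw [mulOp, dif_pos ha]
  have h := (ContinuousLinearMap.mul ℂ ℂ).coeFn_holder (r := 2) (ha.toLp a) u
  filter_upwards [h, ha.coeFn_toLp] with x hx hx'
  rw [← hx']
  exact hx

lemma mulOp_mulOp {a b : α → ℂ} (ha : MemLp a ∞ μ) (hb : MemLp b ∞ μ)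
    (hab : MemLp (fun x => a x * b x) ∞ μ) (u : Lp ℂ 2 μ) :
    mulOp μ a (mulOp μ b u) = mulOp μ (fun x => a x * b x) u := by
  apply Lp.ext
  filter_upwards [mulOp_coe ha (mulOp μ b u), mulOp_coe hb u, mulOp_coe hab u] with x h1 h2 h3
  rw [h1, h2, h3]
  ring

lemma norm_le_of_ae_le {u v : Lp ℂ 2 μ} {C : ℝ} (h : ∀ᵐ x ∂μ, ‖u x‖ ≤ C * ‖v x‖) :
    ‖u‖ ≤ C * ‖v‖ :=
  Lp.norm_le_mul_norm_of_ae_le_mul h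

lemma norm_mulOp_le {a : α → ℂ} (ha : MemLp a ∞ μ) {C : ℝ} (hC : ∀ x, ‖a x‖ ≤ C) (u : Lp ℂ 2 μ) :
    ‖mulOp μ a u‖ ≤ C * ‖u‖ := by
  apply norm_le_of_ae_le
  filter_upwards [mulOp_coe ha u] with x hx
  rw [hx, norm_mul]
  exact mul_le_mul_of_nonneg_right (hC x) (norm_nonneg _)

lemma memLp_top_of_continuous [TopologicalSpace α] [OpensMeasurableSpace α]
    {a : α → ℂ} (ha : Continuous a) {C : ℝ} (hC : ∀ x, ‖a x‖ ≤ C) : MemLp a ∞ μ :=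
  memLp_top_of_bound ha.measurable.aestronglyMeasurable C (Filter.Eventually.of_forall hC)

lemma integrable_mul_conj (u v : Lp ℂ 2 μ) :
    Integrable (fun x => u x * (starRingEnd ℂ) (v x)) μ := by
  exact L2.integrable_inner (𝕜 := ℂ) v u

lemma inner_eq_integral (u v : Lp ℂ 2 μ) :
    inner ℂ u v = ∫ x, v x * (starRingEnd ℂ) (u x) ∂μ := by
  rw [L2.inner_def]; rfl

/-- Multiplication by a real function is symmetric. -/
lemma inner_mulOp_left {a : α → ℝ} (ha : MemLp (fun x => (a x : ℂ)) ∞ μ) (u v : Lp ℂ 2 μ) :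
    inner ℂ (mulOp μ (fun x => (a x : ℂ)) u) v = inner ℂ u (mulOp μ (fun x => (a x : ℂ)) v) := by
  rw [inner_eq_integral, inner_eq_integral]
  apply integral_congr_ae
  filter_upwards [mulOp_coe ha u, mulOp_coe ha v] with x h1 h2
  rw [h1, h2]
  simp
  ring

lemma norm_sq_eq_integral (u : Lp ℂ 2 μ) : ‖u‖ ^ 2 = ∫ x, ‖u x‖ ^ 2 ∂μ := by
  have h := inner_self_eq_norm_sq (𝕜 := ℂ) u
  rw [← h, inner_eq_integral]
  have h2 : ∀ x, u x * (starRingEnd ℂ) (u x) = ((‖u x‖ ^ 2 : ℝ) : ℂ) := by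
    intro x; rw [Complex.mul_conj, Complex.normSq_eq_norm_sq]
  simp_rw [h2]
  rw [integral_complex_ofReal]
  rfl

lemma integrable_norm_sq (u : Lp ℂ 2 μ) : Integrable (fun x => ‖u x‖ ^ 2) μ :=
  (Lp.memLp u).integrable_norm_pow (by norm_num)

lemma le_re_inner_mulOp {a : α → ℝ} (ha : MemLp (fun x => (a x : ℂ)) ∞ μ) {c : ℝ}
    (hc : ∀ x, c ≤ a x) (u : Lp ℂ 2 μ) :
    c * ‖u‖ ^ 2 ≤ (inner ℂ u (mulOp μ (fun x => (a x : ℂ)) u)).re := by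
  have h : ∫ x, (mulOp μ (fun x => (a x : ℂ)) u) x * (starRingEnd ℂ) (u x) ∂μ
      = ∫ x, ((a x * ‖u x‖ ^ 2 : ℝ) : ℂ) ∂μ := by
    apply integral_congr_ae
    filter_upwards [mulOp_coe ha u] with x h1
    rw [h1, mul_assoc, Complex.mul_conj, Complex.normSq_eq_norm_sq]
    push_cast; rfl
  have hint : Integrable (fun x => a x * ‖u x‖ ^ 2) μ := by
    have := (integrable_mul_conj (mulOp μ (fun x => (a x : ℂ)) u) u).re
    refine this.congr ?_
    filter_upwards [mulOp_coe ha u] with x h1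
    rw [h1, mul_assoc, Complex.mul_conj, Complex.normSq_eq_norm_sq, ← Complex.ofReal_mul]
    rfl
  rw [inner_eq_integral, h, integral_complex_ofReal, Complex.ofReal_re, norm_sq_eq_integral,
    ← integral_const_mul]
  exact integral_mono ((integrable_norm_sq u).const_mul c) hint
    fun x => mul_le_mul_of_nonneg_right (hc x) (by positivity)

end Operators

section Translation

variable {G : Type*} [MeasurableSpace G] [AddCommGroup G] [MeasurableAdd G]
  {μ : Measure G} [μ.IsAddRightInvariant]

/-- Translation `(T_v u)(x) = u(x + v)` on `L²`. -/
noncomputable def trans (μ : Measure G) [μ.IsAddRightInvariant] (v : G) :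
    Lp ℂ 2 μ →L[ℂ] Lp ℂ 2 μ :=
  (Lp.compMeasurePreservingₗᵢ ℂ (fun x => x + v)
    (measurePreserving_add_right μ v)).toContinuousLinearMap

lemma trans_coe (v : G) (u : Lp ℂ 2 μ) : trans μ v u =ᵐ[μ] fun x => u (x + v) :=
  Lp.coeFn_compMeasurePreserving u (measurePreserving_add_right μ v)

lemma norm_trans (v : G) (u : Lp ℂ 2 μ) : ‖trans μ v u‖ = ‖u‖ :=
  Lp.norm_compMeasurePreserving u (measurePreserving_add_right μ v)

lemma norm_trans_pow (v : G) (i : ℕ) (u : Lp ℂ 2 μ) : ‖(trans μ v ^ i) u‖ = ‖u‖ := by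
  induction i with
  | zero => simp
  | succ i ih => rw [pow_succ', mul_apply_eq_comp, norm_trans, ih]

lemma ae_comp_add {p : G → Prop} (h : ∀ᵐ x ∂μ, p x) (v : G) : ∀ᵐ x ∂μ, p (x + v) :=
  (measurePreserving_add_right μ v).quasiMeasurePreserving.ae h

lemma trans_comm (v w : G) (u : Lp ℂ 2 μ) :
    trans μ v (trans μ w u) = trans μ w (trans μ v u) := by
  apply Lp.ext
  filter_upwards [trans_coe v (trans μ w u), ae_comp_add (trans_coe w u) v,
    trans_coe w (trans μ v u), ae_comp_add (trans_coe v u) w] with x h1 h2 h3 h4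
  rw [h1, h2, h3, h4, add_right_comm]

/-- The difference quotient `δu = h⁻¹ (u(· + v) - u)` on `L²`. Shift `v` and step `h` are independent
parameters, so that it applies in any direction; it is `0` for `h = 0`. -/
noncomputable def dq (μ : Measure G) [μ.IsAddRightInvariant] (v : G) (h : ℝ) :
    Lp ℂ 2 μ →L[ℂ] Lp ℂ 2 μ :=
  ((h : ℂ)⁻¹) • (trans μ v - 1)

lemma dq_apply (v : G) (h : ℝ) (u : Lp ℂ 2 μ) :
    dq μ v h u = ((h : ℂ)⁻¹) • (trans μ v u - u) := rfl

lemma commute_trans (v w : G) : Commute (trans μ v) (trans μ w) :=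
  ContinuousLinearMap.ext fun u => trans_comm v w u

lemma commute_trans_dq (v w : G) (h : ℝ) : Commute (trans μ v) (dq μ w h) := by
  unfold dq
  exact (((commute_trans v w).sub_right (Commute.one_right _))).smul_right _

/-- The difference quotient `h⁻¹ (a(· + v) - a)` of a function; it is `0` for `h = 0`. -/
noncomputable def fdq {E : Type*} [AddCommGroup E] [Module ℝ E] (v : G) (h : ℝ) (a : G → E)
    (x : G) : E := h⁻¹ • (a (x + v) - a x)

lemma memLp_top_fdq {a : G → ℂ} (ha : MemLp a ∞ μ) (v : G) (h : ℝ) :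
    MemLp (fdq v h a) ∞ μ :=
  ((ha.comp_measurePreserving (measurePreserving_add_right μ v)).sub ha).const_smul (h⁻¹ : ℝ)

/-- The Leibniz rule for a difference quotient. The second factor is translated, which is harmless
since translations are isometries. -/
lemma dq_mulOp {a : G → ℂ} (ha : MemLp a ∞ μ) (v : G) (h : ℝ) (u : Lp ℂ 2 μ) :
    dq μ v h (mulOp μ a u) = mulOp μ a (dq μ v h u) + mulOp μ (fdq v h a) (trans μ v u) := by
  apply Lp.ext
  rw [dq_apply, dq_apply]
  filter_upwards [Lp.coeFn_smul (h : ℂ)⁻¹ (trans μ v (mulOp μ a u) - mulOp μ a u),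
    Lp.coeFn_sub (trans μ v (mulOp μ a u)) (mulOp μ a u), trans_coe v (mulOp μ a u),
    mulOp_coe ha u, ae_comp_add (mulOp_coe ha u) v,
    Lp.coeFn_add (mulOp μ a ((h : ℂ)⁻¹ • (trans μ v u - u))) (mulOp μ (fdq v h a) (trans μ v u)),
    mulOp_coe ha ((h : ℂ)⁻¹ • (trans μ v u - u)), Lp.coeFn_smul (h : ℂ)⁻¹ (trans μ v u - u),
    Lp.coeFn_sub (trans μ v u) u, trans_coe v u,
    mulOp_coe (memLp_top_fdq ha v h) (trans μ v u)] with x h1 h2 h3 h4 h5 h6 h7 h8 h9 h10 h11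
  rw [h1, h6, Pi.smul_apply, h2, Pi.sub_apply, h3, h4, h5, Pi.add_apply, h7, h8, h11,
    Pi.smul_apply, h9, Pi.sub_apply, h10, fdq]
  simp only [smul_eq_mul, Complex.real_smul, Complex.ofReal_inv]
  ring

lemma memLp_top_iterate_fdq {a : G → ℂ} (ha : MemLp a ∞ μ) (v : G) (h : ℝ) (i : ℕ) :
    MemLp ((fdq v h)^[i] a) ∞ μ := by
  induction i with
  | zero => exact ha
  | succ i ih => rw [Function.iterate_succ_apply']; exact memLp_top_fdq ih v h

/-- The Leibniz rule for iterated difference quotients. -/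
lemma dq_pow_mulOp {a : G → ℂ} (ha : MemLp a ∞ μ) (v : G) (h : ℝ) (j : ℕ) (u : Lp ℂ 2 μ) :
    (dq μ v h ^ j) (mulOp μ a u) = ∑ ij ∈ Finset.HasAntidiagonal.antidiagonal j,
      j.choose ij.1 • mulOp μ ((fdq v h)^[ij.1] a) ((trans μ v ^ ij.1) ((dq μ v h ^ ij.2) u)) := by
  induction j generalizing a u with
  | zero => simp
  | succ j ih =>
    rw [Finset.sum_antidiagonal_choose_succ_nsmul (fun p q => mulOp μ ((fdq v h)^[p] a)
      ((trans μ v ^ p) ((dq μ v h ^ q) u))), pow_succ, mul_apply_eq_comp,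
      dq_mulOp ha, map_add, ih ha, ih (memLp_top_fdq ha v h)]
    congr 1
    apply Finset.sum_congr rfl
    rintro ⟨p, q⟩ hpq
    rw [Finset.HasAntidiagonal.mem_antidiagonal] at hpq
    simp only at hpq ⊢
    rw [Nat.choose_symm_of_eq_add hpq.symm, Function.iterate_succ_apply]
    congr 2
    rw [pow_succ, mul_apply_eq_comp]
    congr 1
    exact congrArg (fun F : Lp ℂ 2 μ →L[ℂ] Lp ℂ 2 μ => F u)
      (((commute_trans_dq v v h).pow_right q).eq).symm

end Translation

/-! ### Weak derivatives on the line and the Fourier transform -/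

section WeakDeriv

open FourierTransform

/-- The space `L²(ℝ; ℂ)`. -/
abbrev L2R : Type := Lp ℂ 2 (volume : Measure ℝ)

/-- `v` is the weak derivative of `u` on the line. -/
def WeakDeriv (u v : L2R) : Prop :=
  ∀ θ : ℝ → ℝ, ContDiff ℝ ∞ θ → HasCompactSupport θ →
    ∫ z, deriv θ z • u z = -∫ z, θ z • v z

lemma integrable_smul_Lp {X : Type*} [TopologicalSpace X] [T2Space X] [LocallyCompactSpace X]
    [MeasurableSpace X] [OpensMeasurableSpace X] {μ : Measure X}
    [IsLocallyFiniteMeasure μ] {θ : X → ℝ}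
    (h1 : Continuous θ) (h2 : HasCompactSupport θ) (u : Lp ℂ 2 μ) :
    Integrable (fun z => θ z • u z) μ :=
  LocallyIntegrable.integrable_smul_left_of_hasCompactSupport
    ((Lp.memLp u).locallyIntegrable (by norm_num)) h1 h2

lemma contDiff_deriv {θ : ℝ → ℝ} (h : ContDiff ℝ ∞ θ) : ContDiff ℝ ∞ (deriv θ) :=
  ((contDiff_infty_iff_deriv).1 h).2

lemma WeakDeriv.add {u v u' v' : L2R} (h : WeakDeriv u v) (h' : WeakDeriv u' v') :
    WeakDeriv (u + u') (v + v') := by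
  intro θ h1 h2
  have e1 : ∫ z, deriv θ z • (u + u') z = ∫ z, (deriv θ z • u z + deriv θ z • u' z) := by
    apply integral_congr_ae
    filter_upwards [Lp.coeFn_add u u'] with z hz
    rw [hz, Pi.add_apply, smul_add]
  have e2 : ∫ z, θ z • (v + v') z = ∫ z, (θ z • v z + θ z • v' z) := by
    apply integral_congr_ae
    filter_upwards [Lp.coeFn_add v v'] with z hz
    rw [hz, Pi.add_apply, smul_add]
  have h3 := (contDiff_deriv h1).continuous
  rw [e1, e2, integral_add (integrable_smul_Lp h3 h2.deriv u) (integrable_smul_Lp h3 h2.deriv u'),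
    integral_add (integrable_smul_Lp h1.continuous h2 v) (integrable_smul_Lp h1.continuous h2 v'),
    h θ h1 h2, h' θ h1 h2]
  ring

lemma WeakDeriv.smul {u v : L2R} (h : WeakDeriv u v) (c : ℂ) : WeakDeriv (c • u) (c • v) := by
  intro θ h1 h2
  have e1 : ∫ z, deriv θ z • (c • u) z = ∫ z, c * (deriv θ z • u z) := by
    apply integral_congr_ae
    filter_upwards [Lp.coeFn_smul c u] with z hz
    rw [hz, Pi.smul_apply, smul_eq_mul, mul_smul_comm]
  have e2 : ∫ z, θ z • (c • v) z = ∫ z, c * (θ z • v z) := by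
    apply integral_congr_ae
    filter_upwards [Lp.coeFn_smul c v] with z hz
    rw [hz, Pi.smul_apply, smul_eq_mul, mul_smul_comm]
  rw [e1, e2, integral_const_mul, integral_const_mul, h θ h1 h2]
  ring

lemma WeakDeriv.sub {u v u' v' : L2R} (h : WeakDeriv u v) (h' : WeakDeriv u' v') :
    WeakDeriv (u - u') (v - v') := by
  have := h.add (h'.smul (-1))
  simpa [sub_eq_add_neg] using this

lemma WeakDeriv.translate {u v : L2R} (h : WeakDeriv u v) (a : ℝ) :
    WeakDeriv (trans volume a u) (trans volume a v) := by
  intro θ h1 h2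
  have key : ∀ (η : ℝ → ℝ) (w : L2R),
      ∫ z, η z • (trans volume a w) z = ∫ z, η (z - a) • w z := by
    intro η w
    rw [← integral_add_right_eq_self (fun z => η (z - a) • w z) a]
    apply integral_congr_ae
    filter_upwards [trans_coe a w] with z hz
    rw [hz, add_sub_cancel_right]
  have h3 : ∀ z, deriv θ (z - a) = deriv (fun y => θ (y - a)) z := by
    intro z; rw [deriv_comp_sub_const]
  rw [key, key]
  simp_rw [h3]
  refine h _ (by fun_prop) ?_
  exact h2.comp_homeomorph (Homeomorph.subRight a)

lemma WeakDeriv.diffQuot {u v : L2R} (h : WeakDeriv u v) (a b : ℝ) :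
    WeakDeriv (dq volume a b u) (dq volume a b v) :=
  ((h.translate a).sub h).smul _

lemma WeakDeriv.diffQuot_pow {u v : L2R} (h : WeakDeriv u v) (a b : ℝ) (j : ℕ) :
    WeakDeriv ((dq volume a b ^ j) u) ((dq volume a b ^ j) v) := by
  induction j with
  | zero => simpa using h
  | succ j ih => rw [pow_succ', mul_apply_eq_comp, mul_apply_eq_comp]; exact ih.diffQuot a b

/-- The Leibniz rule for weak derivatives. -/
lemma WeakDeriv.leibniz {u v : L2R} (h : WeakDeriv u v) {a : ℝ → ℝ} (ha : ContDiff ℝ ∞ a)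
    (h1 : MemLp (fun z => (a z : ℂ)) ∞ volume) (h2 : MemLp (fun z => ((deriv a z : ℝ) : ℂ)) ∞ volume) :
    WeakDeriv (mulOp volume (fun z => (a z : ℂ)) u)
      (mulOp volume (fun z => ((deriv a z : ℝ) : ℂ)) u + mulOp volume (fun z => (a z : ℂ)) v) := by
  intro θ t1 t2
  have hd : ∀ z, deriv (fun y => a y * θ y) z = deriv a z * θ z + a z * deriv θ z := by
    intro z
    exact deriv_fun_mul (ha.differentiable (by simp) z) (t1.differentiable (by simp) z)
  have key := h (fun y => a y * θ y) (ha.mul t1) t2.mul_left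
  have c1 := (contDiff_deriv ha).continuous
  have c2 := (contDiff_deriv t1).continuous
  have i1 : Integrable (fun z => (deriv a z * θ z) • u z) :=
    integrable_smul_Lp (c1.mul t1.continuous) t2.mul_left u
  have i2 : Integrable (fun z => (a z * deriv θ z) • u z) :=
    integrable_smul_Lp (ha.continuous.mul c2) t2.deriv.mul_left u
  have i3 : Integrable (fun z => (a z * θ z) • v z) :=
    integrable_smul_Lp (ha.continuous.mul t1.continuous) t2.mul_left v
  simp_rw [hd, add_smul] at key
  rw [integral_add i1 i2] at key
  have e1 : ∫ z, deriv θ z • (mulOp volume (fun z => (a z : ℂ)) u) z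
      = ∫ z, (a z * deriv θ z) • u z := by
    apply integral_congr_ae
    filter_upwards [mulOp_coe h1 u] with z hz
    rw [hz]; simp only [Complex.real_smul]; push_cast; ring
  have e2 : ∫ z, θ z • (mulOp volume (fun z => ((deriv a z : ℝ) : ℂ)) u
      + mulOp volume (fun z => (a z : ℂ)) v : L2R) z
      = ∫ z, ((deriv a z * θ z) • u z + (a z * θ z) • v z) := by
    apply integral_congr_ae
    filter_upwards [mulOp_coe h2 u, mulOp_coe h1 v,
      Lp.coeFn_add (mulOp volume (fun z => ((deriv a z : ℝ) : ℂ)) u)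
        (mulOp volume (fun z => (a z : ℂ)) v)] with z hz hz' hz''
    rw [hz'', Pi.add_apply, hz, hz']; simp only [Complex.real_smul]; push_cast; ring
  rw [e1, e2, integral_add i1 i3, neg_add, ← key]
  ring

/-- Complex test functions may be used in the definition of the weak derivative. -/
lemma WeakDeriv.complex_test {u v : L2R} (h : WeakDeriv u v) {φ : ℝ → ℂ} (h1 : ContDiff ℝ ∞ φ)
    (h2 : HasCompactSupport φ) : ∫ z, deriv φ z * u z = -∫ z, φ z * v z := by
  have r1 : ContDiff ℝ ∞ (fun z => (φ z).re) := Complex.reCLM.contDiff.comp h1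
  have r2 : ContDiff ℝ ∞ (fun z => (φ z).im) := Complex.imCLM.contDiff.comp h1
  have s1 : HasCompactSupport (fun z => (φ z).re) := h2.comp_left (g := Complex.re) rfl
  have s2 : HasCompactSupport (fun z => (φ z).im) := h2.comp_left (g := Complex.im) rfl
  have d1 : ∀ z, deriv (fun z => (φ z).re) z = (deriv φ z).re := fun z =>
    (Complex.reCLM.hasFDerivAt.comp_hasDerivAt z
      (h1.differentiable (by simp) z).hasDerivAt).deriv
  have d2 : ∀ z, deriv (fun z => (φ z).im) z = (deriv φ z).im := fun z =>
    (Complex.imCLM.hasFDerivAt.comp_hasDerivAt z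
      (h1.differentiable (by simp) z).hasDerivAt).deriv
  have k1 := h _ r1 s1
  have k2 := h _ r2 s2
  have split : ∀ (c : ℂ) (w : ℂ), c * w = c.re • w + Complex.I * (c.im • w) := by
    intro c w
    conv_lhs => rw [← Complex.re_add_im c]
    simp only [Complex.real_smul]; ring
  have i1 := integrable_smul_Lp (contDiff_deriv r1).continuous s1.deriv u
  have i2 := integrable_smul_Lp (contDiff_deriv r2).continuous s2.deriv u
  have i3 := integrable_smul_Lp r1.continuous s1 v
  have i4 := integrable_smul_Lp r2.continuous s2 v
  simp_rw [d1] at k1 i1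
  simp_rw [d2] at k2 i2
  rw [integral_congr_ae (Filter.Eventually.of_forall fun z => split (deriv φ z) (u z)),
    integral_congr_ae (Filter.Eventually.of_forall fun z => split (φ z) (v z))]
  rw [integral_add i1 (i2.const_mul _), integral_add i3 (i4.const_mul _), integral_const_mul,
    integral_const_mul, k1, k2]
  ring

/-- Schwartz functions may be used as test functions for the weak derivative. -/
lemma WeakDeriv.schwartz {u v : L2R} (h : WeakDeriv u v) (φ : SchwartzMap ℝ ℂ) :
    ∫ z, deriv φ z * u z = -∫ z, φ z * v z := by
  -- Cut off by `χ(z / n)` with a smooth bump `χ` and let `n → ∞`.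
  let χ : ContDiffBump (0 : ℝ) := ⟨1, 2, by norm_num, by norm_num⟩
  let c : ℕ → ℝ → ℝ := fun n z => χ (z / (n + 1))
  have hc : ∀ n, ContDiff ℝ ∞ (c n) := fun n => χ.contDiff.comp (by fun_prop)
  obtain ⟨M, hM⟩ : ∃ M, ∀ x, ‖deriv χ x‖ ≤ M :=
    (χ.hasCompactSupport.deriv).exists_bound_of_continuous
      (contDiff_deriv χ.contDiff).continuous
  have hcd : ∀ n z, deriv (c n) z = (deriv χ (z / (n + 1))) / (n + 1) := by
    intro n z
    have h1 : HasDerivAt (fun z : ℝ => z / ((n : ℝ) + 1)) (1 / ((n : ℝ) + 1)) z :=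
      (hasDerivAt_id z).div_const _
    have h2 := ((χ.contDiff (n := 1)).differentiable (by simp) (z / (n + 1))).hasDerivAt
    refine (h2.comp z h1).deriv.trans ?_
    ring
  have hcs : ∀ n, HasCompactSupport (c n) := by
    intro n
    have hn : ((n : ℝ) + 1) ≠ 0 := by positivity
    exact χ.hasCompactSupport.comp_homeomorph (Homeomorph.mulRight₀ ((n : ℝ) + 1)⁻¹ (inv_ne_zero hn))
  have hcle : ∀ n z, |c n z| ≤ 1 := fun n z => by
    rw [abs_of_nonneg χ.nonneg]; exact χ.le_one
  have hone : ∀ z : ℝ, ∀ᶠ n : ℕ in Filter.atTop, ‖z / ((n : ℝ) + 1)‖ < 1 := by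
    intro z
    filter_upwards [Filter.eventually_ge_atTop (⌈|z|⌉₊)] with n hn
    have h1 : |z| ≤ n := (Nat.le_ceil _).trans (by exact_mod_cast hn)
    rw [norm_div, Real.norm_eq_abs, Real.norm_of_nonneg (by positivity), div_lt_one (by positivity)]
    linarith
  have hφ := φ.smooth ⊤
  have hφd : ∀ z, HasDerivAt φ (deriv φ z) z := fun z =>
    (hφ.differentiable (by simp) z).hasDerivAt
  have hψ : ∀ n z, deriv (fun z => (c n z : ℂ) * φ z) z
      = ((deriv (c n) z : ℝ) : ℂ) * φ z + (c n z : ℂ) * deriv φ z := by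
    intro n z
    have h1 := ((hc n).differentiable (by simp) z).hasDerivAt
    exact (h1.ofReal_comp.mul (hφd z)).deriv
  have key : ∀ n, ∫ z, (((deriv (c n) z : ℝ) : ℂ) * φ z + (c n z : ℂ) * deriv φ z) * u z
      = -∫ z, ((c n z : ℂ) * φ z) * v z := by
    intro n
    have := h.complex_test (φ := fun z => (c n z : ℂ) * φ z)
      ((Complex.ofRealCLM.contDiff.comp (hc n)).mul hφ)
      (((hcs n).comp_left (g := Complex.ofReal) rfl).mul_right)
    rw [← this]
    exact integral_congr_ae (Filter.Eventually.of_forall fun z => by simp only [hψ])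
  have mφ : MemLp φ 2 volume := φ.memLp 2 volume
  have mφ' : MemLp (deriv φ) 2 volume := (SchwartzMap.derivCLM ℂ ℂ φ).memLp 2 volume
  have i1 : Integrable (fun z => φ z * u z) := mφ.integrable_mul (Lp.memLp u)
  have i2 : Integrable (fun z => deriv φ z * u z) := mφ'.integrable_mul (Lp.memLp u)
  have i3 : Integrable (fun z => φ z * v z) := mφ.integrable_mul (Lp.memLp v)
  have M0 : 0 ≤ M := (norm_nonneg _).trans (hM 0)
  have cc : ∀ n, Continuous (c n) := fun n => (hc n).continuous
  have ccd : ∀ n, Continuous (deriv (c n)) := fun n => (contDiff_deriv (hc n)).continuous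
  have t1 : Filter.Tendsto (fun n => ∫ z, (((deriv (c n) z : ℝ) : ℂ) * φ z
      + (c n z : ℂ) * deriv φ z) * u z) Filter.atTop (nhds (∫ z, deriv φ z * u z)) := by
    refine tendsto_integral_of_dominated_convergence
      (fun z => M * ‖φ z * u z‖ + ‖deriv φ z * u z‖) ?_
      ((i1.norm.const_mul M).add i2.norm) ?_ ?_
    · intro n
      have : (fun z => (((deriv (c n) z : ℝ) : ℂ) * φ z + (c n z : ℂ) * deriv φ z) * u z)
          = fun z => ((deriv (c n) z : ℝ) : ℂ) * (φ z * u z) + (c n z : ℂ) * (deriv φ z * u z) := by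
        funext z; ring
      rw [this]
      exact ((Complex.continuous_ofReal.comp (ccd n)).aestronglyMeasurable.mul
        i1.aestronglyMeasurable).add
        ((Complex.continuous_ofReal.comp (cc n)).aestronglyMeasurable.mul i2.aestronglyMeasurable)
    · intro n
      refine Filter.Eventually.of_forall fun z => ?_
      have e : (((deriv (c n) z : ℝ) : ℂ) * φ z + (c n z : ℂ) * deriv φ z) * u z
        = ((deriv (c n) z : ℝ) : ℂ) * (φ z * u z) + (c n z : ℂ) * (deriv φ z * u z) := by ring
      rw [e]
      refine (norm_add_le _ _).trans (add_le_add ?_ ?_)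
      · rw [norm_mul, Complex.norm_real]
        refine mul_le_mul_of_nonneg_right ?_ (norm_nonneg _)
        rw [hcd, norm_div, Real.norm_of_nonneg (by positivity : (0 : ℝ) ≤ (n : ℝ) + 1)]
        exact (div_le_self (norm_nonneg _) (by linarith [(n.cast_nonneg : (0 : ℝ) ≤ n)])).trans
          (hM _)
      · rw [norm_mul, Complex.norm_real]
        exact mul_le_of_le_one_left (norm_nonneg _) (hcle n z)
    · refine Filter.Eventually.of_forall fun z => ?_
      refine tendsto_const_nhds.congr' ?_
      filter_upwards [hone z] with n hn
      have hev : c n =ᶠ[nhds z] fun _ => 1 := by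
        have : ∀ᶠ y : ℝ in nhds z, ‖y / ((n : ℝ) + 1)‖ < 1 :=
          (by fun_prop : Continuous fun y : ℝ => ‖y / ((n : ℝ) + 1)‖).continuousAt.eventually_lt
            continuousAt_const hn
        filter_upwards [this] with y hy
        exact χ.one_of_mem_closedBall (by simpa using hy.le)
      rw [hev.deriv_eq, hev.eq_of_nhds]
      simp
  have t2 : Filter.Tendsto (fun n => ∫ z, ((c n z : ℂ) * φ z) * v z) Filter.atTop
      (nhds (∫ z, φ z * v z)) := by
    refine tendsto_integral_of_dominated_convergence (fun z => ‖φ z * v z‖) ?_ i3.norm ?_ ?_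
    · intro n
      simp_rw [mul_assoc]
      exact (Complex.continuous_ofReal.comp (cc n)).aestronglyMeasurable.mul i3.aestronglyMeasurable
    · intro n
      refine Filter.Eventually.of_forall fun z => ?_
      rw [mul_assoc, norm_mul, Complex.norm_real]
      exact mul_le_of_le_one_left (norm_nonneg _) (hcle n z)
    · refine Filter.Eventually.of_forall fun z => ?_
      refine tendsto_const_nhds.congr' ?_
      filter_upwards [hone z] with n hn
      have : c n z = 1 := χ.one_of_mem_closedBall (by simpa using hn.le)
      rw [this]; simp
  simp_rw [key] at t1
  exact tendsto_nhds_unique t1 t2.neg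

/-- In Fourier variables a weak derivative is multiplication by `2πiξ`. -/
lemma WeakDeriv.fourier {u v : L2R} (h : WeakDeriv u v) :
    ∀ᵐ ξ : ℝ, (𝓕 v : L2R) ξ = (2 * Real.pi * ξ * Complex.I) * (𝓕 u : L2R) ξ := by
  have h1 : LineDeriv.lineDerivOp (1 : ℝ) (Lp.toTemperedDistribution u)
      = Lp.toTemperedDistribution v := by
    ext φ
    rw [TemperedDistribution.lineDerivOp_apply_apply, map_neg, Lp.toTemperedDistribution_apply,
      Lp.toTemperedDistribution_apply, neg_eq_iff_eq_neg]
    have := h.schwartz φ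
    simp only [smul_eq_mul]
    rw [← this]
    apply integral_congr_ae
    refine Filter.Eventually.of_forall fun z => ?_
    simp only [SchwartzMap.lineDerivOp_apply_eq_fderiv, fderiv_apply_one_eq_deriv]
  -- As tempered distributions the two sides agree; it remains to recover this pointwise by testing
  -- with smooth functions of compact support.
  have h2 := TemperedDistribution.fourier_lineDerivOp_eq (Lp.toTemperedDistribution u) (1 : ℝ)
  rw [h1, Lp.fourier_toTemperedDistribution_eq, Lp.fourier_toTemperedDistribution_eq] at h2
  refine ae_eq_of_integral_contDiff_smul_eq
    ((Lp.memLp (𝓕 v : L2R)).locallyIntegrable (by norm_num)) ?_ ?_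
  · exact (((Lp.memLp (𝓕 u : L2R)).locallyIntegrable (by norm_num)).locallyIntegrableOn
      Set.univ |>.continuousOn_mul (by fun_prop) isOpen_univ.isLocallyClosed
      |> locallyIntegrableOn_univ.1)
  · intro g g1 g2
    have c1 : HasCompactSupport (fun x => (g x : ℂ)) := g2.comp_left (g := Complex.ofReal) rfl
    have c2 : ContDiff ℝ ∞ (fun x => (g x : ℂ)) := Complex.ofRealCLM.contDiff.comp g1
    have h3 := DFunLike.congr_fun h2 (c1.toSchwartzMap c2)
    have hg : (fun x : ℝ => ((inner ℝ x (1 : ℝ) : ℝ) : ℂ)).HasTemperateGrowth := by fun_prop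
    change _ = (2 * Real.pi * Complex.I : ℂ) • (TemperedDistribution.smulLeftCLM ℂ _
      (Lp.toTemperedDistribution (𝓕 u : L2R)) : TemperedDistribution ℝ ℂ) _ at h3
    rw [TemperedDistribution.smulLeftCLM_apply_apply,
      Lp.toTemperedDistribution_apply, Lp.toTemperedDistribution_apply, smul_eq_mul,
      ← integral_const_mul] at h3
    refine Eq.trans ?_ (h3.trans ?_)
    · rfl
    · apply integral_congr_ae
      refine Filter.Eventually.of_forall fun z => ?_
      simp only [SchwartzMap.smulLeftCLM_apply_apply hg]
      change _ * (((inner ℝ z (1 : ℝ) : ℝ) : ℂ) • (g z : ℂ)) • _ = _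
      simp only [RCLike.inner_apply, conj_trivial, one_mul, smul_eq_mul, Complex.real_smul]
      ring

/-- In Fourier variables the translation by `a` is multiplication by `e^{2πiaξ}`. -/
lemma fourier_trans (a : ℝ) (u : L2R) :
    ∀ᵐ ξ : ℝ, (𝓕 (trans volume a u) : L2R) ξ
      = Complex.exp (2 * Real.pi * (a * ξ) * Complex.I) * (𝓕 u : L2R) ξ := by
  set e : ℝ → ℂ := fun ξ => Complex.exp (2 * Real.pi * (a * ξ) * Complex.I)
  have hn : ∀ ξ, ‖e ξ‖ ≤ 1 := fun ξ => by
    have : (2 * Real.pi * (a * ξ) * Complex.I : ℂ)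
        = ((2 * Real.pi * (a * ξ) : ℝ) : ℂ) * Complex.I := by
      push_cast; ring
    simp only [e, this, Complex.norm_exp_ofReal_mul_I, le_refl]
  have he : MemLp e ∞ volume := memLp_top_of_continuous (by fun_prop) hn
  suffices h : (𝓕 (trans volume a u) : L2R) = mulOp volume e (𝓕 u : L2R) by
    rw [h]; exact mulOp_coe he _
  refine DenseRange.induction_on (SchwartzMap.denseRange_toLpCLM (E := ℝ) (F := ℂ) (p := 2)
    (μ := volume) ENNReal.ofNat_ne_top) u ?_ ?_
  · apply isClosed_eq
    · exact (FourierTransform.fourierCLM ℂ L2R ∘L trans volume a).continuous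
    · exact (mulOp volume e ∘L FourierTransform.fourierCLM ℂ L2R).continuous
  · intro φ
    rw [SchwartzMap.toLpCLM_apply]
    have h1 : trans volume a (φ.toLp 2) = (φ.compSubConstCLM ℂ (-a)).toLp 2 := by
      apply Lp.ext
      filter_upwards [trans_coe a (φ.toLp 2 : L2R), ae_comp_add (φ.coeFn_toLp 2 volume) a,
        (φ.compSubConstCLM ℂ (-a)).coeFn_toLp 2 volume] with x h1 h2 h3
      rw [h1, h2, h3, SchwartzMap.compSubConstCLM_apply, sub_neg_eq_add]
    rw [h1, SchwartzMap.toLp_fourier_eq, SchwartzMap.toLp_fourier_eq]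
    apply Lp.ext
    filter_upwards [mulOp_coe he ((𝓕 φ).toLp 2 : L2R), (𝓕 φ).coeFn_toLp 2 volume,
      (𝓕 (φ.compSubConstCLM ℂ (-a))).coeFn_toLp 2 volume] with ξ h1 h2 h3
    rw [h1, h2, h3, SchwartzMap.fourier_coe, SchwartzMap.fourier_coe]
    have h4 := congrFun (VectorFourier.fourierIntegral_comp_add_right Real.fourierChar volume
      (innerₗ ℝ) φ a) ξ
    have h5 : ⇑(φ.compSubConstCLM ℂ (-a)) = φ ∘ fun v => v + a := by
      funext x; simp [SchwartzMap.compSubConstCLM_apply]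
    rw [h5]
    refine h4.trans ?_
    simp only [innerₗ_apply_apply, RCLike.inner_apply, conj_trivial, Circle.smul_def,
      Real.fourierChar_apply, smul_eq_mul, e]
    congr 2
    push_cast
    ring

/-- The difference quotient is bounded by the weak derivative. -/
lemma WeakDeriv.norm_dq_le {u v : L2R} (h : WeakDeriv u v) (a : ℝ) :
    ‖dq volume a a u‖ ≤ ‖v‖ := by
  rcases eq_or_ne a 0 with rfl | ha
  · simp [dq_apply]
  rw [dq_apply, norm_smul, norm_inv, Complex.norm_real, ← Lp.norm_fourier_eq (_ - _),
    ← Lp.norm_fourier_eq v, inv_mul_le_iff₀ (by positivity)]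
  have hsub : (𝓕 (trans volume a u - u) : L2R) = 𝓕 (trans volume a u) - 𝓕 u :=
    map_sub (Lp.fourierTransformₗᵢ ℝ ℂ) _ _
  rw [hsub]
  apply norm_le_of_ae_le
  filter_upwards [h.fourier, fourier_trans a u,
    Lp.coeFn_sub (𝓕 (trans volume a u) : L2R) (𝓕 u : L2R)] with ξ h1 h2 h3
  rw [h3, Pi.sub_apply, h2, h1, ← sub_one_mul, norm_mul, norm_mul, ← mul_assoc ‖a‖]
  refine mul_le_mul_of_nonneg_right ?_ (norm_nonneg ((𝓕 u : L2R) ξ))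
  have e : (2 * Real.pi * (a * ξ) * Complex.I : ℂ)
      = Complex.I * ((2 * Real.pi * (a * ξ) : ℝ) : ℂ) := by
    push_cast; ring
  rw [e]
  refine (Real.norm_exp_I_mul_ofReal_sub_one_le (x := 2 * Real.pi * (a * ξ))).trans (le_of_eq ?_)
  simp [abs_of_pos Real.pi_pos]
  ring

end WeakDeriv

/-! ### The Fourier multiplier weights -/

section Multiplier

open FourierTransform

/-- `d = (∂_z - i k t) u` in the weak sense: the vertical derivative of the `k`-th mode in
Lagrangian coordinates at time `t`. -/
def HasD (k t : ℝ) (u d : L2R) : Prop :=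
  WeakDeriv u (d + ((k * t : ℝ) * Complex.I : ℂ) • u)

lemma HasD.diffQuot_pow {k t : ℝ} {u d : L2R} (h : HasD k t u d) (a b : ℝ) (j : ℕ) :
    HasD k t ((dq volume a b ^ j) u) ((dq volume a b ^ j) d) := by
  have := WeakDeriv.diffQuot_pow h a b j
  rw [map_add, map_smul] at this
  exact this

lemma HasD.translate_pow {k t : ℝ} {u d : L2R} (h : HasD k t u d) (a : ℝ) (j : ℕ) :
    HasD k t ((trans volume a ^ j) u) ((trans volume a ^ j) d) := by
  induction j with
  | zero => simpa using h
  | succ j ih =>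
    have := WeakDeriv.translate ih a
    rw [map_add, map_smul] at this
    rw [pow_succ', mul_apply_eq_comp, mul_apply_eq_comp]
    exact this

lemma HasD.leibniz {k t : ℝ} {u d : L2R} (h : HasD k t u d) {a : ℝ → ℝ} (ha : ContDiff ℝ ∞ a)
    (h1 : MemLp (fun z => (a z : ℂ)) ∞ volume)
    (h2 : MemLp (fun z => ((deriv a z : ℝ) : ℂ)) ∞ volume) :
    HasD k t (mulOp volume (fun z => (a z : ℂ)) u)
      (mulOp volume (fun z => ((deriv a z : ℝ) : ℂ)) u + mulOp volume (fun z => (a z : ℂ)) d) := by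
  have := WeakDeriv.leibniz h ha h1 h2
  rw [map_add, map_smul, ← add_assoc] at this
  exact this

lemma HasD.fourier {k t : ℝ} {u d : L2R} (h : HasD k t u d) :
    ∀ᵐ ξ : ℝ, (𝓕 d : L2R) ξ = ((2 * Real.pi * ξ - k * t : ℝ) * Complex.I) * (𝓕 u : L2R) ξ := by
  have hlin : (𝓕 (d + ((k * t : ℝ) * Complex.I : ℂ) • u) : L2R)
      = 𝓕 d + ((k * t : ℝ) * Complex.I : ℂ) • (𝓕 u : L2R) := by
    change Lp.fourierTransformₗᵢ ℝ ℂ _ = Lp.fourierTransformₗᵢ ℝ ℂ _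
      + _ • Lp.fourierTransformₗᵢ ℝ ℂ _
    rw [map_add, map_smul]
  have h1 := WeakDeriv.fourier h
  rw [hlin] at h1
  filter_upwards [h1, Lp.coeFn_add (𝓕 d : L2R) (((k * t : ℝ) * Complex.I : ℂ) • (𝓕 u : L2R)),
    Lp.coeFn_smul ((k * t : ℝ) * Complex.I : ℂ) (𝓕 u : L2R)] with ξ e1 e2 e3
  rw [e2, Pi.add_apply, e3, Pi.smul_apply, smul_eq_mul] at e1
  rw [eq_sub_of_add_eq e1]
  push_cast
  ring

/-- The operator `∂_z - i k t` is antisymmetric. -/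
lemma HasD.inner_eq_neg {k t : ℝ} {u d u' d' : L2R} (h : HasD k t u d) (h' : HasD k t u' d') :
    inner ℂ d u' = -inner ℂ u d' := by
  rw [← Lp.inner_fourier_eq d u', ← Lp.inner_fourier_eq u d', inner_eq_integral,
    inner_eq_integral, ← integral_neg]
  apply integral_congr_ae
  filter_upwards [h.fourier, h'.fourier] with ξ e1 e2
  rw [e1, e2, map_mul, map_mul, Complex.conj_ofReal, Complex.conj_I]
  ring

/-- The time `t - 2πξ/k` elapsed since the critical time `2πξ/k` of the frequency `ξ`, at which the
symbol of `∂_z - i k t` vanishes. -/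
noncomputable def relTime (k t ξ : ℝ) : ℝ := t - 2 * Real.pi * ξ / k

/-- The symbol `(1 + (t - 2πξ/k)²)^{-1/2}`, the square root of the symbol of
`k² (k² - (∂_z - i k t)²)⁻¹`. -/
noncomputable def dissSymbol (k t ξ : ℝ) : ℝ := (√(1 + relTime k t ξ ^ 2))⁻¹

/-- The bounded decreasing weight `π - arctan (t - 2πξ/k)`, whose time derivative is
`-(1 + (t - 2πξ/k)²)⁻¹`. -/
noncomputable def weightSymbol (k t ξ : ℝ) : ℝ := Real.pi - Real.arctan (relTime k t ξ)

lemma continuous_relTime (k t : ℝ) : Continuous (relTime k t) := by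
  unfold relTime; fun_prop

lemma dissSymbol_nonneg (k t ξ : ℝ) : 0 ≤ dissSymbol k t ξ := by unfold dissSymbol; positivity

lemma dissSymbol_sq (k t ξ : ℝ) : dissSymbol k t ξ ^ 2 = (1 + relTime k t ξ ^ 2)⁻¹ := by
  rw [dissSymbol, inv_pow, Real.sq_sqrt (by positivity)]

lemma dissSymbol_le_one (k t ξ : ℝ) : dissSymbol k t ξ ≤ 1 := by
  rw [dissSymbol]
  exact inv_le_one_of_one_le₀ (Real.one_le_sqrt.2 (by nlinarith [sq_nonneg (relTime k t ξ)]))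

lemma continuous_dissSymbol (k t : ℝ) : Continuous (dissSymbol k t) := by
  unfold dissSymbol
  exact ((continuous_const.add ((continuous_relTime k t).pow 2)).sqrt).inv₀
    (fun ξ => (Real.sqrt_pos.2 (add_pos_of_pos_of_nonneg one_pos (sq_nonneg (relTime k t ξ)))).ne')

lemma continuous_weightSymbol (k t : ℝ) : Continuous (weightSymbol k t) := by
  unfold weightSymbol
  exact continuous_const.sub (Real.continuous_arctan.comp (continuous_relTime k t))

lemma weightSymbol_ge (k t ξ : ℝ) : 3 / 2 ≤ weightSymbol k t ξ := by
  unfold weightSymbol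
  linarith [Real.arctan_lt_pi_div_two (relTime k t ξ), Real.pi_gt_three]

lemma weightSymbol_le (k t ξ : ℝ) : weightSymbol k t ξ ≤ 5 := by
  unfold weightSymbol
  linarith [Real.neg_pi_div_two_lt_arctan (relTime k t ξ), Real.pi_lt_d2]

lemma memLp_top_ofReal {a : ℝ → ℝ} (ha : Continuous a) {C : ℝ} (hC : ∀ x, |a x| ≤ C) :
    MemLp (fun x => (a x : ℂ)) ∞ (volume : Measure ℝ) :=
  memLp_top_of_continuous (Complex.continuous_ofReal.comp ha) (C := C) fun x => by
    rw [Complex.norm_real]; exact hC x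

lemma memLp_dissSymbol (k t : ℝ) :
    MemLp (fun ξ => (dissSymbol k t ξ : ℂ)) ∞ (volume : Measure ℝ) :=
  memLp_top_ofReal (continuous_dissSymbol k t) (C := 1) fun ξ => by
    rw [abs_of_nonneg (dissSymbol_nonneg k t ξ)]; exact dissSymbol_le_one k t ξ

lemma weightSymbol_abs_le (k t ξ : ℝ) : |weightSymbol k t ξ| ≤ 5 := by
  rw [abs_of_nonneg (by linarith [weightSymbol_ge k t ξ])]; exact weightSymbol_le k t ξ

lemma memLp_weightSymbol (k t : ℝ) :
    MemLp (fun ξ => (weightSymbol k t ξ : ℂ)) ∞ (volume : Measure ℝ) :=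
  memLp_top_ofReal (continuous_weightSymbol k t) (weightSymbol_abs_le k t)

/-- The operator with symbol `(1 + (t - 2πξ/k)²)^{-1/2}`, without the inverse Fourier transform: the
value is a function of `ξ`, and only its norm matters. -/
noncomputable def dissOp (k t : ℝ) : L2R →L[ℂ] L2R :=
  mulOp volume (fun ξ => (dissSymbol k t ξ : ℂ)) ∘L
    (Lp.fourierTransformₗᵢ ℝ ℂ).toContinuousLinearEquiv.toContinuousLinearMap

/-- Multiplication by the symbol `π - arctan (t - 2πξ/k)`, acting on functions of the Fourier
variable `ξ`. -/
noncomputable def weightOp (k t : ℝ) : L2R →L[ℂ] L2R :=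
  mulOp volume (fun ξ => (weightSymbol k t ξ : ℂ))

lemma dissOp_apply (k t : ℝ) (u : L2R) :
    dissOp k t u = mulOp volume (fun ξ => (dissSymbol k t ξ : ℂ)) (𝓕 u) := rfl

/-- Duality: the smoothed norm of `U` controls its pairing with any `v` whose elliptic norm
`‖v‖ + ‖d‖ / |k|`, where `d = (∂_z - i k t) v`, is finite. -/
lemma HasD.norm_inner_fourier_le {k t : ℝ} (hk : k ≠ 0) {v d : L2R} (h : HasD k t v d) (U : L2R) :
    ‖(inner ℂ U (𝓕 v : L2R) : ℂ)‖
      ≤ ‖mulOp volume (fun ξ => (dissSymbol k t ξ : ℂ)) U‖ * (‖v‖ + ‖d‖ / |k|) := by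
  set r := dissSymbol k t with hr
  set b : ℝ → ℂ := fun ξ => (r ξ * relTime k t ξ : ℝ) * (Complex.I / k) with hb
  have hrt : ∀ ξ, |r ξ * relTime k t ξ| ≤ 1 := by
    intro ξ
    rw [← sq_le_one_iff_abs_le_one, mul_pow, dissSymbol_sq, inv_mul_le_iff₀ (by positivity)]
    linarith
  have hbn : ∀ ξ, ‖b ξ‖ ≤ 1 / |k| := by
    intro ξ
    rw [hb]
    simp only [norm_mul, norm_div, Complex.norm_I, Complex.norm_real]
    exact mul_le_of_le_one_left (by positivity) (by rw [← norm_mul]; exact hrt ξ)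
  have hbm : MemLp b ∞ volume := by
    refine memLp_top_of_continuous (Continuous.mul (Complex.continuous_ofReal.comp ?_)
      continuous_const) hbn
    exact (continuous_dissSymbol k t).mul (continuous_relTime k t)
  have hrm := memLp_dissSymbol k t
  -- With `τ = relTime k t ξ` the identity `r² (1 + τ²) = 1` writes `𝓕 v = r G`, where
  -- `G = r 𝓕 v + b 𝓕 d` is bounded by the elliptic norm of `v`; one factor `r` then goes to `U`.
  set G : L2R := mulOp volume (fun ξ => (r ξ : ℂ)) (𝓕 v : L2R) + mulOp volume b (𝓕 d : L2R) with hG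
  have hGn : ‖G‖ ≤ ‖v‖ + ‖d‖ / |k| := by
    refine (norm_add_le _ _).trans (add_le_add ?_ ?_)
    · refine (norm_mulOp_le hrm (C := 1) (fun ξ => ?_) _).trans ?_
      · rw [Complex.norm_real, Real.norm_of_nonneg (dissSymbol_nonneg k t ξ)]
        exact dissSymbol_le_one k t ξ
      · rw [one_mul, Lp.norm_fourier_eq]
    · refine (norm_mulOp_le hbm hbn _).trans ?_
      rw [Lp.norm_fourier_eq, one_div, inv_mul_eq_div]
  have hv : (𝓕 v : L2R) = mulOp volume (fun ξ => (r ξ : ℂ)) G := by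
    apply Lp.ext
    filter_upwards [mulOp_coe hrm G, Lp.coeFn_add (mulOp volume (fun ξ => (r ξ : ℂ)) (𝓕 v : L2R))
      (mulOp volume b (𝓕 d : L2R)), mulOp_coe hrm (𝓕 v : L2R), mulOp_coe hbm (𝓕 d : L2R),
      h.fourier] with ξ h1 h2 h3 h4 h5
    rw [h1, hG, h2, Pi.add_apply, h3, h4, h5]
    have e1 : (r ξ : ℂ) ^ 2 * (1 + (relTime k t ξ : ℂ) ^ 2) = 1 := by
      rw [← Complex.ofReal_pow, dissSymbol_sq]
      push_cast
      exact inv_mul_cancel₀ (by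
        have : (1 + (relTime k t ξ) ^ 2 : ℝ) ≠ 0 := by positivity
        exact_mod_cast this)
    have e2 : ((2 * Real.pi * ξ - k * t : ℝ) : ℂ) = -((k : ℂ) * (relTime k t ξ : ℂ)) := by
      rw [← Complex.ofReal_mul, ← Complex.ofReal_neg]
      congr 1
      rw [relTime]; field_simp; ring
    have hk' : (k : ℂ) ≠ 0 := by exact_mod_cast hk
    rw [e2, hb]
    simp only [Complex.ofReal_mul]
    have e3 : (Complex.I / (k : ℂ)) * (-((k : ℂ) * (relTime k t ξ : ℂ)) * Complex.I)
        = relTime k t ξ := by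
      field_simp
      rw [Complex.I_sq]; ring
    calc _ = ((r ξ : ℂ) ^ 2 * (1 + (relTime k t ξ : ℂ) ^ 2)) * (𝓕 v : L2R) ξ := by
          rw [e1, one_mul]
      _ = (r ξ : ℂ) ^ 2 * (1 + (relTime k t ξ : ℂ) * ((Complex.I / (k : ℂ))
            * (-((k : ℂ) * (relTime k t ξ : ℂ)) * Complex.I))) * (𝓕 v : L2R) ξ := by
          rw [e3]; ring
      _ = _ := by ring
  rw [hv, ← inner_mulOp_left hrm]
  exact (norm_inner_le_norm _ _).trans (mul_le_mul_of_nonneg_left hGn (norm_nonneg _))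

/-- The norm `‖dissOp k t u‖` dissipated by the energy controls the pairing of `u` with functions of
finite elliptic norm. -/
lemma HasD.norm_inner_le {k t : ℝ} (hk : k ≠ 0) {v d : L2R} (h : HasD k t v d) (u : L2R) :
    ‖(inner ℂ u v : ℂ)‖ ≤ ‖dissOp k t u‖ * (‖v‖ + ‖d‖ / |k|) := by
  rw [← Lp.inner_fourier_eq]
  exact h.norm_inner_fourier_le hk _

/-- The duality persists with the energy weight inserted, since the weight commutes with the
smoothing and is at most `5`. -/
lemma HasD.norm_inner_weightOp_le {k t : ℝ} (hk : k ≠ 0) {v d : L2R} (h : HasD k t v d) (u : L2R) :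
    ‖(inner ℂ (weightOp k t (𝓕 u)) (𝓕 v : L2R) : ℂ)‖
      ≤ 5 * ‖dissOp k t u‖ * (‖v‖ + ‖d‖ / |k|) := by
  refine (h.norm_inner_fourier_le hk _).trans (mul_le_mul_of_nonneg_right ?_ (by positivity))
  rw [dissOp_apply, weightOp]
  apply norm_le_of_ae_le
  filter_upwards [mulOp_coe (memLp_dissSymbol k t) (mulOp volume (fun ξ => (weightSymbol k t ξ : ℂ))
    (𝓕 u)), mulOp_coe (memLp_weightSymbol k t) (𝓕 u : L2R),
    mulOp_coe (memLp_dissSymbol k t) (𝓕 u : L2R)] with ξ h1 h2 h3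
  rw [h1, h2, h3, mul_left_comm, norm_mul, Complex.norm_real]
  exact mul_le_mul_of_nonneg_right (weightSymbol_abs_le k t ξ) (norm_nonneg _)

/-- Taylor's formula for `arctan`, with a remainder that is uniform in the base point. -/
lemma abs_arctan_sub_sub_le (x y : ℝ) :
    |Real.arctan y - Real.arctan x - (y - x) * (1 + x ^ 2)⁻¹| ≤ |y - x| ^ 2 := by
  have hlip : ∀ a, |(1 + a ^ 2 : ℝ)⁻¹ - (1 + x ^ 2)⁻¹| ≤ |a - x| := by
    intro a
    rw [inv_sub_inv (by positivity) (by positivity), abs_div,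
      abs_of_pos (by positivity : (0 : ℝ) < (1 + a ^ 2) * (1 + x ^ 2)), div_le_iff₀ (by positivity)]
    have e : (1 + x ^ 2 : ℝ) - (1 + a ^ 2) = (x - a) * (x + a) := by ring
    rw [e, abs_mul, abs_sub_comm x a]
    refine mul_le_mul_of_nonneg_left ?_ (abs_nonneg _)
    rw [abs_le]
    constructor <;> nlinarith [sq_nonneg (a - 1), sq_nonneg (x - 1), sq_nonneg (a + 1),
      sq_nonneg (x + 1), sq_nonneg (a * x)]
  have hd : ∀ a ∈ Set.uIcc x y, HasDerivWithinAt (fun a => Real.arctan a - a * (1 + x ^ 2)⁻¹)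
      ((1 + a ^ 2)⁻¹ - (1 + x ^ 2)⁻¹) (Set.uIcc x y) a := by
    intro a _
    have := (Real.hasDerivAt_arctan a).sub ((hasDerivAt_id a).mul_const ((1 + x ^ 2 : ℝ)⁻¹))
    simp only [one_div, one_mul] at this
    exact this.hasDerivWithinAt
  have := Convex.norm_image_sub_le_of_norm_hasDerivWithin_le hd (C := |y - x|)
    (fun a ha => (hlip a).trans (Set.abs_sub_left_of_mem_uIcc ha))
    (convex_uIcc x y) Set.left_mem_uIcc Set.right_mem_uIcc
  simp only [Real.norm_eq_abs] at this
  rw [sq |y - x|]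
  refine le_of_eq_of_le ?_ this
  congr 1
  ring

lemma memLp_dissSymbol_sq (k t : ℝ) :
    MemLp (fun ξ => ((dissSymbol k t ξ ^ 2 : ℝ) : ℂ)) ∞ (volume : Measure ℝ) :=
  memLp_top_ofReal ((continuous_dissSymbol k t).pow 2) (C := 1) fun ξ => by
    rw [abs_of_nonneg (by positivity)]
    exact pow_le_one₀ (dissSymbol_nonneg k t ξ) (dissSymbol_le_one k t ξ)

/-- The weight is differentiable in operator norm, because the remainder in the Taylor expansion of
its symbol is bounded uniformly in `ξ`. -/
lemma hasDerivAt_weightOp (k t : ℝ) :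
    HasDerivAt (fun τ => (weightOp k τ).restrictScalars ℝ)
      (-(mulOp volume (fun ξ => ((dissSymbol k t ξ ^ 2 : ℝ) : ℂ))).restrictScalars ℝ) t := by
  rw [hasDerivAt_iff_isLittleO]
  refine Asymptotics.IsBigO.trans_isLittleO (g := fun τ => |τ - t| ^ 2) ?_ ?_
  · refine Asymptotics.IsBigO.of_bound 1 (Filter.Eventually.of_forall fun τ => ?_)
    rw [one_mul, Real.norm_of_nonneg (by positivity)]
    refine ContinuousLinearMap.opNorm_le_bound _ (by positivity) fun u => ?_
    apply norm_le_of_ae_le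
    have h1 := mulOp_coe (memLp_weightSymbol k τ) u
    have h2 := mulOp_coe (memLp_weightSymbol k t) u
    have h3 := mulOp_coe (memLp_dissSymbol_sq k t) u
    have e : ((weightOp k τ).restrictScalars ℝ - (weightOp k t).restrictScalars ℝ
      - (τ - t) • (-(mulOp volume (fun ξ => ((dissSymbol k t ξ ^ 2 : ℝ) : ℂ))).restrictScalars ℝ)) u
      = mulOp volume (fun ξ => (weightSymbol k τ ξ : ℂ)) u
        - mulOp volume (fun ξ => (weightSymbol k t ξ : ℂ)) u
        + ((τ - t : ℝ) : ℂ) • mulOp volume (fun ξ => ((dissSymbol k t ξ ^ 2 : ℝ) : ℂ)) u := by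
      simp only [weightOp, smul_neg, sub_neg_eq_add, Complex.coe_smul]
      rfl
    rw [e]
    filter_upwards [h1, h2, h3, Lp.coeFn_add (mulOp volume (fun ξ => (weightSymbol k τ ξ : ℂ)) u
        - mulOp volume (fun ξ => (weightSymbol k t ξ : ℂ)) u) (((τ - t : ℝ) : ℂ) • mulOp volume
          (fun ξ => ((dissSymbol k t ξ ^ 2 : ℝ) : ℂ)) u),
      Lp.coeFn_sub (mulOp volume (fun ξ => (weightSymbol k τ ξ : ℂ)) u)
        (mulOp volume (fun ξ => (weightSymbol k t ξ : ℂ)) u),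
      Lp.coeFn_smul ((τ - t : ℝ) : ℂ) (mulOp volume
          (fun ξ => ((dissSymbol k t ξ ^ 2 : ℝ) : ℂ)) u)] with ξ e1 e2 e3 e4 e5 e6
    rw [e4, Pi.add_apply, e5, Pi.sub_apply, e6, Pi.smul_apply, e1, e2, e3, smul_eq_mul, ← sub_mul,
      ← mul_assoc, ← add_mul, norm_mul, ← Complex.ofReal_sub, ← Complex.ofReal_mul,
      ← Complex.ofReal_add, Complex.norm_real]
    refine mul_le_mul_of_nonneg_right ?_ (norm_nonneg _)
    have := abs_arctan_sub_sub_le (relTime k t ξ) (relTime k τ ξ)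
    have e7 : relTime k τ ξ - relTime k t ξ = τ - t := by unfold relTime; ring
    rw [e7] at this
    rw [Real.norm_eq_abs, ← abs_neg, dissSymbol_sq]
    convert! this using 2
    unfold weightSymbol
    ring
  · simp_rw [← Real.norm_eq_abs]
    refine Asymptotics.isLittleO_iff.2 fun c hc => ?_
    filter_upwards [Metric.ball_mem_nhds t hc] with τ hτ
    rw [Metric.mem_ball, dist_eq_norm] at hτ
    rw [norm_pow, norm_norm, sq]
    exact mul_le_mul_of_nonneg_right hτ.le (norm_nonneg _)

/-- The time derivative of the weighted energy: the decrease of the weight contributes the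
dissipation `-‖dissOp k t (u t)‖²`. -/
lemma hasDerivWithinAt_weighted_energy (k : ℝ) {u : ℝ → L2R} {u' : L2R} {s : Set ℝ} {t : ℝ}
    (hu : HasDerivWithinAt u u' s t) :
    HasDerivWithinAt (fun τ => (inner ℂ (𝓕 (u τ) : L2R) (weightOp k τ (𝓕 (u τ)))).re)
      (2 * (inner ℂ (weightOp k t (𝓕 (u t))) (𝓕 u' : L2R)).re - ‖dissOp k t (u t)‖ ^ 2) s t := by
  have h1 : HasDerivWithinAt (fun τ => (𝓕 (u τ) : L2R)) (𝓕 u') s t :=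
    ((Lp.fourierTransformₗᵢ ℝ ℂ).toContinuousLinearEquiv.toContinuousLinearMap.restrictScalars
      ℝ).hasFDerivAt.comp_hasDerivWithinAt t hu
  have h2 := (hasDerivAt_weightOp k t).hasDerivWithinAt (s := s) |>.clm_apply h1
  have h3 := h1.inner ℂ h2
  have h4 := Complex.reCLM.hasFDerivAt.comp_hasDerivWithinAt t h3
  refine h4.congr_deriv ?_
  have hr := memLp_dissSymbol k t
  have hsq : mulOp volume (fun ξ => ((dissSymbol k t ξ ^ 2 : ℝ) : ℂ)) (𝓕 (u t) : L2R)
      = mulOp volume (fun ξ => (dissSymbol k t ξ : ℂ)) (dissOp k t (u t)) := by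
    have hr2 := memLp_dissSymbol_sq k t
    have e : (fun ξ => ((dissSymbol k t ξ ^ 2 : ℝ) : ℂ))
        = fun ξ => (dissSymbol k t ξ : ℂ) * (dissSymbol k t ξ : ℂ) := by
      funext ξ; push_cast; ring
    rw [e] at hr2 ⊢
    rw [dissOp_apply, mulOp_mulOp hr hr hr2]
  have h5 : (inner ℂ (𝓕 (u t) : L2R)
      (mulOp volume (fun ξ => ((dissSymbol k t ξ ^ 2 : ℝ) : ℂ)) (𝓕 (u t) : L2R))).re
      = ‖dissOp k t (u t)‖ ^ 2 := by
    rw [hsq, ← inner_mulOp_left hr, ← dissOp_apply]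
    exact inner_self_eq_norm_sq (𝕜 := ℂ) _
  have h6 : inner ℂ (𝓕 (u t) : L2R) (weightOp k t (𝓕 u'))
      = inner ℂ (weightOp k t (𝓕 (u t))) (𝓕 u' : L2R) :=
    (inner_mulOp_left (memLp_weightSymbol k t) _ _).symm
  have h7 : (inner ℂ (𝓕 u' : L2R) (weightOp k t (𝓕 (u t)))).re
      = (inner ℂ (weightOp k t (𝓕 (u t))) (𝓕 u' : L2R)).re :=
    inner_re_symm (𝕜 := ℂ) _ _
  simp only [neg_apply, ContinuousLinearMap.coe_restrictScalars',
    Complex.reCLM_apply, Complex.add_re, inner_add_right, inner_neg_right, Complex.neg_re]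
  rw [h5, h6, h7]
  ring

end Multiplier

/-! ### Difference quotients of smooth functions -/

section FunctionQuotients

lemma contDiff_fdq {a : ℝ → ℝ} (ha : ContDiff ℝ ∞ a) (v h : ℝ) : ContDiff ℝ ∞ (fdq v h a) := by
  unfold fdq; fun_prop

lemma contDiff_iterate_fdq {a : ℝ → ℝ} (ha : ContDiff ℝ ∞ a) (v h : ℝ) (i : ℕ) :
    ContDiff ℝ ∞ ((fdq v h)^[i] a) := by
  induction i with
  | zero => exact ha
  | succ i ih => rw [Function.iterate_succ_apply']; exact contDiff_fdq ih v h

lemma deriv_fdq {a : ℝ → ℝ} (ha : ContDiff ℝ ∞ a) (v h : ℝ) :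
    deriv (fdq v h a) = fdq v h (deriv a) := by
  funext z
  have hd := ha.differentiable (by simp)
  have h1 : HasDerivAt (fun z => a (z + v)) (deriv a (z + v)) z :=
    (hd (z + v)).hasDerivAt.comp_add_const z v
  exact ((h1.sub (hd z).hasDerivAt).const_smul h⁻¹).deriv

lemma deriv_iterate_fdq {a : ℝ → ℝ} (ha : ContDiff ℝ ∞ a) (v h : ℝ) (i : ℕ) :
    deriv ((fdq v h)^[i] a) = (fdq v h)^[i] (deriv a) := by
  induction i with
  | zero => rfl
  | succ i ih =>
    rw [Function.iterate_succ_apply', Function.iterate_succ_apply',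
      deriv_fdq (contDiff_iterate_fdq ha v h i), ih]

lemma iteratedDeriv_fdq {a : ℝ → ℝ} (ha : ContDiff ℝ ∞ a) (v h : ℝ) (i : ℕ) :
    iteratedDeriv i (fdq v h a) = fdq v h (iteratedDeriv i a) := by
  induction i generalizing a with
  | zero => simp
  | succ i ih =>
    rw [iteratedDeriv_succ', iteratedDeriv_succ', deriv_fdq ha, ih (contDiff_deriv ha)]

/-- The mean value inequality for the difference quotient with step `h`. -/
lemma abs_fdq_le {a : ℝ → ℝ} (ha : Differentiable ℝ a) {C : ℝ} (hC : ∀ z, |deriv a z| ≤ C)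
    (h z : ℝ) : |fdq h h a z| ≤ C := by
  have hC0 : 0 ≤ C := (abs_nonneg _).trans (hC 0)
  rcases eq_or_ne h 0 with rfl | hh
  · simpa [fdq] using hC0
  have := Convex.norm_image_sub_le_of_norm_deriv_le (fun x _ => ha x) (fun x _ => hC x)
    convex_univ (Set.mem_univ z) (Set.mem_univ (z + h))
  rw [add_sub_cancel_left, Real.norm_eq_abs, Real.norm_eq_abs] at this
  rw [fdq, smul_eq_mul, abs_mul, abs_inv, inv_mul_le_iff₀ (by positivity), mul_comm]
  exact this

lemma abs_iterate_fdq_le {a : ℝ → ℝ} (ha : ContDiff ℝ ∞ a) {C : ℝ} (i : ℕ)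
    (hC : ∀ z, |iteratedDeriv i a z| ≤ C) (h z : ℝ) : |(fdq h h)^[i] a z| ≤ C := by
  induction i generalizing a with
  | zero => simpa using hC z
  | succ i ih =>
    rw [Function.iterate_succ_apply]
    refine ih (contDiff_fdq ha h h) fun z => ?_
    rw [iteratedDeriv_fdq ha]
    refine abs_fdq_le (ha.differentiable_iteratedDeriv i (by exact_mod_cast ENat.natCast_lt_top i)) (fun z => ?_) h z
    rw [← iteratedDeriv_succ]
    exact hC z

lemma iterate_fdq_ofReal (a : ℝ → ℝ) (v h : ℝ) (i : ℕ) :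
    (fdq v h)^[i] (fun z => (a z : ℂ)) = fun z => (((fdq v h)^[i] a z : ℝ) : ℂ) := by
  induction i with
  | zero => rfl
  | succ i ih =>
    rw [Function.iterate_succ_apply', Function.iterate_succ_apply', ih]
    funext z
    simp [fdq]

end FunctionQuotients

/-! ### Convolution inequalities for finite sums -/

section Sums

open Finset

/-- Young's inequality for a truncated convolution, combined with the inequality of arithmetic and
geometric means with parameter `σ`. -/
lemma sum_antidiagonal_conv_le {β X Y : ℕ → ℝ} (hβ : ∀ i, 0 ≤ β i) {σ : ℝ} (hσ : 0 < σ) (J : ℕ) :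
    ∑ j ∈ range (J + 1), ∑ il ∈ HasAntidiagonal.antidiagonal j, β il.1 * (X j * Y il.2)
      ≤ (∑ i ∈ range (J + 1), β i) *
        ((σ * ∑ j ∈ range (J + 1), X j ^ 2 + σ⁻¹ * ∑ j ∈ range (J + 1), Y j ^ 2) / 2) := by
  have h1 : ∑ j ∈ range (J + 1), ∑ il ∈ HasAntidiagonal.antidiagonal j, β il.1 * X j ^ 2
      ≤ (∑ i ∈ range (J + 1), β i) * ∑ j ∈ range (J + 1), X j ^ 2 := by
    rw [mul_sum]
    refine sum_le_sum fun j hj => ?_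
    rw [← sum_mul, Nat.sum_antidiagonal_eq_sum_range_succ_mk]
    refine mul_le_mul_of_nonneg_right (sum_le_sum_of_subset_of_nonneg ?_ fun i _ _ => hβ i)
      (sq_nonneg _)
    exact range_mono (by simpa using hj)
  have h2 : ∑ j ∈ range (J + 1), ∑ il ∈ HasAntidiagonal.antidiagonal j, β il.1 * Y il.2 ^ 2
      ≤ (∑ i ∈ range (J + 1), β i) * ∑ j ∈ range (J + 1), Y j ^ 2 := by
    simp_rw [Nat.sum_antidiagonal_eq_sum_range_succ_mk]
    rw [sum_range_diag_flip (J + 1) (fun i l => β i * Y l ^ 2), sum_mul]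
    refine sum_le_sum fun i _ => ?_
    rw [← mul_sum]
    refine mul_le_mul_of_nonneg_left (sum_le_sum_of_subset_of_nonneg ?_ fun i _ _ => sq_nonneg _)
      (hβ i)
    exact range_mono (Nat.sub_le _ _)
  have h3 : ∀ j l, X j * Y l ≤ (σ * X j ^ 2 + σ⁻¹ * Y l ^ 2) / 2 := by
    intro j l
    have e : (σ * X j ^ 2 + σ⁻¹ * Y l ^ 2) / 2 - X j * Y l = σ⁻¹ * (σ * X j - Y l) ^ 2 / 2 := by
      field_simp; ring
    have : 0 ≤ σ⁻¹ * (σ * X j - Y l) ^ 2 / 2 := by positivity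
    linarith
  calc _ ≤ ∑ j ∈ range (J + 1), ∑ il ∈ HasAntidiagonal.antidiagonal j,
        (σ / 2 * (β il.1 * X j ^ 2) + σ⁻¹ / 2 * (β il.1 * Y il.2 ^ 2)) := by
        refine sum_le_sum fun j _ => sum_le_sum fun il _ => ?_
        refine (mul_le_mul_of_nonneg_left (h3 j il.2) (hβ il.1)).trans (le_of_eq ?_)
        ring
    _ = σ / 2 * ∑ j ∈ range (J + 1), ∑ il ∈ HasAntidiagonal.antidiagonal j, β il.1 * X j ^ 2
        + σ⁻¹ / 2 *
          ∑ j ∈ range (J + 1), ∑ il ∈ HasAntidiagonal.antidiagonal j, β il.1 * Y il.2 ^ 2 := by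
        simp_rw [sum_add_distrib, mul_sum]
    _ ≤ _ := by
        have := mul_le_mul_of_nonneg_left h1 (by positivity : 0 ≤ σ / 2)
        have := mul_le_mul_of_nonneg_left h2 (by positivity : 0 ≤ σ⁻¹ / 2)
        refine (add_le_add ‹_› ‹_›).trans (le_of_eq ?_)
        ring

/-- Summation of the elliptic estimates of all orders, the lower orders being absorbed. -/
lemma sum_sq_le_of_elliptic {β P Q : ℕ → ℝ} (hβ : ∀ i, 0 ≤ β i) {b η : ℝ}
    (hb : 0 < b) (hη : 0 < η) (J : ℕ)
    (h : ∀ j, b * P j ^ 2 ≤ η * (Q j * P j)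
      + ∑ il ∈ HasAntidiagonal.antidiagonal j, β il.1 * (P j * P il.2))
    (hsum : ∑ i ∈ range (J + 1), β i ≤ b / 2) :
    ∑ j ∈ range (J + 1), P j ^ 2 ≤ (2 * η / b) ^ 2 * ∑ j ∈ range (J + 1), Q j ^ 2 := by
  set SP := ∑ j ∈ range (J + 1), P j ^ 2
  set SQ := ∑ j ∈ range (J + 1), Q j ^ 2
  have hSP : 0 ≤ SP := sum_nonneg fun _ _ => sq_nonneg _
  have h1 : b * SP ≤ η * ∑ j ∈ range (J + 1), Q j * P j
      + ∑ j ∈ range (J + 1), ∑ il ∈ HasAntidiagonal.antidiagonal j, β il.1 * (P j * P il.2) := by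
    rw [mul_sum, mul_sum, ← sum_add_distrib]
    exact sum_le_sum fun j _ => h j
  have h2 := sum_antidiagonal_conv_le (X := P) (Y := P) hβ one_pos J
  have h3 : (∑ i ∈ range (J + 1), β i) * ((1 * SP + 1⁻¹ * SP) / 2) ≤ b / 2 * SP := by
    have : (1 * SP + 1⁻¹ * SP) / 2 = SP := by norm_num
    rw [this]
    exact mul_le_mul_of_nonneg_right hsum hSP
  have h4 : η * ∑ j ∈ range (J + 1), Q j * P j ≤ b / 4 * SP + η ^ 2 / b * SQ := by
    rw [mul_sum, mul_sum, mul_sum, ← sum_add_distrib]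
    refine sum_le_sum fun j _ => ?_
    have e : b / 4 * P j ^ 2 + η ^ 2 / b * Q j ^ 2 - η * (Q j * P j)
        = (b * P j - 2 * η * Q j) ^ 2 / (4 * b) := by
      field_simp; ring
    have : 0 ≤ (b * P j - 2 * η * Q j) ^ 2 / (4 * b) := by positivity
    linarith
  have h5 : b / 4 * SP ≤ η ^ 2 / b * SQ := by linarith
  have e : (2 * η / b) ^ 2 * SQ = 4 / b * (η ^ 2 / b * SQ) := by field_simp; ring
  rw [e]
  calc SP = 4 / b * (b / 4 * SP) := by field_simp
    _ ≤ _ := mul_le_mul_of_nonneg_left h5 (by positivity)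

/-- The forcing is absorbed by the dissipation. -/
lemma sum_forcing_le {γ P Q : ℕ → ℝ} (hγ : ∀ i, 0 ≤ γ i) {σ : ℝ} (hσ : 0 < σ) (J : ℕ)
    (hP : ∑ j ∈ range (J + 1), P j ^ 2 ≤ σ ^ 2 * ∑ j ∈ range (J + 1), Q j ^ 2)
    (hsum : (∑ i ∈ range (J + 1), γ i) * σ ≤ 1) :
    ∑ j ∈ range (J + 1), ∑ il ∈ HasAntidiagonal.antidiagonal j, γ il.1 * (Q j * P il.2)
      ≤ ∑ j ∈ range (J + 1), Q j ^ 2 := by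
  set SQ := ∑ j ∈ range (J + 1), Q j ^ 2
  have hSQ : 0 ≤ SQ := sum_nonneg fun _ _ => sq_nonneg _
  have hΓ : 0 ≤ ∑ i ∈ range (J + 1), γ i := sum_nonneg fun _ _ => hγ _
  refine (sum_antidiagonal_conv_le (X := Q) (Y := P) hγ hσ J).trans ?_
  have h1 : σ⁻¹ * ∑ j ∈ range (J + 1), P j ^ 2 ≤ σ * SQ := by
    rw [inv_mul_le_iff₀ hσ, ← mul_assoc, ← sq]; exact hP
  calc _ ≤ (∑ i ∈ range (J + 1), γ i) * ((σ * SQ + σ * SQ) / 2) := by gcongr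
    _ = ((∑ i ∈ range (J + 1), γ i) * σ) * SQ := by ring
    _ ≤ _ := mul_le_of_le_one_left hSQ hsum

end Sums

/-! ### The energy estimate for a single mode -/

section Mode

open FourierTransform Finset

/-- Quantitative hypotheses on the coefficients `f` and `m = g²` of a mode: `F i` and `M i` bound the
derivatives of order `i`, and `b` is the ellipticity constant. -/
structure CoeffBounds (f m : ℝ → ℝ) (F M : ℕ → ℝ) (b : ℝ) : Prop where
  f_smooth : ContDiff ℝ ∞ f
  m_smooth : ContDiff ℝ ∞ m
  f_le : ∀ i z, |iteratedDeriv i f z| ≤ F i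
  m_le : ∀ i z, |iteratedDeriv i m z| ≤ M i
  m_ge : ∀ z, b ≤ m z

/-- The elliptic equation `-k² ψ + D (m D ψ) - f D ψ = u` for the `k`-th mode, where
`D = ∂_z - i k t` and `d = D ψ`. With `m = g²` and `f = g g'` this is
`(-k² + (g D)²) ψ = u`. -/
def IsModeStream (f m : ℝ → ℝ) (k t : ℝ) (u ψ d : L2R) : Prop :=
  HasD k t ψ d ∧ HasD k t (mulOp volume (fun z => (m z : ℂ)) d)
    (u + ((k ^ 2 : ℝ) : ℂ) • ψ + mulOp volume (fun z => (f z : ℂ)) d)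

/-- The function `w` solves `∂ₜ w + i k f ψ = 0` with `ψ` the stream function of `w`. -/
def IsModeSolution (f m : ℝ → ℝ) (k : ℝ) (w : ℝ → L2R) : Prop :=
  ∀ t : ℝ, 0 ≤ t → ∃ ψ d : L2R, IsModeStream f m k t (w t) ψ d ∧
    HasDerivWithinAt w (-((k : ℂ) * Complex.I) • mulOp volume (fun z => (f z : ℂ)) ψ)
      (Set.Ici 0) t

lemma memLp_of_bound {a : ℝ → ℝ} (ha : ContDiff ℝ ∞ a) {A : ℕ → ℝ}
    (hA : ∀ i z, |iteratedDeriv i a z| ≤ A i) : MemLp (fun z => (a z : ℂ)) ∞ volume :=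
  memLp_top_ofReal ha.continuous (C := A 0) fun z => by simpa using hA 0 z

lemma norm_mulOp_iterate_fdq_le {a : ℝ → ℝ} (ha : ContDiff ℝ ∞ a) {A : ℕ → ℝ}
    (hA : ∀ i z, |iteratedDeriv i a z| ≤ A i) (h : ℝ) (i : ℕ) (v : L2R) :
    ‖mulOp volume ((fdq h h)^[i] (fun z => (a z : ℂ))) v‖ ≤ A i * ‖v‖ :=
  norm_mulOp_le (memLp_top_iterate_fdq (memLp_of_bound ha hA) h h i) (fun z => by
    rw [iterate_fdq_ofReal, Complex.norm_real]
    exact abs_iterate_fdq_le ha i (hA i) h z) v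

/-- The Leibniz rule as an estimate. -/
lemma norm_dq_pow_mulOp_le {a : ℝ → ℝ} (ha : ContDiff ℝ ∞ a) {A : ℕ → ℝ}
    (hA : ∀ i z, |iteratedDeriv i a z| ≤ A i) (h : ℝ) (j : ℕ) (v : L2R) :
    ‖(dq volume h h ^ j) (mulOp volume (fun z => (a z : ℂ)) v)‖
      ≤ ∑ il ∈ HasAntidiagonal.antidiagonal j,
        (j.choose il.1 : ℝ) * (A il.1 * ‖(dq volume h h ^ il.2) v‖) := by
  rw [dq_pow_mulOp (memLp_of_bound ha hA)]
  refine (norm_sum_le _ _).trans (sum_le_sum fun il _ => ?_)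
  rw [← Nat.cast_smul_eq_nsmul ℝ, norm_smul, Real.norm_of_nonneg (Nat.cast_nonneg _)]
  refine mul_le_mul_of_nonneg_left ?_ (Nat.cast_nonneg _)
  refine (norm_mulOp_iterate_fdq_le ha hA h _ _).trans (le_of_eq ?_)
  rw [norm_trans_pow]

/-- The commutator of difference quotients and multiplication by `a`: the term in which `a` is not
differenced drops out. -/
lemma norm_dq_pow_mulOp_sub_le {a : ℝ → ℝ} (ha : ContDiff ℝ ∞ a) {A : ℕ → ℝ}
    (hA : ∀ i z, |iteratedDeriv i a z| ≤ A i) (h : ℝ) (j : ℕ) (v : L2R) :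
    ‖(dq volume h h ^ j) (mulOp volume (fun z => (a z : ℂ)) v)
        - mulOp volume (fun z => (a z : ℂ)) ((dq volume h h ^ j) v)‖
      ≤ ∑ il ∈ HasAntidiagonal.antidiagonal j,
        (j.choose il.1 : ℝ) * ((if il.1 = 0 then 0 else A il.1) * ‖(dq volume h h ^ il.2) v‖) := by
  have h0 : ((0, j) : ℕ × ℕ) ∈ HasAntidiagonal.antidiagonal j := by
    simp [HasAntidiagonal.mem_antidiagonal]
  rw [dq_pow_mulOp (memLp_of_bound ha hA), ← add_sum_erase _ _ h0, ← add_sum_erase _ _ h0]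
  simp only [Nat.choose_zero_right, one_smul, pow_zero, one_apply_eq_self, Function.iterate_zero,
    id_eq, if_true, zero_mul, mul_zero, zero_add, add_sub_cancel_left]
  refine (norm_sum_le _ _).trans (sum_le_sum fun il hil => ?_)
  have hne : il.1 ≠ 0 := by
    rintro h1
    rw [mem_erase, HasAntidiagonal.mem_antidiagonal] at hil
    exact hil.1 (Prod.ext h1 (by omega))
  rw [if_neg hne, ← Nat.cast_smul_eq_nsmul ℝ, norm_smul, Real.norm_of_nonneg (Nat.cast_nonneg _)]
  refine mul_le_mul_of_nonneg_left ?_ (Nat.cast_nonneg _)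
  refine (norm_mulOp_iterate_fdq_le ha hA h _ _).trans (le_of_eq ?_)
  rw [norm_trans_pow]

/-- The elliptic norm `|k| ‖δʲψ‖ + ‖δʲd‖` of the difference quotients of order `j`. -/
noncomputable def ellNorm (k h : ℝ) (ψ d : L2R) (j : ℕ) : ℝ :=
  |k| * ‖(dq volume h h ^ j) ψ‖ + ‖(dq volume h h ^ j) d‖

lemma ellNorm_nonneg (k h : ℝ) (ψ d : L2R) (j : ℕ) : 0 ≤ ellNorm k h ψ d j := by
  unfold ellNorm; positivity

lemma norm_fst_le_ellNorm {k : ℝ} (hk : k ≠ 0) (h : ℝ) (ψ d : L2R) (j : ℕ) :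
    ‖(dq volume h h ^ j) ψ‖ ≤ ellNorm k h ψ d j / |k| := by
  rw [le_div_iff₀ (abs_pos.2 hk), ellNorm, mul_comm]
  linarith [norm_nonneg ((dq volume h h ^ j) d)]

lemma norm_snd_le_ellNorm (k h : ℝ) (ψ d : L2R) (j : ℕ) :
    ‖(dq volume h h ^ j) d‖ ≤ ellNorm k h ψ d j := by
  unfold ellNorm
  linarith [mul_nonneg (abs_nonneg k) (norm_nonneg ((dq volume h h ^ j) ψ))]

/-- The elliptic estimate of order `j`: the equation for the stream function is differenced `j`
times and paired with `δʲψ`. -/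
lemma IsModeStream.elliptic {f m : ℝ → ℝ} {F M : ℕ → ℝ} {b : ℝ} (hc : CoeffBounds f m F M b)
    (hb1 : b ≤ 1) {k t : ℝ} (hk : k ≠ 0) {u ψ d : L2R} (hs : IsModeStream f m k t u ψ d)
    (hb : 0 ≤ b) (h : ℝ) (j : ℕ) :
    b / 2 * ellNorm k h ψ d j ^ 2 ≤
      |k|⁻¹ * (‖dissOp k t ((dq volume h h ^ j) u)‖ * ellNorm k h ψ d j)
      + ∑ il ∈ HasAntidiagonal.antidiagonal j, (j.choose il.1 : ℝ) *
        ((F il.1 / |k| + if il.1 = 0 then 0 else M il.1)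
          * (ellNorm k h ψ d j * ellNorm k h ψ d il.2)) := by
  have hk' : 0 < |k| := abs_pos.2 hk
  set δ := dq (volume : Measure ℝ) h h ^ j with hδ
  set p := ellNorm k h ψ d with hp
  set fd := mulOp volume (fun z => (f z : ℂ)) d
  set md := mulOp volume (fun z => (m z : ℂ)) d
  have hm := memLp_of_bound hc.m_smooth hc.m_le
  have hD := hs.1.diffQuot_pow h h j
  have hN := hs.2.diffQuot_pow h h j
  -- By antisymmetry of `D = ∂_z - i k t`, pairing `δʲ (D (m d))` with `δʲ ψ` gives
  -- `⟨δʲ u, δʲ ψ⟩ + k² ‖δʲ ψ‖² + ⟨δʲ (f d), δʲ ψ⟩ = -⟨δʲ (m d), δʲ d⟩`.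
  have key := hN.inner_eq_neg hD
  rw [← hδ, map_add, map_add, map_smul, inner_add_left, inner_add_left, inner_smul_left,
    Complex.conj_ofReal] at key
  -- On the right, `m` is moved out of the difference quotients; the commutator is `S`.
  have hSe : δ md = (δ md - mulOp volume (fun z => (m z : ℂ)) (δ d))
      + mulOp volume (fun z => (m z : ℂ)) (δ d) := by abel
  rw [hSe, inner_add_left] at key
  set S := δ md - mulOp volume (fun z => (m z : ℂ)) (δ d) with hS
  have kre := congrArg Complex.re key
  simp only [Complex.add_re, Complex.neg_re, Complex.re_ofReal_mul] at kre
  have e1 : (inner ℂ (δ ψ) (δ ψ) : ℂ).re = ‖δ ψ‖ ^ 2 := inner_self_eq_norm_sq (𝕜 := ℂ) _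
  have e2 : b * ‖δ d‖ ^ 2
      ≤ (inner ℂ (mulOp volume (fun z => (m z : ℂ)) (δ d)) (δ d) : ℂ).re := by
    rw [inner_mulOp_left hm]
    exact le_re_inner_mulOp hm hc.m_ge _
  have e3 : |(inner ℂ (δ u) (δ ψ) : ℂ).re| ≤ |k|⁻¹ * (‖dissOp k t (δ u)‖ * p j) := by
    refine (Complex.abs_re_le_norm _).trans ((hD.norm_inner_le hk _).trans (le_of_eq ?_))
    rw [hp, ellNorm, ← hδ]
    field_simp
  have e4 : |(inner ℂ (δ fd) (δ ψ) : ℂ).re| ≤ ∑ il ∈ HasAntidiagonal.antidiagonal j,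
      (j.choose il.1 : ℝ) * (F il.1 / |k| * (p j * p il.2)) := by
    refine (Complex.abs_re_le_norm _).trans ((norm_inner_le_norm _ _).trans ?_)
    refine (mul_le_mul (norm_dq_pow_mulOp_le hc.f_smooth hc.f_le h j d)
      (norm_fst_le_ellNorm hk h ψ d j) (norm_nonneg _) (sum_nonneg fun il _ => ?_)).trans ?_
    · have : 0 ≤ F il.1 := (abs_nonneg _).trans (hc.f_le il.1 0)
      positivity
    · rw [sum_mul]
      refine sum_le_sum fun il _ => ?_
      have hF : 0 ≤ F il.1 := (abs_nonneg _).trans (hc.f_le il.1 0)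
      have := norm_snd_le_ellNorm k h ψ d il.2
      have hpj := ellNorm_nonneg k h ψ d j
      calc _ ≤ (j.choose il.1 : ℝ) * (F il.1 * p il.2) * (ellNorm k h ψ d j / |k|) := by gcongr
        _ = _ := by rw [hp]; ring
  have e5 : |(inner ℂ S (δ d) : ℂ).re| ≤ ∑ il ∈ HasAntidiagonal.antidiagonal j,
      (j.choose il.1 : ℝ) * ((if il.1 = 0 then 0 else M il.1) * (p j * p il.2)) := by
    refine (Complex.abs_re_le_norm _).trans ((norm_inner_le_norm _ _).trans ?_)
    have hM : ∀ i, 0 ≤ (if i = 0 then 0 else M i) := by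
      intro i; split_ifs
      · rfl
      · exact (abs_nonneg _).trans (hc.m_le i 0)
    refine (mul_le_mul (norm_dq_pow_mulOp_sub_le hc.m_smooth hc.m_le h j d)
      (norm_snd_le_ellNorm k h ψ d j) (norm_nonneg _) (sum_nonneg fun il _ => ?_)).trans ?_
    · have := hM il.1
      positivity
    · rw [sum_mul]
      refine sum_le_sum fun il _ => ?_
      have hM' := hM il.1
      have := norm_snd_le_ellNorm k h ψ d il.2
      have hpj := ellNorm_nonneg k h ψ d j
      calc _ ≤ (j.choose il.1 : ℝ) * ((if il.1 = 0 then 0 else M il.1) * p il.2)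
            * (ellNorm k h ψ d j) := by gcongr
        _ = _ := by rw [hp]; ring
  have e6 : b / 2 * p j ^ 2 ≤ k ^ 2 * ‖δ ψ‖ ^ 2 + b * ‖δ d‖ ^ 2 := by
    have h1 : p j ^ 2 ≤ 2 * ((|k| * ‖δ ψ‖) ^ 2 + ‖δ d‖ ^ 2) := by
      rw [hp, ellNorm, ← hδ]
      nlinarith [sq_nonneg (|k| * ‖δ ψ‖ - ‖δ d‖)]
    rw [mul_pow, sq_abs] at h1
    have h2 : b * (k ^ 2 * ‖δ ψ‖ ^ 2) ≤ k ^ 2 * ‖δ ψ‖ ^ 2 := mul_le_of_le_one_left (by positivity) hb1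
    nlinarith
  have e7 : ∑ il ∈ HasAntidiagonal.antidiagonal j, (j.choose il.1 : ℝ) *
        ((F il.1 / |k| + if il.1 = 0 then 0 else M il.1) * (p j * p il.2))
      = ∑ il ∈ HasAntidiagonal.antidiagonal j, (j.choose il.1 : ℝ) *
          (F il.1 / |k| * (p j * p il.2))
        + ∑ il ∈ HasAntidiagonal.antidiagonal j, (j.choose il.1 : ℝ) *
          ((if il.1 = 0 then 0 else M il.1) * (p j * p il.2)) := by
    rw [← sum_add_distrib]
    refine sum_congr rfl fun il _ => ?_
    ring
  rw [e7]
  rw [e1] at kre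
  have := neg_abs_le (inner ℂ (δ u) (δ ψ) : ℂ).re
  have := neg_abs_le (inner ℂ (δ fd) (δ ψ) : ℂ).re
  have := neg_abs_le (inner ℂ S (δ d) : ℂ).re
  linarith

/-- The forcing `∂ₜ δʲw`, paired with the weighted `δʲw`, is controlled by the dissipation of the
multiplier and by the elliptic norms. -/
lemma IsModeStream.forcing {f m : ℝ → ℝ} {F M : ℕ → ℝ} {b : ℝ} (hc : CoeffBounds f m F M b)
    {k t : ℝ} (hk : k ≠ 0) {u ψ d : L2R} (hs : IsModeStream f m k t u ψ d) (h : ℝ) (j : ℕ) :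
    2 * (inner ℂ (weightOp k t (𝓕 ((dq volume h h ^ j) u)))
        (𝓕 ((dq volume h h ^ j) (-((k : ℂ) * Complex.I) •
          mulOp volume (fun z => (f z : ℂ)) ψ)) : L2R)).re
      ≤ ∑ il ∈ HasAntidiagonal.antidiagonal j, (j.choose il.1 : ℝ) *
        (10 * (F il.1 + F (il.1 + 1) / |k|)
          * (‖dissOp k t ((dq volume h h ^ j) u)‖ * ellNorm k h ψ d il.2)) := by
  have hk' : 0 < |k| := abs_pos.2 hk
  set U := (dq (volume : Measure ℝ) h h ^ j) u
  set q := ‖dissOp k t U‖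
  have hF0 : ∀ i, 0 ≤ F i := fun i => (abs_nonneg _).trans (hc.f_le i 0)
  have hf' : ∀ i z, |iteratedDeriv i (deriv f) z| ≤ F (i + 1) := by
    intro i z; rw [← iteratedDeriv_succ']; exact hc.f_le (i + 1) z
  have hff := memLp_of_bound hc.f_smooth hc.f_le
  have hff' := memLp_of_bound (contDiff_deriv hc.f_smooth) hf'
  set T : ℕ × ℕ → L2R := fun il => mulOp volume ((fdq h h)^[il.1] fun z => (f z : ℂ))
    ((trans volume h ^ il.1) ((dq volume h h ^ il.2) ψ)) with hT
  -- Each term of the Leibniz rule is a product of `fdq^i f` and a translate of `δˡ ψ`. Its elliptic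
  -- norm, which involves one derivative of `f`, is what the pairing with the dissipation needs.
  have hterm : ∀ il : ℕ × ℕ, |k| * ‖(inner ℂ (weightOp k t (𝓕 U)) (𝓕 (T il) : L2R) : ℂ)‖
      ≤ 5 * q * ((F il.1 + F (il.1 + 1) / |k|) * ellNorm k h ψ d il.2) := by
    intro il
    have hD := (hs.1.diffQuot_pow h h il.2).translate_pow h il.1
    have e1 := iterate_fdq_ofReal f h h il.1
    have e2 : (fun z => ((deriv ((fdq h h)^[il.1] f) z : ℝ) : ℂ))
        = (fdq h h)^[il.1] (fun z => ((deriv f z : ℝ) : ℂ)) := by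
      rw [iterate_fdq_ofReal, deriv_iterate_fdq hc.f_smooth]
    have hL := hD.leibniz (contDiff_iterate_fdq hc.f_smooth h h il.1)
      (by rw [← e1]; exact memLp_top_iterate_fdq hff h h il.1)
      (by rw [e2]; exact memLp_top_iterate_fdq hff' h h il.1)
    rw [← e1, e2] at hL
    have h1 := hL.norm_inner_weightOp_le hk U
    have h2 := norm_mulOp_iterate_fdq_le hc.f_smooth hc.f_le h il.1
      ((trans volume h ^ il.1) ((dq volume h h ^ il.2) ψ))
    have h3 := norm_mulOp_iterate_fdq_le (contDiff_deriv hc.f_smooth) (A := fun i => F (i + 1)) hf'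
      h il.1 ((trans volume h ^ il.1) ((dq volume h h ^ il.2) ψ))
    have h4 := norm_mulOp_iterate_fdq_le hc.f_smooth hc.f_le h il.1
      ((trans volume h ^ il.1) ((dq volume h h ^ il.2) d))
    rw [norm_trans_pow] at h2 h3 h4
    have h5 := norm_fst_le_ellNorm hk h ψ d il.2
    set A := ‖(dq volume h h ^ il.2) ψ‖
    set B := ‖(dq volume h h ^ il.2) d‖
    have h6 : ‖T il‖ + ‖mulOp volume ((fdq h h)^[il.1] fun z => ((deriv f z : ℝ) : ℂ))
          ((trans volume h ^ il.1) ((dq volume h h ^ il.2) ψ))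
        + mulOp volume ((fdq h h)^[il.1] fun z => (f z : ℂ))
          ((trans volume h ^ il.1) ((dq volume h h ^ il.2) d))‖ / |k|
        ≤ F il.1 * A + (F (il.1 + 1) * A + F il.1 * B) / |k| :=
      add_le_add h2 (div_le_div_of_nonneg_right ((norm_add_le _ _).trans (add_le_add h3 h4)) hk'.le)
    calc _ ≤ |k| * (5 * q * (F il.1 * A + (F (il.1 + 1) * A + F il.1 * B) / |k|)) := by
          refine mul_le_mul_of_nonneg_left (h1.trans ?_) hk'.le
          exact mul_le_mul_of_nonneg_left h6 (by positivity)
      _ = 5 * q * (F il.1 * ellNorm k h ψ d il.2 + F (il.1 + 1) * A) := by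
          rw [ellNorm]; field_simp; ring
      _ ≤ 5 * q * (F il.1 * ellNorm k h ψ d il.2
            + F (il.1 + 1) * (ellNorm k h ψ d il.2 / |k|)) := by
          have := hF0 (il.1 + 1)
          gcongr
      _ = _ := by ring
  have hexp : (𝓕 ((dq volume h h ^ j) (-((k : ℂ) * Complex.I) •
      mulOp volume (fun z => (f z : ℂ)) ψ)) : L2R)
      = -((k : ℂ) * Complex.I) • ∑ il ∈ HasAntidiagonal.antidiagonal j,
        ((j.choose il.1 : ℝ) : ℂ) • (𝓕 (T il) : L2R) := by
    rw [map_smul, dq_pow_mulOp hff]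
    change Lp.fourierTransformₗᵢ ℝ ℂ _ = _ • ∑ il ∈ HasAntidiagonal.antidiagonal j,
        _ • Lp.fourierTransformₗᵢ ℝ ℂ _
    rw [map_smul, map_sum]
    congr 1
    refine sum_congr rfl fun il _ => ?_
    rw [← Nat.cast_smul_eq_nsmul ℂ, map_smul, Complex.ofReal_natCast]
  rw [hexp, inner_smul_right, inner_sum]
  have hn : ‖-((k : ℂ) * Complex.I)‖ = |k| := by simp
  calc _ ≤ 2 * (|k| * ∑ il ∈ HasAntidiagonal.antidiagonal j, (j.choose il.1 : ℝ)
        * ‖(inner ℂ (weightOp k t (𝓕 U)) (𝓕 (T il) : L2R) : ℂ)‖) := by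
        refine mul_le_mul_of_nonneg_left ((Complex.re_le_norm _).trans ?_) (by norm_num)
        rw [norm_mul, hn]
        refine mul_le_mul_of_nonneg_left ((norm_sum_le _ _).trans
          (le_of_eq (sum_congr rfl fun il _ => ?_))) hk'.le
        rw [inner_smul_right, norm_mul, Complex.norm_real, Real.norm_of_nonneg (Nat.cast_nonneg _)]
    _ = ∑ il ∈ HasAntidiagonal.antidiagonal j, 2 * ((j.choose il.1 : ℝ) *
          (|k| * ‖(inner ℂ (weightOp k t (𝓕 U)) (𝓕 (T il) : L2R) : ℂ)‖)) := by
        rw [mul_sum, mul_sum]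
        refine sum_congr rfl fun il _ => ?_
        ring
    _ ≤ _ := by
        refine sum_le_sum fun il _ => ?_
        calc _ ≤ 2 * ((j.choose il.1 : ℝ) *
              (5 * q * ((F il.1 + F (il.1 + 1) / |k|) * ellNorm k h ψ d il.2))) := by
              have := hterm il
              gcongr
          _ = _ := by ring

/-- The energy estimate: if the weighted coefficients are small, the weighted norm of the difference
quotients of a mode grows at most by a constant factor, uniformly in time. -/
theorem IsModeSolution.sum_norm_dq_le {f m : ℝ → ℝ} {F M : ℕ → ℝ} {b : ℝ}
    (hc : CoeffBounds f m F M b) (hb : 0 < b) (hb1 : b ≤ 1) {k : ℝ} (hk : k ≠ 0) {w : ℝ → L2R}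
    (hw : IsModeSolution f m k w) {W : ℕ → ℝ} (hW0 : ∀ j, 0 ≤ W j)
    (hW : ∀ i l, ((i + l).choose i : ℝ) * W (i + l) ≤ W i * W l) (J : ℕ)
    (hell : ∑ i ∈ range (J + 1), W i * (F i / |k| + if i = 0 then 0 else M i) ≤ b / 4)
    (hfor : (∑ i ∈ range (J + 1), W i * (10 * (F i + F (i + 1) / |k|))) * (4 / (|k| * b)) ≤ 1)
    (h : ℝ) {t : ℝ} (ht : 0 ≤ t) :
    ∑ j ∈ range (J + 1), W j ^ 2 * ‖(dq volume h h ^ j) (w t)‖ ^ 2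
      ≤ 4 * ∑ j ∈ range (J + 1), W j ^ 2 * ‖(dq volume h h ^ j) (w 0)‖ ^ 2 := by
  have hk' : 0 < |k| := abs_pos.2 hk
  have hF0 : ∀ i, 0 ≤ F i := fun i => (abs_nonneg _).trans (hc.f_le i 0)
  have hM0 : ∀ i, 0 ≤ (if i = 0 then 0 else M i) := by
    intro i; split_ifs
    · rfl
    · exact (abs_nonneg _).trans (hc.m_le i 0)
  set δ : ℕ → L2R →L[ℂ] L2R := fun j => dq volume h h ^ j with hδ
  set e : ℕ → ℝ → ℝ := fun j τ =>
    (inner ℂ (𝓕 (δ j (w τ)) : L2R) (weightOp k τ (𝓕 (δ j (w τ))))).re with he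
  set E : ℝ → ℝ := fun τ => ∑ j ∈ range (J + 1), W j ^ 2 * e j τ with hE
  -- The energy has a nonpositive derivative.
  have hder : ∀ τ, 0 ≤ τ → ∃ E', E' ≤ 0 ∧ HasDerivWithinAt E E' (Set.Ici 0) τ := by
    intro τ hτ
    obtain ⟨ψ, d, hs, hd⟩ := hw τ hτ
    set dw := -((k : ℂ) * Complex.I) • mulOp volume (fun z => (f z : ℂ)) ψ
    have h1 : ∀ j, HasDerivWithinAt (fun τ => δ j (w τ)) (δ j dw) (Set.Ici 0) τ := fun j =>
      ((δ j).restrictScalars ℝ).hasFDerivAt.comp_hasDerivWithinAt τ hd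
    have h2 := fun j => hasDerivWithinAt_weighted_energy k (h1 j)
    refine ⟨_, ?_, HasDerivWithinAt.fun_sum fun j _ => (h2 j).const_mul (W j ^ 2)⟩
    set p := ellNorm k h ψ d
    set q : ℕ → ℝ := fun j => ‖dissOp k τ (δ j (w τ))‖ with hq
    have hp0 := ellNorm_nonneg k h ψ d
    have hq0 : ∀ j, 0 ≤ q j := fun j => norm_nonneg _
    have hWc : ∀ j, ∀ il ∈ HasAntidiagonal.antidiagonal j,
        (j.choose il.1 : ℝ) * W j ≤ W il.1 * W il.2 := by
      rintro j ⟨i, l⟩ hil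
      rw [HasAntidiagonal.mem_antidiagonal] at hil
      rw [← hil]; exact hW i l
    -- The elliptic estimates multiplied by `W j ^ 2`: the binomial coefficients are absorbed by the
    -- submultiplicativity of the weights.
    have h3 : ∀ j, b / 2 * (W j * p j) ^ 2 ≤ |k|⁻¹ * ((W j * q j) * (W j * p j))
        + ∑ il ∈ HasAntidiagonal.antidiagonal j,
          (W il.1 * (F il.1 / |k| + if il.1 = 0 then 0 else M il.1))
            * ((W j * p j) * (W il.2 * p il.2)) := by
      intro j
      have := mul_le_mul_of_nonneg_left (hs.elliptic hc hb1 hk hb.le h j) (sq_nonneg (W j))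
      calc _ = W j ^ 2 * (b / 2 * p j ^ 2) := by ring
        _ ≤ _ := this
        _ = |k|⁻¹ * ((W j * q j) * (W j * p j)) + ∑ il ∈ HasAntidiagonal.antidiagonal j,
              ((j.choose il.1 : ℝ) * W j) * ((F il.1 / |k| + if il.1 = 0 then 0 else M il.1)
                * ((W j * p j) * p il.2)) := by
            rw [mul_add, mul_sum]
            congr 1
            · ring
            · exact sum_congr rfl fun il _ => by ring
        _ ≤ |k|⁻¹ * ((W j * q j) * (W j * p j)) + ∑ il ∈ HasAntidiagonal.antidiagonal j,
              (W il.1 * W il.2) * ((F il.1 / |k| + if il.1 = 0 then 0 else M il.1)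
                * ((W j * p j) * p il.2)) := by
            refine add_le_add le_rfl (sum_le_sum fun il hil =>
              mul_le_mul_of_nonneg_right (hWc j il hil) ?_)
            have := hF0 il.1; have := hM0 il.1; have := hp0 j; have := hp0 il.2; have := hW0 j
            positivity
        _ = _ := by
            congr 1
            exact sum_congr rfl fun il _ => by ring
    have h4 := sum_sq_le_of_elliptic (β := fun i => W i * (F i / |k| + if i = 0 then 0 else M i))
      (P := fun j => W j * p j) (Q := fun j => W j * q j)
      (fun i => by have := hF0 i; have := hM0 i; have := hW0 i; positivity)
      (half_pos hb) (inv_pos.2 hk') J h3 (by linarith)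
    have hσ : 2 * |k|⁻¹ / (b / 2) = 4 / (|k| * b) := by field_simp; norm_num
    rw [hσ] at h4
    have h5 := sum_forcing_le (γ := fun i => W i * (10 * (F i + F (i + 1) / |k|)))
      (P := fun j => W j * p j) (Q := fun j => W j * q j)
      (fun i => by have := hF0 i; have := hF0 (i + 1); have := hW0 i; positivity)
      (by positivity) J h4 hfor
    have h6 : ∀ j, W j ^ 2 * (2 * (inner ℂ (weightOp k τ (𝓕 (δ j (w τ)))) (𝓕 (δ j dw) : L2R)).re)
        ≤ ∑ il ∈ HasAntidiagonal.antidiagonal j,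
          (W il.1 * (10 * (F il.1 + F (il.1 + 1) / |k|))) * ((W j * q j) * (W il.2 * p il.2)) := by
      intro j
      refine (mul_le_mul_of_nonneg_left (hs.forcing hc hk h j) (sq_nonneg (W j))).trans ?_
      rw [mul_sum]
      refine sum_le_sum fun il hil => ?_
      calc _ = ((j.choose il.1 : ℝ) * W j) * (10 * (F il.1 + F (il.1 + 1) / |k|)
                * ((W j * q j) * p il.2)) := by ring
        _ ≤ (W il.1 * W il.2) * (10 * (F il.1 + F (il.1 + 1) / |k|)
                * ((W j * q j) * p il.2)) := by
            refine mul_le_mul_of_nonneg_right (hWc j il hil) ?_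
            have := hF0 il.1; have := hF0 (il.1 + 1); have := hp0 il.2; have := hW0 j
            have := hq0 j
            positivity
        _ = _ := by ring
    have h7 : ∑ j ∈ range (J + 1), W j ^ 2 *
        (2 * (inner ℂ (weightOp k τ (𝓕 (δ j (w τ)))) (𝓕 (δ j dw) : L2R)).re - q j ^ 2)
        = ∑ j ∈ range (J + 1), W j ^ 2 *
          (2 * (inner ℂ (weightOp k τ (𝓕 (δ j (w τ)))) (𝓕 (δ j dw) : L2R)).re)
          - ∑ j ∈ range (J + 1), (W j * q j) ^ 2 := by
      rw [← sum_sub_distrib]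
      exact sum_congr rfl fun j _ => by ring
    refine le_of_eq_of_le h7 ?_
    have h8 := sum_le_sum (s := range (J + 1)) fun j _ => h6 j
    linarith
  have hanti : AntitoneOn E (Set.Ici 0) := by
    refine antitoneOn_of_deriv_nonpos (convex_Ici 0) ?_ ?_ ?_
    · intro τ hτ
      obtain ⟨E', _, h1⟩ := hder τ hτ
      exact h1.continuousWithinAt
    · intro τ hτ
      rw [interior_Ici] at hτ
      obtain ⟨E', _, h1⟩ := hder τ (le_of_lt hτ)
      exact (h1.hasDerivAt (Ici_mem_nhds hτ)).differentiableAt.differentiableWithinAt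
    · intro τ hτ
      rw [interior_Ici] at hτ
      obtain ⟨E', h0, h1⟩ := hder τ (le_of_lt hτ)
      rw [(h1.hasDerivAt (Ici_mem_nhds hτ)).deriv]
      exact h0
  have hEle := hanti (Set.mem_Ici.2 le_rfl) (Set.mem_Ici.2 ht) ht
  -- The weight lies between `3 / 2` and `5`, and `5 / (3 / 2) ≤ 4`.
  have hlow : ∀ j τ, 3 / 2 * ‖δ j (w τ)‖ ^ 2 ≤ e j τ := by
    intro j τ
    have := le_re_inner_mulOp (memLp_weightSymbol k τ) (weightSymbol_ge k τ)
      (𝓕 (δ j (w τ)) : L2R)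
    rwa [Lp.norm_fourier_eq] at this
  have hup : ∀ j τ, e j τ ≤ 5 * ‖δ j (w τ)‖ ^ 2 := by
    intro j τ
    refine (Complex.re_le_norm _).trans ((norm_inner_le_norm _ _).trans ?_)
    have := norm_mulOp_le (memLp_weightSymbol k τ) (C := 5) (fun ξ => by
      rw [Complex.norm_real]; exact weightSymbol_abs_le k τ ξ) (𝓕 (δ j (w τ)) : L2R)
    rw [Lp.norm_fourier_eq] at this ⊢
    calc _ ≤ ‖δ j (w τ)‖ * (5 * ‖δ j (w τ)‖) := mul_le_mul_of_nonneg_left this (norm_nonneg _)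
      _ = _ := by ring
  have h9 : 3 / 2 * ∑ j ∈ range (J + 1), W j ^ 2 * ‖δ j (w t)‖ ^ 2 ≤ E t := by
    rw [mul_sum]
    refine sum_le_sum fun j _ => ?_
    have := mul_le_mul_of_nonneg_left (hlow j t) (sq_nonneg (W j))
    linarith
  have h10 : E 0 ≤ 5 * ∑ j ∈ range (J + 1), W j ^ 2 * ‖δ j (w 0)‖ ^ 2 := by
    rw [mul_sum]
    refine sum_le_sum fun j _ => ?_
    have := mul_le_mul_of_nonneg_left (hup j 0) (sq_nonneg (W j))
    linarith
  have h11 : 0 ≤ ∑ j ∈ range (J + 1), W j ^ 2 * ‖δ j (w 0)‖ ^ 2 := sum_nonneg fun j _ => by positivity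
  linarith

end Mode

/-! ### Fourier modes in the periodic variable -/

section ModeTests

variable {L : ℝ}

/-- The product test functions `Re (c e_{-n}(x)) θ(z)`. Test functions on the channel are real; the
constant `c` gives access to both the real and the imaginary part of `e_{-n}`. -/
noncomputable def modeTest (L : ℝ) (n : ℤ) (c : ℂ) (θ : ℝ → ℝ) (q : Channel L) : ℝ :=
  (c * fourier (-n) q.1).re * θ q.2

/-- The wave number `2πn/L`. -/
noncomputable def waveNumber (L : ℝ) (n : ℤ) : ℝ := 2 * Real.pi * n / L

lemma fourier_neg_coe (n : ℤ) (x : ℝ) :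
    (fourier (-n) (x : AddCircle L) : ℂ) = Complex.exp (-(waveNumber L n * x : ℝ) * Complex.I) := by
  rw [fourier_coe_apply, waveNumber]
  congr 1
  push_cast
  ring

lemma hasDerivAt_fourier_shift (n : ℤ) (c : ℂ) (x : AddCircle L) :
    HasDerivAt (fun h : ℝ => (c * fourier (-n) (x + (h : AddCircle L))).re)
      ((-(waveNumber L n) * Complex.I * c) * fourier (-n) x).re 0 := by
  have h1 : ∀ h : ℝ, (fourier (-n) (x + (h : AddCircle L)) : ℂ)
      = fourier (-n) x * Complex.exp (-(waveNumber L n * h : ℝ) * Complex.I) := by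
    intro h
    rw [← fourier_neg_coe, fourier_apply, fourier_apply, fourier_apply, smul_add,
      AddCircle.toCircle_add, Circle.coe_mul]
  have h2 : HasDerivAt (fun h : ℝ => c * fourier (-n) (x + (h : AddCircle L)))
      ((-(waveNumber L n) * Complex.I * c) * fourier (-n) x) 0 := by
    simp_rw [h1]
    have h3 : HasDerivAt (fun h : ℝ => (-(waveNumber L n * h : ℝ) * Complex.I : ℂ))
        (-(waveNumber L n) * Complex.I) 0 := by
      have := (((hasDerivAt_id (0 : ℝ)).const_mul (waveNumber L n)).ofReal_comp).neg.mul_const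
        Complex.I
      simpa using this
    have h4 := ((h3.cexp).const_mul (fourier (-n) x : ℂ)).const_mul c
    refine h4.congr_deriv ?_
    simp
    ring
  exact Complex.reCLM.hasFDerivAt.comp_hasDerivAt 0 h2

lemma pdx_modeTest (n : ℤ) (c : ℂ) (θ : ℝ → ℝ) :
    pdx (modeTest L n c θ) = modeTest L n (-(waveNumber L n) * Complex.I * c) θ := by
  funext q
  exact ((hasDerivAt_fourier_shift n c q.1).mul_const (θ q.2)).deriv

lemma pdz_modeTest (n : ℤ) (c : ℂ) (θ : ℝ → ℝ) :
    pdz (modeTest L n c θ) = modeTest L n c (deriv θ) := by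
  funext q
  simp only [pdz, modeTest, deriv_const_mul_field]

lemma iterate_pdx_modeTest (n : ℤ) (c : ℂ) (θ : ℝ → ℝ) (a : ℕ) :
    pdx^[a] (modeTest L n c θ) = modeTest L n ((-(waveNumber L n) * Complex.I) ^ a * c) θ := by
  induction a with
  | zero => simp
  | succ a ih => rw [Function.iterate_succ_apply', ih, pdx_modeTest, pow_succ',
      mul_assoc (-(waveNumber L n : ℂ) * Complex.I)]

lemma iterate_pdz_modeTest (n : ℤ) (c : ℂ) (θ : ℝ → ℝ) (b : ℕ) :
    pdz^[b] (modeTest L n c θ) = modeTest L n c (iteratedDeriv b θ) := by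
  induction b with
  | zero => simp
  | succ b ih => rw [Function.iterate_succ_apply', ih, pdz_modeTest, iteratedDeriv_succ]

lemma continuous_modeTest (n : ℤ) (c : ℂ) {θ : ℝ → ℝ} (h : Continuous θ) :
    Continuous (modeTest L n c θ) := by
  unfold modeTest
  fun_prop

lemma hasCompactSupport_iteratedDeriv {θ : ℝ → ℝ} (h : HasCompactSupport θ) (b : ℕ) :
    HasCompactSupport (iteratedDeriv b θ) := by
  induction b with
  | zero => simpa using h
  | succ b ih => rw [iteratedDeriv_succ]; exact ih.deriv

end ModeTests

section Modes

variable {L : ℝ} [hL : Fact (0 < L)]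

instance : (volume : Measure (Channel L)).IsAddRightInvariant :=
  inferInstanceAs ((volume : Measure (AddCircle L)).prod (volume : Measure ℝ)).IsAddRightInvariant

lemma ae_channel_of_ae {p : ℝ → Prop} (h : ∀ᵐ z : ℝ, p z) :
    ∀ᵐ q : Channel L, p q.2 :=
  (Measure.quasiMeasurePreserving_snd (μ := (volume : Measure (AddCircle L)))
    (ν := (volume : Measure ℝ))).ae h

lemma memLp_fourier (n : ℤ) :
    MemLp (fun q : Channel L => (fourier n q.1 : ℂ)) ∞ volume :=
  memLp_top_of_continuous (by fun_prop) (C := 1) fun q => by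
    rw [fourier_apply]; exact (Circle.norm_coe _).le

lemma memLp_mode (n : ℤ) (θ : L2R) :
    MemLp (fun q : Channel L => (fourier n q.1 : ℂ) * θ q.2) 2 volume :=
  ((Lp.memLp θ).comp_snd (volume : Measure (AddCircle L))).mul (memLp_fourier n)

/-- The embedding `θ ↦ e_n(x) θ(z)` of the `n`-th mode. It has norm `√L`, as lengths on the circle
are not normalized. -/
noncomputable def modeEmb (L : ℝ) [hL : Fact (0 < L)] (n : ℤ) : L2R →L[ℂ] L2 L :=
  LinearMap.mkContinuous
    { toFun := fun θ => (memLp_mode n θ).toLp _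
      map_add' := fun θ η => by
        apply Lp.ext
        filter_upwards [(memLp_mode (L := L) n (θ + η)).coeFn_toLp,
          (memLp_mode (L := L) n θ).coeFn_toLp, (memLp_mode (L := L) n η).coeFn_toLp,
          Lp.coeFn_add ((memLp_mode (L := L) n θ).toLp _) ((memLp_mode (L := L) n η).toLp _),
          ae_channel_of_ae (Lp.coeFn_add θ η)] with q h1 h2 h3 h4 h5
        rw [h1, h4, Pi.add_apply, h2, h3, h5, Pi.add_apply, mul_add]
      map_smul' := fun c θ => by
        apply Lp.ext
        filter_upwards [(memLp_mode (L := L) n (c • θ)).coeFn_toLp,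
          (memLp_mode (L := L) n θ).coeFn_toLp,
          Lp.coeFn_smul c ((memLp_mode (L := L) n θ).toLp _),
          ae_channel_of_ae (Lp.coeFn_smul c θ)] with q h1 h2 h3 h4
        rw [h1, RingHom.id_apply, h3, Pi.smul_apply, h2, h4, Pi.smul_apply, smul_eq_mul,
          smul_eq_mul, mul_left_comm] } (√L) (fun θ => by
    rw [← Real.sqrt_sq (norm_nonneg θ), ← Real.sqrt_mul hL.out.le]
    refine Real.le_sqrt_of_sq_le (le_of_eq ?_)
    rw [norm_sq_eq_integral, norm_sq_eq_integral]
    have h1 : ∫ q : Channel L, ‖((memLp_mode (L := L) n θ).toLp _ : L2 L) q‖ ^ 2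
        = ∫ q : Channel L, ‖θ q.2‖ ^ 2 := by
      apply integral_congr_ae
      filter_upwards [(memLp_mode (L := L) n θ).coeFn_toLp] with q h1
      rw [h1, norm_mul, fourier_apply, Circle.norm_coe, one_mul]
    refine h1.trans ?_
    rw [Measure.volume_eq_prod, integral_fun_snd (fun z => ‖θ z‖ ^ 2)]
    simp [Measure.real, hL.out.le])

lemma modeEmb_coe (n : ℤ) (θ : L2R) :
    modeEmb L n θ =ᵐ[volume] fun q => (fourier n q.1 : ℂ) * θ q.2 :=
  (memLp_mode n θ).coeFn_toLp

/-- The `n`-th mode `z ↦ ∫ e_{-n}(x) u(x, z) dx`, defined as the adjoint of the embedding. -/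
noncomputable def modeProj (n : ℤ) : L2 L →L[ℂ] L2R := (modeEmb L n).adjoint

/-- Testing the `n`-th mode with `θ` amounts to testing the function with `e_{-n}(x) θ(z)`. -/
lemma integral_fourier_mul (n : ℤ) {θ : ℝ → ℝ} (h1 : Continuous θ) (h2 : HasCompactSupport θ)
    (u : L2 L) :
    ∫ q : Channel L, (fourier (-n) q.1 * θ q.2) * u q = ∫ z, θ z • modeProj n u z := by
  have hm : MemLp (fun z => (θ z : ℂ)) 2 (volume : Measure ℝ) :=
    (Complex.continuous_ofReal.comp h1).memLp_of_hasCompactSupport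
      (h2.comp_left (g := Complex.ofReal) rfl)
  have key : inner ℂ (hm.toLp _) (modeProj n u) = inner ℂ (modeEmb L n (hm.toLp _)) u :=
    ContinuousLinearMap.adjoint_inner_right _ _ _
  rw [inner_eq_integral, inner_eq_integral] at key
  refine Eq.trans ?_ (key.symm.trans ?_)
  · apply integral_congr_ae
    filter_upwards [modeEmb_coe (L := L) n (hm.toLp _), ae_channel_of_ae hm.coeFn_toLp] with q e1 e2
    rw [e1, e2, map_mul, Complex.conj_ofReal, ← fourier_neg]
    ring
  · apply integral_congr_ae
    filter_upwards [hm.coeFn_toLp] with z e1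
    rw [e1, Complex.conj_ofReal, Complex.real_smul, mul_comm]

/-- Functions in `L²(ℝ)` are determined by their integrals against real test functions. -/
lemma eq_of_test {u v : L2R}
    (h : ∀ θ : ℝ → ℝ, ContDiff ℝ ∞ θ → HasCompactSupport θ →
      ∫ z, θ z • u z = ∫ z, θ z • v z) : u = v :=
  Lp.ext (ae_eq_of_integral_contDiff_smul_eq ((Lp.memLp u).locallyIntegrable (by norm_num))
    ((Lp.memLp v).locallyIntegrable (by norm_num)) h)

lemma hasCompactSupport_modeTest (n : ℤ) (c : ℂ) {θ : ℝ → ℝ} (h : HasCompactSupport θ) :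
    HasCompactSupport (modeTest L n c θ) := by
  refine HasCompactSupport.intro (isCompact_univ.prod h) fun q hq => ?_
  rw [modeTest, image_eq_zero_of_notMem_tsupport (f := θ) (fun h' => hq ⟨trivial, h'⟩), mul_zero]

lemma isTest_modeTest (n : ℤ) (c : ℂ) {θ : ℝ → ℝ} (h1 : ContDiff ℝ ∞ θ)
    (h2 : HasCompactSupport θ) : IsTest (modeTest L n c θ) := by
  refine ⟨?_, hasCompactSupport_modeTest n c h2⟩
  simp only [modeTest, fourier_neg_coe]
  refine ContDiff.mul ?_ (h1.comp contDiff_snd)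
  refine Complex.reCLM.contDiff.comp (contDiff_const.mul (Complex.contDiff_exp.comp ?_))
  refine ContDiff.mul (ContDiff.neg ?_) contDiff_const
  exact Complex.ofRealCLM.contDiff.comp (contDiff_const.mul contDiff_fst)

/-- The pairing of a function with a complex product test function is assembled from two real
ones. -/
lemma integral_modeTest_add (n : ℤ) (c : ℂ) {θ : ℝ → ℝ} (h1 : Continuous θ)
    (h2 : HasCompactSupport θ) (u : L2 L) :
    (∫ q, modeTest L n c θ q • u q) + Complex.I * ∫ q, modeTest L n (c * -Complex.I) θ q • u q
      = c * ∫ z, θ z • modeProj n u z := by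
  have i1 := fun c => integrable_smul_Lp (continuous_modeTest (L := L) n c h1)
    (hasCompactSupport_modeTest n c h2) u
  rw [← integral_fourier_mul n h1 h2, ← integral_const_mul, ← integral_const_mul,
    ← integral_add (i1 _) ((i1 _).const_mul _)]
  apply integral_congr_ae
  refine Filter.Eventually.of_forall fun q => ?_
  have e : ∀ w : ℂ, w = (w.re : ℂ) + Complex.I * ((-Complex.I * w).re : ℂ) := by
    intro w
    apply Complex.ext <;> simp
  simp only [modeTest, Complex.real_smul]
  have e2 := e (c * fourier (-n) q.1)
  have e3 : -Complex.I * (c * fourier (-n) q.1) = c * -Complex.I * fourier (-n) q.1 := by ring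
  rw [e3] at e2
  calc _ = (((c * fourier (-n) q.1).re : ℂ)
        + Complex.I * ((c * -Complex.I * fourier (-n) q.1).re : ℂ)) * θ q.2 * u q := by
        push_cast; ring
    _ = _ := by rw [← e2]; ring

/-- Weak derivatives on the channel become, for the `n`-th mode, multiplication by powers of
`i k` and weak derivatives on the line. -/
lemma HasWeakDeriv.mode {a b : ℕ} {u v : L2 L} (h : HasWeakDeriv a b u v) (n : ℤ) {θ : ℝ → ℝ}
    (h1 : ContDiff ℝ ∞ θ) (h2 : HasCompactSupport θ) :
    (waveNumber L n * Complex.I) ^ a * ∫ z, iteratedDeriv b θ z • modeProj n u z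
      = (-1) ^ b * ∫ z, θ z • modeProj n v z := by
  have hk := fun c => h (modeTest L n c θ) (isTest_modeTest n c h1 h2)
  simp_rw [iterate_pdz_modeTest, iterate_pdx_modeTest] at hk
  have hc : Continuous (iteratedDeriv b θ) := h1.continuous_iteratedDeriv b (by exact_mod_cast le_top)
  have hs := hasCompactSupport_iteratedDeriv h2 b
  have e1 := integral_modeTest_add n ((-(waveNumber L n) * Complex.I) ^ a) hc hs u
  have e2 := integral_modeTest_add n 1 h1.continuous h2 v
  have hk1 := hk 1
  rw [mul_one] at hk1
  rw [hk1, hk, Complex.real_smul, Complex.real_smul, mul_left_comm, ← mul_add] at e1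
  rw [one_mul, one_mul] at e2
  rw [e2] at e1
  have e3 : (waveNumber L n * Complex.I) ^ a
      = (-1 : ℂ) ^ a * (-(waveNumber L n) * Complex.I) ^ a := by
    rw [← mul_pow]; congr 1; ring
  rw [e3, mul_assoc, ← e1, ← mul_assoc]
  congr 1
  push_cast
  rw [← pow_add, ← add_assoc, pow_add, ← two_mul, pow_mul]
  norm_num

lemma HasWeakDeriv.mode_dx {u v : L2 L} (h : HasWeakDeriv 1 0 u v) (n : ℤ) :
    modeProj n v = (waveNumber L n * Complex.I) • modeProj n u := by
  refine eq_of_test fun θ h1 h2 => ?_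
  have := h.mode n h1 h2
  rw [pow_one, pow_zero, one_mul, iteratedDeriv_zero] at this
  rw [← this, ← integral_const_mul]
  apply integral_congr_ae
  filter_upwards [Lp.coeFn_smul (waveNumber L n * Complex.I) (modeProj n u)] with z hz
  rw [hz, Pi.smul_apply, smul_eq_mul, mul_smul_comm]

lemma HasWeakDeriv.mode_dz {u v : L2 L} (h : HasWeakDeriv 0 1 u v) (n : ℤ) :
    WeakDeriv (modeProj n u) (modeProj n v) := by
  intro θ h1 h2
  have := h.mode n h1 h2
  rw [pow_zero, pow_one, one_mul, iteratedDeriv_one] at this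
  rw [this]; ring

/-- The modes of consecutive vertical derivatives are weak derivatives of one another. -/
lemma HasWeakDeriv.mode_dz_succ {b : ℕ} {u v v' : L2 L} (h : HasWeakDeriv 0 b u v)
    (h' : HasWeakDeriv 0 (b + 1) u v') (n : ℤ) :
    WeakDeriv (modeProj n v) (modeProj n v') := by
  intro θ h1 h2
  have e1 := h.mode n (contDiff_deriv h1) h2.deriv
  have e2 := h'.mode n h1 h2
  rw [iteratedDeriv_succ'] at e2
  rw [pow_zero, one_mul] at e1 e2
  rw [e2, pow_succ, mul_assoc] at e1
  have := mul_left_cancel₀ (pow_ne_zero b (by norm_num : (-1 : ℂ) ≠ 0)) e1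
  rw [← this]; ring

/-- Horizontal derivatives multiply the `n`-th mode by powers of `i k`. -/
lemma HasWeakDeriv.mode_dx_pow {a b : ℕ} {u v v' : L2 L} (h : HasWeakDeriv 0 b u v)
    (h' : HasWeakDeriv a b u v') (n : ℤ) :
    modeProj n v' = ((waveNumber L n * Complex.I) ^ a) • modeProj n v := by
  refine eq_of_test fun θ h1 h2 => ?_
  have e1 := h.mode n h1 h2
  have e2 := h'.mode n h1 h2
  rw [pow_zero, one_mul] at e1
  rw [e1, mul_left_comm] at e2
  rw [← mul_left_cancel₀ (pow_ne_zero b (by norm_num : (-1 : ℂ) ≠ 0)) e2, ← integral_const_mul]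
  apply integral_congr_ae
  filter_upwards [Lp.coeFn_smul ((waveNumber L n * Complex.I) ^ a) (modeProj n v)] with z hz
  rw [hz, Pi.smul_apply, smul_eq_mul, mul_smul_comm]

lemma modeProj_of_hasWeakDeriv_zero {u v : L2 L} (h : HasWeakDeriv 0 0 u v) (n : ℤ) :
    modeProj n v = modeProj n u := by
  refine eq_of_test fun θ h1 h2 => ?_
  have := h.mode n h1 h2
  simpa using this.symm

/-- Vertical translations act on each mode. -/
lemma modeProj_trans_snd (n : ℤ) (h : ℝ) (u : L2 L) :
    modeProj n (trans volume ((0, h) : Channel L) u) = trans volume h (modeProj n u) := by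
  refine eq_of_test fun θ h1 h2 => ?_
  have h1' : Continuous fun z => θ (z - h) := h1.continuous.comp (continuous_id.sub continuous_const)
  have h2' : HasCompactSupport fun z => θ (z - h) := h2.comp_homeomorph (Homeomorph.subRight h)
  have e1 : ∫ z, θ z • (trans volume h (modeProj n u)) z
      = ∫ z, θ (z - h) • modeProj n u z := by
    rw [← integral_add_right_eq_self (fun z => θ (z - h) • modeProj n u z) h]
    apply integral_congr_ae
    filter_upwards [trans_coe h (modeProj n u)] with z hz
    rw [hz, add_sub_cancel_right]
  rw [e1, ← integral_fourier_mul n h1.continuous h2, ← integral_fourier_mul n h1' h2',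
    ← integral_add_right_eq_self (fun q : Channel L => fourier (-n) q.1 * (θ (q.2 - h) : ℂ) * u q)
      ((0, h) : Channel L)]
  apply integral_congr_ae
  filter_upwards [trans_coe ((0, h) : Channel L) u] with q hq
  rw [hq]
  simp

/-- Horizontal translations act on the `n`-th mode by a phase. -/
lemma modeProj_trans_fst (n : ℤ) (h : ℝ) (u : L2 L) :
    modeProj n (trans volume (((h : AddCircle L), 0) : Channel L) u)
      = Complex.exp (Complex.I * (waveNumber L n * h : ℝ)) • modeProj n u := by
  refine eq_of_test fun θ h1 h2 => ?_
  have e1 : ∫ z, θ z • (Complex.exp (Complex.I * (waveNumber L n * h : ℝ)) • modeProj n u : L2R) z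
      = Complex.exp (Complex.I * (waveNumber L n * h : ℝ)) * ∫ z, θ z • modeProj n u z := by
    rw [← integral_const_mul]
    apply integral_congr_ae
    filter_upwards [Lp.coeFn_smul (Complex.exp (Complex.I * (waveNumber L n * h : ℝ)))
      (modeProj n u)] with z hz
    rw [hz, Pi.smul_apply, smul_eq_mul, mul_smul_comm]
  rw [e1, ← integral_fourier_mul n h1.continuous h2, ← integral_fourier_mul n h1.continuous h2,
    ← integral_const_mul, ← integral_add_right_eq_self (fun q : Channel L =>
      Complex.exp (Complex.I * (waveNumber L n * h : ℝ)) * (fourier (-n) q.1 * (θ q.2 : ℂ) * u q))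
      (((h : AddCircle L), 0) : Channel L)]
  apply integral_congr_ae
  filter_upwards [trans_coe (((h : AddCircle L), 0) : Channel L) u] with q hq
  have e2 : (fourier (-n) (q.1 + (h : AddCircle L)) : ℂ)
      = fourier (-n) q.1 * Complex.exp (-(waveNumber L n * h : ℝ) * Complex.I) := by
    rw [← fourier_neg_coe, fourier_apply, fourier_apply, fourier_apply, smul_add,
      AddCircle.toCircle_add, Circle.coe_mul]
  have e3 : Complex.exp (Complex.I * (waveNumber L n * h : ℝ))
      * Complex.exp (-(waveNumber L n * h : ℝ) * Complex.I) = 1 := by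
    rw [← Complex.exp_add, ← Complex.exp_zero]; congr 1; ring
  rw [hq]
  simp only [Prod.fst_add, Prod.snd_add, add_zero, e2]
  calc _ = (Complex.exp (Complex.I * (waveNumber L n * h : ℝ))
      * Complex.exp (-(waveNumber L n * h : ℝ) * Complex.I))
        * (fourier (-n) q.1 * (θ q.2 : ℂ) * u (q + ((h : AddCircle L), 0))) := by rw [e3, one_mul]
    _ = _ := by ring

lemma modeProj_dq_snd_pow (n : ℤ) (h : ℝ) (j : ℕ) (u : L2 L) :
    modeProj n ((dq volume ((0, h) : Channel L) h ^ j) u)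
      = (dq volume h h ^ j) (modeProj n u) := by
  induction j with
  | zero => simp
  | succ j ih =>
    rw [pow_succ', pow_succ', mul_apply_eq_comp, mul_apply_eq_comp, ← ih, dq_apply, dq_apply,
      map_smul, map_sub, modeProj_trans_snd]

/-- Horizontal difference quotients multiply the `n`-th mode by a factor of modulus at most the
wave number. -/
lemma norm_modeProj_dq_fst_pow_le (n : ℤ) (h : ℝ) (j : ℕ) (u : L2 L) :
    ‖modeProj n ((dq volume (((h : AddCircle L), 0) : Channel L) h ^ j) u)‖
      ≤ |waveNumber L n| ^ j * ‖modeProj n u‖ := by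
  induction j with
  | zero => simp
  | succ j ih =>
    have e : ∀ (c : ℂ) (x : L2R), c • x - x = (c - 1) • x := fun c x => by
      rw [sub_smul, one_smul]
    rw [pow_succ', mul_apply_eq_comp, dq_apply, map_smul, map_sub, modeProj_trans_fst,
      e, norm_smul, norm_smul, ← mul_assoc, pow_succ', mul_assoc |waveNumber L n|]
    refine mul_le_mul ?_ ih (norm_nonneg _) (abs_nonneg _)
    rw [norm_inv, Complex.norm_real]
    rcases eq_or_ne h 0 with rfl | hh
    · simp
    rw [inv_mul_le_iff₀ (by positivity)]
    refine (Real.norm_exp_I_mul_ofReal_sub_one_le (x := waveNumber L n * h)).trans (le_of_eq ?_)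
    rw [norm_mul, mul_comm, Real.norm_eq_abs, Real.norm_eq_abs]

end Modes

/-! ### Parseval's identity -/

section Parseval

variable {L : ℝ} [hL : Fact (0 < L)]

lemma enorm_sq_eq_lintegral {α : Type*} [MeasurableSpace α] {μ : Measure α} (u : Lp ℂ 2 μ) :
    ‖u‖ₑ ^ 2 = ∫⁻ x, ‖u x‖ₑ ^ 2 ∂μ := by
  rw [Lp.enorm_def, eLpNorm_eq_lintegral_rpow_enorm_toReal (by norm_num) (by norm_num),
    ← ENNReal.rpow_natCast, ← ENNReal.rpow_mul]
  simp

/-- The modes are the Fourier coefficients of the horizontal slices. -/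
lemma modeProj_ae_eq (n : ℤ) (u : L2 L) :
    ∀ᵐ z : ℝ, modeProj n u z = ∫ x : AddCircle L, fourier (-n) x * u (x, z) := by
  -- Over a compact set of heights `u` is integrable, so that Fubini's theorem applies.
  have hK : ∀ K : Set ℝ, IsCompact K → Integrable (fun q : Channel L => fourier (-n) q.1 * u q)
      ((volume : Measure (AddCircle L)).prod (volume.restrict K)) := by
    intro K hKc
    have h1 : IsFiniteMeasure ((volume : Measure (AddCircle L)).prod
        ((volume : Measure ℝ).restrict K)) := by
      have : IsFiniteMeasure ((volume : Measure ℝ).restrict K) :=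
        ⟨by rw [Measure.restrict_apply_univ]; exact hKc.measure_lt_top⟩
      infer_instance
    have h2 : (volume : Measure (AddCircle L)).prod ((volume : Measure ℝ).restrict K)
        = (volume : Measure (Channel L)).restrict (Set.univ ×ˢ K) := by
      rw [Measure.volume_eq_prod, ← Measure.prod_restrict, Measure.restrict_univ]
    have h3 : Integrable (fun q : Channel L => u q)
        ((volume : Measure (AddCircle L)).prod (volume.restrict K)) := by
      have := (Lp.memLp u).restrict (Set.univ ×ˢ K)
      rw [← h2] at this
      exact this.integrable (by norm_num)
    refine h3.norm.mono' ?_ (Filter.Eventually.of_forall fun q => ?_)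
    · exact ((by fun_prop : Continuous fun q : Channel L =>
        (fourier (-n) q.1 : ℂ)).aestronglyMeasurable).mul h3.aestronglyMeasurable
    · rw [norm_mul, fourier_apply, Circle.norm_coe, one_mul]
  refine ae_eq_of_integral_contDiff_smul_eq ((Lp.memLp _).locallyIntegrable (by norm_num)) ?_ ?_
  · rw [locallyIntegrable_iff]
    intro K hKc
    exact (hK K hKc).integral_prod_right
  · intro θ h1 h2
    rw [← integral_fourier_mul n h1.continuous h2]
    have hint : Integrable (fun q : Channel L => (fourier (-n) q.1 * (θ q.2 : ℂ)) * u q)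
        ((volume : Measure (AddCircle L)).prod (volume : Measure ℝ)) := by
      have hm : MemLp (fun z => (θ z : ℂ)) 2 (volume : Measure ℝ) :=
        (Complex.continuous_ofReal.comp h1.continuous).memLp_of_hasCompactSupport
          (h2.comp_left (g := Complex.ofReal) rfl)
      have h3 : MemLp (fun q : Channel L => (fourier (-n) q.1 : ℂ) * (θ q.2 : ℂ)) 2 volume :=
        (hm.comp_snd (volume : Measure (AddCircle L))).mul (memLp_fourier (-n))
      exact h3.integrable_mul (Lp.memLp u)
    refine (integral_prod_symm _ hint).trans ?_
    refine integral_congr_ae (Filter.Eventually.of_forall fun z => ?_)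
    simp only [Complex.real_smul]
    rw [← integral_const_mul]
    refine integral_congr_ae (Filter.Eventually.of_forall fun x => ?_)
    simp only
    ring

lemma modeProj_zero_of_hasZeroMean {u : L2 L} (h : HasZeroMean u) : modeProj 0 u = 0 := by
  apply Lp.ext
  filter_upwards [modeProj_ae_eq 0 u, h, Lp.coeFn_zero ℂ 2 (volume : Measure ℝ)] with z h1 h2 h3
  rw [h1, h3]
  simpa using h2

/-- Parseval's identity on a circle of length `L`. -/
lemma tsum_enorm_fourier_sq {f : AddCircle L → ℂ} (hf : MemLp f 2 volume) :
    ∑' n : ℤ, ‖∫ x : AddCircle L, fourier (-n) x * f x‖ₑ ^ 2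
      = ENNReal.ofReal L * ∫⁻ x, ‖f x‖ₑ ^ 2 := by
  have hf' : MemLp f 2 AddCircle.haarAddCircle := (memLp_haarAddCircle_iff).2 hf
  have hL0 := hL.out
  have h1 := hasSum_sq_fourierCoeff (hf'.toLp f)
  have h2 : ∀ n, fourierCoeff (hf'.toLp f) n
      = (L⁻¹ : ℝ) • ∫ x : AddCircle L, fourier (-n) x * f x := by
    intro n
    rw [fourierCoeff_congr_ae hf'.coeFn_toLp, fourierCoeff, AddCircle.integral_haarAddCircle]
    rfl
  have h3 : ∫ t, ‖(hf'.toLp f) t‖ ^ 2 ∂AddCircle.haarAddCircle = L⁻¹ * ∫ t, ‖f t‖ ^ 2 := by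
    have : ∫ t, ‖(hf'.toLp f) t‖ ^ 2 ∂AddCircle.haarAddCircle
        = ∫ t, ‖f t‖ ^ 2 ∂AddCircle.haarAddCircle := by
      apply integral_congr_ae
      filter_upwards [hf'.coeFn_toLp] with t ht
      rw [ht]
    rw [this, AddCircle.integral_haarAddCircle, smul_eq_mul]
  simp_rw [h2] at h1
  rw [h3] at h1
  have h4 := h1.mul_left (L ^ 2)
  have h5 : ∀ n : ℤ, L ^ 2 * ‖(L⁻¹ : ℝ) • ∫ x : AddCircle L, fourier (-n) x * f x‖ ^ 2
      = ‖∫ x : AddCircle L, fourier (-n) x * f x‖ ^ 2 := by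
    intro n
    rw [norm_smul, norm_inv, Real.norm_of_nonneg hL0.le, mul_pow, ← mul_assoc, ← mul_pow,
      mul_inv_cancel₀ hL0.ne', one_pow, one_mul]
  simp_rw [h5] at h4
  have h6 : ∀ n : ℤ, ‖∫ x : AddCircle L, fourier (-n) x * f x‖ₑ ^ 2
      = ENNReal.ofReal (‖∫ x : AddCircle L, fourier (-n) x * f x‖ ^ 2) := by
    intro n
    rw [ENNReal.ofReal_pow (norm_nonneg _), ofReal_norm]
  have h7 : ∫⁻ x, ‖f x‖ₑ ^ 2 = ENNReal.ofReal (∫ t, ‖f t‖ ^ 2) := by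
    rw [ofReal_integral_eq_lintegral_ofReal (hf.integrable_norm_pow (by norm_num))
      (Filter.Eventually.of_forall fun _ => by positivity)]
    refine lintegral_congr fun x => ?_
    rw [ENNReal.ofReal_pow (norm_nonneg _), ofReal_norm]
  simp_rw [h6]
  rw [← ENNReal.ofReal_tsum_of_nonneg (fun _ => by positivity) h4.summable, h4.tsum_eq, h7,
    ← ENNReal.ofReal_mul hL0.le]
  congr 1
  field_simp

/-- Parseval's identity on the channel. -/
lemma tsum_enorm_modeProj_sq (u : L2 L) :
    ∑' n : ℤ, ‖modeProj n u‖ₑ ^ 2 = ENNReal.ofReal L * ‖u‖ₑ ^ 2 := by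
  have hsm : StronglyMeasurable (u : Channel L → ℂ) := Lp.stronglyMeasurable u
  have hmeas : Measurable fun q : Channel L => ‖u q‖ₑ ^ 2 := by
    exact (hsm.measurable.enorm).pow_const 2
  have hu : ‖u‖ₑ ^ 2 = ∫⁻ z : ℝ, ∫⁻ x : AddCircle L, ‖u (x, z)‖ₑ ^ 2 := by
    rw [enorm_sq_eq_lintegral]
    exact lintegral_prod_symm' _ hmeas
  have hfin : ∀ᵐ z : ℝ, ∫⁻ x : AddCircle L, ‖u (x, z)‖ₑ ^ 2 < ⊤ := by
    refine ae_lt_top (hmeas.lintegral_prod_left') ?_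
    rw [← hu]
    finiteness
  have hslice : ∀ᵐ z : ℝ, MemLp (fun x : AddCircle L => u (x, z)) 2 volume := by
    filter_upwards [hfin] with z hz
    refine ⟨(hsm.comp_measurable (by fun_prop)).aestronglyMeasurable, ?_⟩
    rw [eLpNorm_lt_top_iff_lintegral_rpow_enorm_lt_top (by norm_num) (by norm_num)]
    simpa using hz
  have hall : ∀ᵐ z : ℝ, ∀ n : ℤ,
      modeProj n u z = ∫ x : AddCircle L, fourier (-n) x * u (x, z) :=
    ae_all_iff.2 fun n => modeProj_ae_eq n u
  simp_rw [enorm_sq_eq_lintegral (modeProj _ u)]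
  rw [← lintegral_tsum (fun n => ((Lp.stronglyMeasurable _).measurable.enorm.pow_const 2).aemeasurable),
    hu, ← lintegral_const_mul' _ _ ENNReal.ofReal_ne_top]
  apply lintegral_congr_ae
  filter_upwards [hslice, hall] with z h1 h2
  simp_rw [h2]
  exact tsum_enorm_fourier_sq h1

end Parseval

/-! ### The equations of the modes -/

section ModeEquation

variable {L : ℝ} [hL : Fact (0 < L)]

/-- The weak equation of the stream function, tested with `e_{-n}(x) θ(z)`. -/
lemma IsStreamFunction.test_mode {f g : ℝ → ℝ} (hg : Differentiable ℝ g)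
    (hf : Continuous f) (hfg : ∀ z, g z * deriv g z = f z)
    {t : ℝ} {w ψ ψx ψz D : L2 L} (h : IsStreamFunction g t w ψ ψx ψz)
    (hD : ∀ᵐ q : Channel L, D q = ψz q - t • ψx q) (n : ℤ) {θ : ℝ → ℝ} (t1 : ContDiff ℝ ∞ θ)
    (t2 : HasCompactSupport θ) :
    (-(waveNumber L n) * Complex.I) * (∫ z, θ z • modeProj n ψx z)
      + (∫ z, (f z * θ z + g z ^ 2 * deriv θ z) • modeProj n D z)
      - t * ((-(waveNumber L n) * Complex.I) * ∫ z, (g z ^ 2 * θ z) • modeProj n D z)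
      = -∫ z, θ z • modeProj n w z := by
  obtain ⟨-, -, h3⟩ := h
  set k := waveNumber L n with hk
  set η₁ : ℝ → ℝ := fun z => f z * θ z + g z ^ 2 * deriv θ z with hη₁
  set η₂ : ℝ → ℝ := fun z => g z ^ 2 * θ z with hη₂
  have hθc := t1.continuous
  have hθd := (contDiff_deriv t1).continuous
  have hgc := hg.continuous
  have c1 : Continuous η₁ := by fun_prop
  have c2 : Continuous η₂ := by fun_prop
  have s1 : HasCompactSupport η₁ := t2.mul_left.add t2.deriv.mul_left
  have s2 : HasCompactSupport η₂ := t2.mul_left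
  have key : ∀ c : ℂ, (∫ q, modeTest L n (-k * Complex.I * c) θ q • ψx q)
      + (∫ q, modeTest L n c η₁ q • D q)
      - t * (∫ q, modeTest L n (-k * Complex.I * c) η₂ q • D q)
      = -∫ q, modeTest L n c θ q • w q := by
    intro c
    rw [← h3 _ (isTest_modeTest n c t1 t2)]
    have e1 : (fun q : Channel L => g q.2 * modeTest L n c θ q)
        = modeTest L n c (fun z => g z * θ z) := by
      funext q; simp only [modeTest]; ring
    rw [e1, pdx_modeTest, pdx_modeTest, pdz_modeTest]
    have i1 : Integrable (fun q => modeTest L n (-k * Complex.I * c) θ q • ψx q) :=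
      integrable_smul_Lp (continuous_modeTest _ _ hθc) (hasCompactSupport_modeTest _ _ t2) _
    have i2 : Integrable (fun q => modeTest L n c η₁ q • D q) :=
      integrable_smul_Lp (continuous_modeTest _ _ c1) (hasCompactSupport_modeTest _ _ s1) _
    have i3 : Integrable (fun q => (t : ℂ) * (modeTest L n (-k * Complex.I * c) η₂ q • D q)) :=
      (integrable_smul_Lp (continuous_modeTest _ _ c2)
        (hasCompactSupport_modeTest _ _ s2) _).const_mul _
    have i4 : Integrable (fun q => modeTest L n (-k * Complex.I * c) θ q • ψx q
      + modeTest L n c η₁ q • D q) := i1.add i2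
    rw [← integral_const_mul, ← integral_add i1 i2, ← integral_sub i4 i3]
    apply integral_congr_ae
    filter_upwards [hD] with q e2
    have e3 : deriv (fun z => g z * θ z) q.2 = deriv g q.2 * θ q.2 + g q.2 * deriv θ q.2 :=
      deriv_fun_mul (hg _) (t1.differentiable (by simp) _)
    rw [← e2]
    simp only [modeTest, e3, hη₁, hη₂, ← hfg, Complex.real_smul]
    push_cast
    ring
  have k1 := key 1
  -- The values `c = 1` and `c = -i` yield the real and the imaginary part of the complex identity.
  have k2 := key (-Complex.I)
  rw [mul_one] at k1
  have a1 := integral_modeTest_add n (-k * Complex.I) hθc t2 ψx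
  have a2 := integral_modeTest_add n 1 c1 s1 D
  have a3 := integral_modeTest_add n (-k * Complex.I) c2 s2 D
  have a4 := integral_modeTest_add n 1 hθc t2 w
  rw [one_mul] at a2 a4
  rw [one_mul] at a2 a4
  rw [← a1, ← a2, ← a3, ← a4]
  linear_combination k1 + Complex.I * k2

lemma integral_smul_add {θ : ℝ → ℝ} (h1 : Continuous θ) (h2 : HasCompactSupport θ) (u v : L2R) :
    ∫ z, θ z • (u + v) z = (∫ z, θ z • u z) + ∫ z, θ z • v z := by
  rw [← integral_add (integrable_smul_Lp h1 h2 u) (integrable_smul_Lp h1 h2 v)]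
  apply integral_congr_ae
  filter_upwards [Lp.coeFn_add u v] with z e
  rw [e, Pi.add_apply, smul_add]

lemma integral_smul_smul (θ : ℝ → ℝ) (c : ℂ) (u : L2R) :
    ∫ z, θ z • (c • u) z = c * ∫ z, θ z • u z := by
  rw [← integral_const_mul]
  apply integral_congr_ae
  filter_upwards [Lp.coeFn_smul c u] with z e
  rw [e, Pi.smul_apply, smul_eq_mul, mul_smul_comm]

lemma integral_smul_mulOp (θ : ℝ → ℝ) {a : ℝ → ℝ}
    (ha : MemLp (fun z => (a z : ℂ)) ∞ volume) (u : L2R) :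
    ∫ z, θ z • (mulOp volume (fun z => (a z : ℂ)) u) z = ∫ z, (a z * θ z) • u z := by
  apply integral_congr_ae
  filter_upwards [mulOp_coe ha u] with z e
  rw [e]; simp only [Complex.real_smul]; push_cast; ring

/-- The second equation of `IsModeStream`, from its tested form. -/
lemma hasD_of_test {f m : ℝ → ℝ} (hf : Continuous f) (hm : Continuous m)
    (hfm : MemLp (fun z => (f z : ℂ)) ∞ volume) (hmm : MemLp (fun z => (m z : ℂ)) ∞ volume)
    {k t : ℝ} {w ψ d : L2R}
    (h : ∀ θ : ℝ → ℝ, ContDiff ℝ ∞ θ → HasCompactSupport θ →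
      (-(k : ℂ) * Complex.I) * (∫ z, θ z • (((k : ℂ) * Complex.I) • ψ) z)
      + (∫ z, (f z * θ z + m z * deriv θ z) • d z)
      - t * ((-(k : ℂ) * Complex.I) * ∫ z, (m z * θ z) • d z) = -∫ z, θ z • w z) :
    HasD k t (mulOp volume (fun z => (m z : ℂ)) d)
      (w + ((k ^ 2 : ℝ) : ℂ) • ψ + mulOp volume (fun z => (f z : ℂ)) d) := by
  intro θ t1 t2
  have comb := h θ t1 t2
  have hθc := t1.continuous
  have hθd := (contDiff_deriv t1).continuous
  have jf := integrable_smul_Lp (θ := fun z => f z * θ z) (by fun_prop) t2.mul_left d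
  have jd := integrable_smul_Lp (θ := fun z => m z * deriv θ z) (by fun_prop)
    t2.deriv.mul_left d
  have r2 : ∫ z, (f z * θ z + m z * deriv θ z) • d z
      = (∫ z, (f z * θ z) • d z) + ∫ z, (m z * deriv θ z) • d z := by
    rw [← integral_add jf jd]
    refine integral_congr_ae (Filter.Eventually.of_forall fun z => ?_)
    exact add_smul _ _ _
  have r3 := integral_smul_mulOp θ hmm d
  have r4 := integral_smul_mulOp θ hfm d
  have r5 := integral_smul_mulOp (deriv θ) hmm d
  have r6 := integral_smul_smul θ (((k : ℝ) : ℂ) * Complex.I) ψ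
  have r7 := integral_smul_smul θ (((k ^ 2 : ℝ) : ℂ)) ψ
  have r8 := integral_smul_smul θ ((k * t : ℝ) * Complex.I : ℂ)
    (mulOp volume (fun z => (m z : ℂ)) d)
  have r9 := integral_smul_add hθc t2 (w + ((k ^ 2 : ℝ) : ℂ) • ψ
    + mulOp volume (fun z => (f z : ℂ)) d)
    (((k * t : ℝ) * Complex.I : ℂ) • mulOp volume (fun z => (m z : ℂ)) d)
  have r10 := integral_smul_add hθc t2 (w + ((k ^ 2 : ℝ) : ℂ) • ψ)
    (mulOp volume (fun z => (f z : ℂ)) d)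
  have r11 := integral_smul_add hθc t2 w (((k ^ 2 : ℝ) : ℂ) • ψ)
  rw [r5, r9, r10, r11, r8, r7, r3, r4]
  rw [r6, r2] at comb
  clear r2 r3 r4 r5 r6 r7 r8 r9 r10 r11
  push_cast
  linear_combination comb + (k : ℂ) ^ 2 * (∫ z, θ z • ψ z) * Complex.I_sq

/-- The equation of the stream function, mode by mode. -/
lemma IsStreamFunction.mode {f g : ℝ → ℝ} (hg : Differentiable ℝ g)
    (hf : Continuous f) (hfg : ∀ z, g z * deriv g z = f z)
    (hfm : MemLp (fun z => (f z : ℂ)) ∞ volume)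
    (hmm : MemLp (fun z => ((g z ^ 2 : ℝ) : ℂ)) ∞ volume)
    {t : ℝ} {w ψ ψx ψz : L2 L} (h : IsStreamFunction g t w ψ ψx ψz) (n : ℤ) :
    IsModeStream f (fun z => g z ^ 2) (waveNumber L n) t (modeProj n w) (modeProj n ψ)
      (modeProj n (ψz - (t : ℂ) • ψx)) := by
  have hx := h.1.mode_dx n
  have hDn : modeProj n (ψz - (t : ℂ) • ψx)
      = modeProj n ψz - ((waveNumber L n * t : ℝ) * Complex.I : ℂ) • modeProj n ψ := by
    rw [map_sub, map_smul, hx, smul_smul]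
    congr 2
    push_cast; ring
  have hDae : ∀ᵐ q : Channel L, (ψz - (t : ℂ) • ψx : L2 L) q = ψz q - t • ψx q := by
    filter_upwards [Lp.coeFn_sub ψz ((t : ℂ) • ψx), Lp.coeFn_smul (t : ℂ) ψx] with q e1 e2
    rw [e1, Pi.sub_apply, e2, Pi.smul_apply, Complex.coe_smul]
  refine ⟨?_, ?_⟩
  · have := h.2.1.mode_dz n
    rw [HasD, hDn, sub_add_cancel]
    exact this
  refine hasD_of_test hf (hg.continuous.pow 2) hfm hmm fun θ t1 t2 => ?_
  have comb := h.test_mode hg hf hfg hDae n t1 t2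
  rw [hx] at comb
  exact comb

/-- Multiplication by functions of the vertical variable commutes with taking modes. -/
lemma modeProj_of_ae_mul {f : ℝ → ℝ} (hf : Continuous f)
    (hfm : MemLp (fun z => (f z : ℂ)) ∞ volume) {u v : L2 L}
    (h : ∀ᵐ q : Channel L, v q + f q.2 • u q = 0) (n : ℤ) :
    modeProj n v = -mulOp volume (fun z => (f z : ℂ)) (modeProj n u) := by
  refine eq_of_test fun θ h1 h2 => ?_
  have e1 := integral_fourier_mul n h1.continuous h2 v
  have e2 := integral_fourier_mul n (θ := fun z => f z * θ z) (hf.mul h1.continuous) h2.mul_left u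
  rw [← e1]
  have e3 : ∫ z, θ z • (-mulOp volume (fun z => (f z : ℂ)) (modeProj n u) : L2R) z
      = -∫ z, (f z * θ z) • modeProj n u z := by
    rw [← integral_neg]
    apply integral_congr_ae
    filter_upwards [Lp.coeFn_neg (mulOp volume (fun z => (f z : ℂ)) (modeProj n u)),
      mulOp_coe hfm (modeProj n u)] with z a1 a2
    rw [a1, Pi.neg_apply, a2]
    simp only [Complex.real_smul]; push_cast; ring
  rw [e3, ← e2, ← integral_neg]
  apply integral_congr_ae
  filter_upwards [h] with q hq
  rw [eq_neg_of_add_eq_zero_left hq]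
  simp only [Complex.real_smul]; push_cast; ring

/-- The modes of a solution solve the mode equations. -/
lemma IsSolution.mode {f g : ℝ → ℝ} (hg : Differentiable ℝ g)
    (hf : Continuous f) (hfg : ∀ z, g z * deriv g z = f z)
    (hfm : MemLp (fun z => (f z : ℂ)) ∞ volume)
    (hmm : MemLp (fun z => ((g z ^ 2 : ℝ) : ℂ)) ∞ volume)
    {w : ℝ → L2 L} (h : IsSolution f g w) (n : ℤ) :
    IsModeSolution f (fun z => g z ^ 2) (waveNumber L n) (fun t => modeProj n (w t)) := by
  intro t ht
  obtain ⟨ψ, ψx, ψz, dw, h1, h2, h3⟩ := h t ht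
  refine ⟨_, _, h1.mode hg hf hfg hfm hmm n, ?_⟩
  have h4 : HasDerivWithinAt (fun t => modeProj n (w t)) (modeProj n dw) (Set.Ici 0) t :=
    ((modeProj n).restrictScalars ℝ).hasFDerivAt.comp_hasDerivWithinAt t h2
  refine h4.congr_deriv ?_
  rw [modeProj_of_ae_mul hf hfm h3 n, h1.1.mode_dx n, map_smul, neg_smul]

/-- A zero mean in `x` is preserved. -/
lemma IsSolution.modeProj_zero {f g : ℝ → ℝ} (hg : Differentiable ℝ g)
    (hf : Continuous f) (hfg : ∀ z, g z * deriv g z = f z)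
    (hfm : MemLp (fun z => (f z : ℂ)) ∞ volume)
    (hmm : MemLp (fun z => ((g z ^ 2 : ℝ) : ℂ)) ∞ volume)
    {w : ℝ → L2 L} (h : IsSolution f g w) (h0 : HasZeroMean (w 0)) {t : ℝ} (ht : 0 ≤ t) :
    modeProj 0 (w t) = 0 := by
  have hm := h.mode hg hf hfg hfm hmm 0
  have hk : waveNumber L 0 = 0 := by simp [waveNumber]
  have hd : ∀ τ ∈ Set.Ici (0 : ℝ), HasDerivWithinAt (fun t => modeProj 0 (w t)) 0 (Set.Ici 0) τ := by
    intro τ hτ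
    obtain ⟨ψ, d, -, hd⟩ := hm τ hτ
    refine hd.congr_deriv ?_
    rw [hk]; simp
  have := Convex.norm_image_sub_le_of_norm_hasDerivWithin_le (C := 0) hd (by simp)
    (convex_Ici 0) (Set.mem_Ici.2 le_rfl) (Set.mem_Ici.2 ht)
  rw [zero_mul, norm_le_zero_iff, sub_eq_zero, modeProj_zero_of_hasZeroMean h0] at this
  exact this

end ModeEquation

/-! ### The coefficients of a bilipschitz shear flow -/

section Coefficients

variable {κ : ℝ≥0} {U : ℝ → ℝ}

lemma IsBilipschitz.pos (h : IsBilipschitz κ U) : 0 < κ := by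
  rcases eq_or_ne κ 0 with h0 | h0
  · have := h.2 0 1
    rw [h0] at this
    simp at this
  · exact pos_iff_ne_zero.2 h0

lemma IsBilipschitz.inv_le_abs_deriv (h : IsBilipschitz κ U) (hU : ContDiff ℝ 2 U) (y : ℝ) :
    (κ : ℝ)⁻¹ ≤ |deriv U y| := by
  have hd := ((hU.differentiable (by simp)) y).hasDerivAt
  have ht := (hasDerivAt_iff_tendsto_slope.1 hd).abs
  refine ge_of_tendsto ht ?_
  filter_upwards [self_mem_nhdsWithin] with x hx
  have hx' : 0 < |x - y| := abs_pos.2 (sub_ne_zero.2 hx)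
  have h1 := h.2.le_mul_dist x y
  rw [Real.dist_eq, Real.dist_eq] at h1
  have hκ : (0 : ℝ) < κ := h.pos
  rw [slope_def_field, abs_div, le_div_iff₀ hx', inv_mul_le_iff₀ hκ]
  exact h1

/-- A bilipschitz `C²` map is onto: its range is open, by the lower bound for the derivative, and
closed. Hence `Function.invFun U` is a genuine inverse of `U`. -/
lemma IsBilipschitz.bijective (h : IsBilipschitz κ U) (hU : ContDiff ℝ 2 U) :
    Function.Bijective U := by
  refine ⟨h.2.injective, ?_⟩
  have hκ : (0 : ℝ) < κ := h.pos
  have ho : IsOpenMap U := isOpenMap_of_hasStrictDerivAt (f' := deriv U)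
    (fun y => hU.contDiffAt.hasStrictDerivAt (by simp)) fun y h0 => by
      have := h.inv_le_abs_deriv hU y
      rw [h0, abs_zero] at this
      exact absurd this (not_le.2 (by positivity))
  have hc : IsClosed (Set.range U) := h.2.isClosed_range h.1.uniformContinuous
  have := IsClopen.eq_univ ⟨hc, ho.isOpen_range⟩ (Set.range_nonempty U)
  exact Set.range_eq_univ.1 this

lemma IsBilipschitz.hasDerivAt_coeffG (h : IsBilipschitz κ U) (hU : ContDiff ℝ 2 U) (z : ℝ) :
    HasDerivAt (coeffG U) (coeffF U z * (coeffG U z)⁻¹) z := by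
  have hb := h.bijective hU
  have hr : Function.RightInverse (Function.invFun U) U := Function.rightInverse_invFun hb.2
  have hκ : (0 : ℝ) < κ := h.pos
  have hV : Continuous (Function.invFun U) := (h.2.to_rightInverse hr).continuous
  have hne : deriv U (Function.invFun U z) ≠ 0 := fun h0 => by
    have := h.inv_le_abs_deriv hU (Function.invFun U z)
    rw [h0, abs_zero] at this
    exact absurd this (not_le.2 (by positivity))
  have h1 : HasDerivAt U (deriv U (Function.invFun U z)) (Function.invFun U z) :=
    ((hU.differentiable (by simp)) _).hasDerivAt
  have h2 : HasDerivAt (Function.invFun U) (deriv U (Function.invFun U z))⁻¹ z :=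
    h1.of_local_left_inverse hV.continuousAt hne (Filter.Eventually.of_forall hr)
  have h3 : HasDerivAt (deriv U) (iteratedDeriv 2 U (Function.invFun U z))
      (Function.invFun U z) := by
    have : iteratedDeriv 2 U = deriv (deriv U) := by
      rw [iteratedDeriv_succ, iteratedDeriv_one]
    rw [this]
    have hd : ContDiff ℝ 1 (deriv U) := by
      have := (contDiff_succ_iff_deriv (n := 1) (f := U)).1 (by simpa [one_add_one_eq_two] using hU)
      exact this.2.2
    exact (hd.differentiable (by simp) _).hasDerivAt
  exact h3.comp z h2

lemma IsBilipschitz.inv_le_abs_coeffG (h : IsBilipschitz κ U) (hU : ContDiff ℝ 2 U) (z : ℝ) :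
    (κ : ℝ)⁻¹ ≤ |coeffG U z| :=
  h.inv_le_abs_deriv hU _

/-- The relation `g g' = f`, by the chain rule for `g = U' ∘ U⁻¹`. -/
lemma IsBilipschitz.coeffG_mul_deriv (h : IsBilipschitz κ U) (hU : ContDiff ℝ 2 U) (z : ℝ) :
    coeffG U z * deriv (coeffG U) z = coeffF U z := by
  have hκ : (0 : ℝ) < κ := h.pos
  have hne : coeffG U z ≠ 0 := fun h0 => by
    have := h.inv_le_abs_coeffG hU z
    rw [h0, abs_zero] at this
    exact absurd this (not_le.2 (by positivity))
  rw [(h.hasDerivAt_coeffG hU z).deriv]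
  field_simp

end Coefficients

/-! ### Pointwise bounds from the norms of the coefficients -/

/-- A finite `C^j` norm entails that the function is `C^j`, the norm being `∞` otherwise. -/
lemma of_cNorm_le {h : ℝ → ℝ} {j : ℕ} {B : ℝ} (hB : 0 ≤ B) (hj : cNorm j h ≤ ENNReal.ofReal B) :
    ContDiff ℝ j h ∧ ∀ z, |iteratedDeriv j h z| ≤ B := by
  by_cases hc : ContDiff ℝ j h
  · refine ⟨hc, fun z => ?_⟩
    rw [cNorm, iInf_pos hc] at hj
    have h1 : ‖iteratedDeriv j h z‖ₑ ≤ ENNReal.ofReal B :=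
      ((le_iSup (fun z => ‖iteratedDeriv j h z‖ₑ) z).trans
        (Finset.single_le_sum (f := fun i => ⨆ z, ‖iteratedDeriv i h z‖ₑ)
          (fun i _ => zero_le) (Finset.self_mem_range_succ j))).trans hj
    rwa [Real.enorm_eq_ofReal_abs, ENNReal.ofReal_le_ofReal_iff hB] at h1
  · rw [cNorm, iInf_neg hc, top_le_iff] at hj
    exact absurd hj ENNReal.ofReal_ne_top

/-- For continuous functions the essential supremum bounds every value. -/
lemma abs_le_of_eLpNorm_top_le {h : ℝ → ℝ} (hc : Continuous h) {B : ℝ} (hB : 0 ≤ B)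
    (hn : eLpNorm h ∞ volume ≤ ENNReal.ofReal B) (z : ℝ) : |h z| ≤ B := by
  have h1 : ∀ᵐ z : ℝ, |h z| ≤ B := by
    rw [eLpNorm_exponent_top] at hn
    filter_upwards [ae_le_eLpNormEssSup (f := h) (μ := volume)] with z hz
    have := hz.trans hn
    rwa [Real.enorm_eq_ofReal_abs, ENNReal.ofReal_le_ofReal_iff hB] at this
  have h2 : IsClosed {z | |h z| ≤ B} := isClosed_le hc.abs continuous_const
  have h3 := (Measure.dense_of_ae h1).closure_eq
  rw [h2.closure_eq] at h3
  exact (h3 ▸ Set.mem_univ z : z ∈ {z | |h z| ≤ B})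

lemma abs_le_of_wOneInftyNorm_mul_lt {h : ℝ → ℝ} (hc : ContDiff ℝ ∞ h) {c L : ℝ} (hL : 0 < L)
    (hn : wOneInftyNorm h * ENNReal.ofReal L < ENNReal.ofReal c) (z : ℝ) :
    |h z| ≤ c / L ∧ |deriv h z| ≤ c / L := by
  have hc0 : 0 < c := by
    rw [← ENNReal.ofReal_pos]; exact zero_le.trans_lt hn
  have h1 : wOneInftyNorm h ≤ ENNReal.ofReal (c / L) := by
    rw [ENNReal.ofReal_div_of_pos hL]
    exact (ENNReal.le_div_iff_mul_le (.inl (ENNReal.ofReal_pos.2 hL).ne')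
      (.inl ENNReal.ofReal_ne_top)).2 hn.le
  have h0 : 0 ≤ c / L := by positivity
  exact ⟨abs_le_of_eLpNorm_top_le hc.continuous h0 (le_self_add.trans h1) z,
    abs_le_of_eLpNorm_top_le (contDiff_deriv hc).continuous h0 (le_add_self.trans h1) z⟩

/-- Since `(g²)' = 2f`, bounds for `f` are bounds for the derivatives of `g²`. -/
lemma iteratedDeriv_sq_succ {f g : ℝ → ℝ} (hg : Differentiable ℝ g)
    (hfg : ∀ z, g z * deriv g z = f z) (hf : ContDiff ℝ ∞ f) (i : ℕ) (z : ℝ) :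
    iteratedDeriv (i + 1) (fun z => g z ^ 2) z = 2 * iteratedDeriv i f z := by
  have h1 : deriv (fun z => g z ^ 2) = fun z => 2 * f z := by
    funext z
    rw [deriv_fun_pow (hg z), ← hfg]
    ring
  rw [iteratedDeriv_succ', h1]
  exact iteratedDeriv_const_mul 2 (hf.contDiffAt.of_le (by exact_mod_cast le_top))

/-! ### Gevrey weights and constants -/

/-- The weights `ρ^j / (j!)^s` of the Gevrey norm of order `s` and radius `ρ`. -/
noncomputable def gevreyWeight (ρ s : ℝ) (j : ℕ) : ℝ := ρ ^ j / (j.factorial : ℝ) ^ s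

/-- The growth `D^{1+j} (1+j)^{js}` allowed for derivatives of order `j`. -/
noncomputable def gevreyBound (D s : ℝ) (j : ℕ) : ℝ := D ^ (1 + j) * (1 + (j : ℝ)) ^ ((j : ℝ) * s)

section Gevrey

variable {ρ s D : ℝ}

lemma gevreyWeight_pos (hρ : 0 < ρ) (s : ℝ) (j : ℕ) : 0 < gevreyWeight ρ s j := by
  have : (0 : ℝ) < j.factorial := by exact_mod_cast j.factorial_pos
  unfold gevreyWeight; positivity

lemma gevreyBound_pos (hD : 0 < D) (s : ℝ) (j : ℕ) : 0 < gevreyBound D s j := by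
  unfold gevreyBound; positivity

lemma gevreyWeight_zero (ρ s : ℝ) : gevreyWeight ρ s 0 = 1 := by simp [gevreyWeight]

/-- The weights are submultiplicative, up to the binomial coefficient; this uses `1 ≤ s`. -/
lemma choose_mul_gevreyWeight_le (hρ : 0 < ρ) (hs : 1 ≤ s) (i l : ℕ) :
    ((i + l).choose i : ℝ) * gevreyWeight ρ s (i + l) ≤ gevreyWeight ρ s i * gevreyWeight ρ s l := by
  have hi : (0 : ℝ) < i.factorial := by exact_mod_cast i.factorial_pos
  have hl : (0 : ℝ) < l.factorial := by exact_mod_cast l.factorial_pos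
  have hc : (1 : ℝ) ≤ (i + l).choose i := by
    exact_mod_cast Nat.choose_pos (Nat.le_add_right i l)
  have hf : ((i + l).factorial : ℝ) = (i + l).choose i * i.factorial * l.factorial := by
    rw [Nat.choose_symm_add]
    exact_mod_cast (Nat.add_choose_mul_factorial_mul_factorial i l).symm
  have hcs : ((i + l).choose i : ℝ) ≤ ((i + l).choose i : ℝ) ^ s := by
    simpa using Real.rpow_le_rpow_of_exponent_le hc hs
  unfold gevreyWeight
  rw [hf, Real.mul_rpow (by positivity) hl.le, Real.mul_rpow (by positivity) hi.le, pow_add,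
    div_mul_div_comm, mul_div_assoc', div_le_div_iff₀ (by positivity) (by positivity)]
  have : 0 ≤ ρ ^ i * ρ ^ l * ((i.factorial : ℝ) ^ s * (l.factorial : ℝ) ^ s) := by positivity
  nlinarith [mul_le_mul_of_nonneg_right hcs this]

/-- Compares `(1 + j)^{js}` with `(j!)^s`, by `(j + 1)^{j + 1} / (j + 1)! ≤ e^{j + 1}`. -/
lemma one_add_rpow_le (hs : 0 ≤ s) (j : ℕ) :
    (1 + (j : ℝ)) ^ ((j : ℝ) * s) ≤ Real.exp s ^ (j + 1) * (j.factorial : ℝ) ^ s := by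
  have hj : (0 : ℝ) < j.factorial := by exact_mod_cast j.factorial_pos
  have h1 : (1 + (j : ℝ)) ^ j ≤ Real.exp 1 ^ (j + 1) * j.factorial := by
    have h := Real.pow_div_factorial_le_exp ((j : ℝ) + 1) (by positivity) (j + 1)
    have he : Real.exp ((j : ℝ) + 1) = Real.exp 1 ^ (j + 1) := by
      rw [← Real.exp_nat_mul]; push_cast; ring_nf
    rw [he, Nat.factorial_succ, div_le_iff₀ (by positivity), pow_succ] at h
    push_cast at h
    have hp : (0 : ℝ) < j + 1 := by positivity
    have h' : ((j : ℝ) + 1) ^ j * (j + 1) ≤ (Real.exp 1 ^ (j + 1) * j.factorial) * (j + 1) := by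
      linarith
    rw [add_comm 1 (j : ℝ)]
    exact le_of_mul_le_mul_right h' hp
  calc (1 + (j : ℝ)) ^ ((j : ℝ) * s) = ((1 + (j : ℝ)) ^ j) ^ s := by
        rw [Real.rpow_mul (by positivity), Real.rpow_natCast]
    _ ≤ (Real.exp 1 ^ (j + 1) * j.factorial) ^ s := Real.rpow_le_rpow (by positivity) h1 hs
    _ = _ := by
        rw [Real.mul_rpow (by positivity) (by positivity), ← Real.rpow_natCast, ← Real.rpow_natCast,
          ← Real.exp_mul, ← Real.exp_mul, ← Real.exp_mul, one_mul, mul_comm s]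

lemma gevreyBound_le (hD : 0 < D) (hs : 0 ≤ s) (j : ℕ) :
    gevreyBound D s j ≤ (D * Real.exp s) ^ (j + 1) * (j.factorial : ℝ) ^ s := by
  unfold gevreyBound
  rw [mul_pow, mul_assoc, add_comm 1 j]
  exact mul_le_mul_of_nonneg_left (one_add_rpow_le hs j) (by positivity)

lemma sum_pow_succ_le {x : ℝ} (h0 : 0 ≤ x) (h1 : x ≤ 1 / 2) (J : ℕ) :
    ∑ i ∈ Finset.range J, x ^ (i + 1) ≤ 2 * x := by
  calc ∑ i ∈ Finset.range J, x ^ (i + 1) ≤ ∑ i ∈ Finset.range J, (1 / 2 : ℝ) ^ i * x := by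
        gcongr with i
        rw [pow_succ]
        gcongr
    _ = (∑ i ∈ Finset.range J, (1 / 2 : ℝ) ^ i) * x := by rw [Finset.sum_mul]
    _ ≤ 2 * x := by gcongr; exact sum_geometric_two_le J

/-- The weights absorb the Gevrey growth of the coefficients, also with one more derivative. -/
lemma gevreyWeight_mul_gevreyBound_le (hρ : 0 < ρ) (hD : 0 < D) (hs : 0 ≤ s) (i : ℕ) :
    gevreyWeight ρ s i * gevreyBound D s i ≤
      D * Real.exp s * (ρ * (D * Real.exp s * Real.exp s)) ^ i ∧
    gevreyWeight ρ s (i + 1) * gevreyBound D s i ≤ (ρ * (D * Real.exp s * Real.exp s)) ^ (i + 1) ∧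
    gevreyWeight ρ s i * gevreyBound D s (i + 1) ≤
      (D * Real.exp s) ^ 2 * (ρ * (D * Real.exp s * Real.exp s)) ^ i := by
  have hi : (0 : ℝ) < i.factorial := by exact_mod_cast i.factorial_pos
  have his : (0 : ℝ) < (i.factorial : ℝ) ^ s := by positivity
  have e1 : 1 ≤ Real.exp s := Real.one_le_exp hs
  set A := D * Real.exp s with hA
  have hA0 : 0 < A := by positivity
  have hsucc : (((i + 1).factorial : ℕ) : ℝ) ^ s = ((i : ℝ) + 1) ^ s * (i.factorial : ℝ) ^ s := by
    rw [Nat.factorial_succ]; push_cast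
    exact Real.mul_rpow (by positivity) hi.le
  have hi1 : 1 ≤ ((i : ℝ) + 1) ^ s := Real.one_le_rpow (by linarith [i.cast_nonneg (α := ℝ)]) hs
  have hi2 : ((i : ℝ) + 1) ^ s ≤ Real.exp s ^ i := by
    rw [← Real.exp_nat_mul, Real.exp_mul]
    exact Real.rpow_le_rpow (by positivity) (Real.add_one_le_exp _) hs
  have b0 := gevreyBound_le hD hs i
  have b1 := gevreyBound_le hD hs (i + 1)
  refine ⟨?_, ?_, ?_⟩
  · calc gevreyWeight ρ s i * gevreyBound D s i
        ≤ gevreyWeight ρ s i * (A ^ (i + 1) * (i.factorial : ℝ) ^ s) :=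
          mul_le_mul_of_nonneg_left b0 (gevreyWeight_pos hρ s i).le
      _ = A * (ρ * A) ^ i := by unfold gevreyWeight; field_simp; ring
      _ ≤ _ := by gcongr; exact le_mul_of_one_le_right hA0.le e1
  · calc gevreyWeight ρ s (i + 1) * gevreyBound D s i
        ≤ gevreyWeight ρ s (i + 1) * (A ^ (i + 1) * (i.factorial : ℝ) ^ s) :=
          mul_le_mul_of_nonneg_left b0 (gevreyWeight_pos hρ s (i + 1)).le
      _ = (ρ * A) ^ (i + 1) / ((i : ℝ) + 1) ^ s := by
          unfold gevreyWeight; rw [hsucc, mul_pow ρ A]; field_simp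
      _ ≤ (ρ * A) ^ (i + 1) := div_le_self (by positivity) hi1
      _ ≤ _ := by gcongr; exact le_mul_of_one_le_right hA0.le e1
  · calc gevreyWeight ρ s i * gevreyBound D s (i + 1)
        ≤ gevreyWeight ρ s i * (A ^ (i + 1 + 1) * ((i + 1).factorial : ℝ) ^ s) :=
          mul_le_mul_of_nonneg_left b1 (gevreyWeight_pos hρ s i).le
      _ = A ^ 2 * (ρ * A) ^ i * ((i : ℝ) + 1) ^ s := by
          unfold gevreyWeight; rw [hsucc, mul_pow]; field_simp; ring
      _ ≤ A ^ 2 * (ρ * A) ^ i * Real.exp s ^ i := by gcongr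
      _ = _ := by rw [mul_assoc, ← mul_pow, mul_assoc ρ]

/-- A small radius makes all commutator terms, of order at least one, small. -/
lemma exists_radius (hs : 0 ≤ s) (hD : 0 < D) {b ℓ : ℝ} (hb : 0 < b) (hℓ : 0 < ℓ) (K : ℝ)
    (hK : 0 < K) :
    ∃ ρ : ℝ, 0 < ρ ∧ ρ ≤ 1 ∧ ρ * K ≤ 1 / 2 ∧ ∀ J : ℕ,
      ∑ i ∈ Finset.range J, gevreyWeight ρ s (i + 1) *
        (gevreyBound D s (i + 1) * ℓ + 2 * gevreyBound D s i) ≤ b / 8 ∧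
      (∑ i ∈ Finset.range J, gevreyWeight ρ s (i + 1) *
        (10 * (gevreyBound D s (i + 1) + gevreyBound D s (i + 2) * ℓ))) * (4 * ℓ / b) ≤ 1 / 2 := by
  set A := D * Real.exp s with hA
  set G := A * Real.exp s with hG
  have hA0 : 0 < A := by positivity
  have hG0 : 0 < G := by positivity
  -- The radius is `X⁻¹`; each summand of `X` enforces one of the required inequalities.
  set X : ℝ := 1 + 2 * K + 2 * G + 16 * (A * ℓ + 2) * G / b
    + 4 * (10 * (A + A ^ 2 * ℓ) * (4 * ℓ / b)) * G with hX
  have p1 : 0 < (A * ℓ + 2) * G / b := by positivity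
  have p2 : 0 < (10 * (A + A ^ 2 * ℓ) * (4 * ℓ / b)) * G := by positivity
  have hX0 : 0 < X := by positivity
  have hp1' : 16 * (A * ℓ + 2) * G / b = 16 * ((A * ℓ + 2) * G / b) := by ring
  have red : ∀ Y : ℝ, Y ≤ X → X⁻¹ * Y ≤ 1 := fun Y hY => by
    rw [inv_mul_le_iff₀ hX0]; linarith
  have hρ : 0 < X⁻¹ := by positivity
  have r0 := red 1 (by linarith)
  have r1 := red (2 * K) (by linarith)
  have r2 := red (2 * G) (by linarith)
  have r3 := red (16 * (A * ℓ + 2) * G / b) (by linarith)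
  have r4 := red (4 * (10 * (A + A ^ 2 * ℓ) * (4 * ℓ / b)) * G) (by linarith)
  generalize X⁻¹ = ρ at *
  have hx0 : 0 ≤ ρ * G := by positivity
  have hx1 : ρ * G ≤ 1 / 2 := by linarith
  refine ⟨ρ, hρ, by linarith, by linarith, fun J => ⟨?_, ?_⟩⟩
  · calc _ ≤ ∑ i ∈ Finset.range J, (A * ℓ + 2) * (ρ * G) ^ (i + 1) := by
          refine Finset.sum_le_sum fun i _ => ?_
          have h1 := (gevreyWeight_mul_gevreyBound_le hρ hD hs (i + 1)).1
          have h2 := (gevreyWeight_mul_gevreyBound_le hρ hD hs i).2.1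
          have h3 := mul_le_mul_of_nonneg_right h1 hℓ.le
          linarith
      _ ≤ (A * ℓ + 2) * (2 * (ρ * G)) := by
          rw [← Finset.mul_sum]
          exact mul_le_mul_of_nonneg_left (sum_pow_succ_le hx0 hx1 J) (by positivity)
      _ = (ρ * (16 * (A * ℓ + 2) * G / b)) * (b / 8) := by field_simp; ring
      _ ≤ 1 * (b / 8) := by gcongr
      _ = b / 8 := one_mul _
  · calc _ ≤ (∑ i ∈ Finset.range J, (10 * (A + A ^ 2 * ℓ)) * (ρ * G) ^ (i + 1))
          * (4 * ℓ / b) := by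
          refine mul_le_mul_of_nonneg_right (Finset.sum_le_sum fun i _ => ?_) (by positivity)
          have h1 := (gevreyWeight_mul_gevreyBound_le hρ hD hs (i + 1)).1
          have h2 := (gevreyWeight_mul_gevreyBound_le hρ hD hs (i + 1)).2.2
          have h3 := mul_le_mul_of_nonneg_right h2 hℓ.le
          linarith
      _ ≤ (10 * (A + A ^ 2 * ℓ)) * (2 * (ρ * G)) * (4 * ℓ / b) := by
          rw [← Finset.mul_sum]
          refine mul_le_mul_of_nonneg_right
            (mul_le_mul_of_nonneg_left (sum_pow_succ_le hx0 hx1 J) (by positivity)) (by positivity)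
      _ = (ρ * (4 * (10 * (A + A ^ 2 * ℓ) * (4 * ℓ / b)) * G)) * (1 / 2) := by ring
      _ ≤ 1 * (1 / 2) := by gcongr
      _ = 1 / 2 := one_mul _

/-- The combined growth of mixed derivatives splits, at the price of a larger constant. -/
lemma gevreyBound_add_le (hD : 0 < D) (hs : 0 ≤ s) (a j : ℕ) :
    gevreyBound D s (a + j) ≤ D * Real.exp s * (D * Real.exp s * 2 ^ s) ^ (a + j) *
      ((a.factorial : ℝ) ^ s * (j.factorial : ℝ) ^ s) := by
  have h1 := gevreyBound_le hD hs (a + j)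
  have h2 : (((a + j).factorial : ℕ) : ℝ) ^ s ≤
      (2 ^ s) ^ (a + j) * ((a.factorial : ℝ) ^ s * (j.factorial : ℝ) ^ s) := by
    have hf : ((a + j).factorial : ℝ) = (a + j).choose a * a.factorial * j.factorial := by
      rw [Nat.choose_symm_add]
      exact_mod_cast (Nat.add_choose_mul_factorial_mul_factorial a j).symm
    have hc : ((a + j).choose a : ℝ) ≤ 2 ^ (a + j) := by
      exact_mod_cast Nat.choose_le_two_pow (a + j) a
    calc _ ≤ (2 ^ (a + j) * a.factorial * j.factorial : ℝ) ^ s := by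
          rw [hf]
          exact Real.rpow_le_rpow (by positivity) (by gcongr) hs
      _ = _ := by
          rw [Real.mul_rpow (by positivity) (by positivity),
            Real.mul_rpow (by positivity) (by positivity), ← Real.rpow_natCast,
            ← Real.rpow_natCast, ← Real.rpow_mul (by positivity), ← Real.rpow_mul (by positivity),
            mul_comm s, mul_assoc]
  calc _ ≤ _ := h1
    _ ≤ (D * Real.exp s) ^ (a + j + 1) *
        ((2 ^ s) ^ (a + j) * ((a.factorial : ℝ) ^ s * (j.factorial : ℝ) ^ s)) := by gcongr
    _ = _ := by rw [mul_pow _ ((2 : ℝ) ^ s)]; ring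

/-- Gevrey bounds in terms of factorials are bounds of the form `(1 + j)^{js}`. -/
lemma factorial_rpow_mul_le (hs : 0 ≤ s) {a b j : ℕ} (h : a + b ≤ j) :
    (a.factorial : ℝ) ^ s * (b.factorial : ℝ) ^ s ≤ (1 + (j : ℝ)) ^ ((j : ℝ) * s) := by
  have h1 : a.factorial * b.factorial ≤ (1 + j) ^ j :=
    calc a.factorial * b.factorial ≤ (a + b).factorial :=
          Nat.le_of_dvd (Nat.factorial_pos _) (Nat.factorial_mul_factorial_dvd_factorial_add a b)
      _ ≤ j.factorial := Nat.factorial_le h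
      _ ≤ j ^ j := Nat.factorial_le_pow j
      _ ≤ (1 + j) ^ j := Nat.pow_le_pow_left (by omega) j
  have h2 : (a.factorial : ℝ) * b.factorial ≤ (1 + j) ^ j := by exact_mod_cast h1
  rw [← Real.mul_rpow (by positivity) (by positivity), Real.rpow_mul (by positivity),
    Real.rpow_natCast]
  exact Real.rpow_le_rpow (by positivity) h2 hs

end Gevrey

/-! ### Summation over the modes -/

section Summation

variable {L : ℝ} [hL : Fact (0 < L)]

lemma hasSum_norm_modeProj_sq (u : L2 L) :
    HasSum (fun n : ℤ => ‖modeProj n u‖ ^ 2) (L * ‖u‖ ^ 2) := by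
  have h := tsum_enorm_modeProj_sq u
  have hf : ENNReal.ofReal L * ‖u‖ₑ ^ 2 ≠ ⊤ :=
    ENNReal.mul_ne_top ENNReal.ofReal_ne_top (ENNReal.pow_ne_top enorm_ne_top)
  have h1 := ENNReal.hasSum_toReal (f := fun n : ℤ => ‖modeProj n u‖ₑ ^ 2) (by rw [h]; exact hf)
  have h2 : ∑' n : ℤ, (‖modeProj n u‖ₑ ^ 2).toReal = L * ‖u‖ ^ 2 := by
    rw [← ENNReal.tsum_toReal_eq fun n => ENNReal.pow_ne_top enorm_ne_top, h, ENNReal.toReal_mul,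
      ENNReal.toReal_ofReal hL.out.le, ENNReal.toReal_pow, toReal_enorm]
  rw [h2] at h1
  simpa only [ENNReal.toReal_pow, toReal_enorm] using h1

/-- Vertical difference quotients of a mode are bounded by the mode of the weak derivative. -/
lemma norm_dq_pow_modeProj_le {u : L2 L} {v : ℕ → L2 L} (hv : ∀ j, HasWeakDeriv 0 j u (v j))
    (n : ℤ) (h : ℝ) (j : ℕ) : ‖(dq volume h h ^ j) (modeProj n u)‖ ≤ ‖modeProj n (v j)‖ := by
  have key : ∀ i l, ‖(dq volume h h ^ l) (modeProj n (v i))‖ ≤ ‖modeProj n (v (i + l))‖ := by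
    intro i l
    induction l generalizing i with
    | zero => simp
    | succ l ih =>
      rw [pow_succ', mul_apply_eq_comp]
      have h1 := (((hv i).mode_dz_succ (hv (i + 1)) n).diffQuot_pow h h l).norm_dq_le h
      have h2 := ih (i + 1)
      rw [add_assoc, add_comm 1 l] at h2
      exact h1.trans h2
  have := key 0 j
  rwa [modeProj_of_hasWeakDeriv_zero (hv 0), zero_add] at this

/-- The estimates of the modes sum up to an estimate of all mixed difference quotients. -/
lemma norm_sq_dq_dq_le {w₀ w : L2 L} {W : ℕ → ℝ} {v : ℕ → ℕ → L2 L}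
    (hv : ∀ a j, HasWeakDeriv a j w₀ (v a j)) (h0 : modeProj 0 w = 0) {h : ℝ} {b : ℕ}
    (hn : ∀ n : ℤ, n ≠ 0 →
      ∑ j ∈ Finset.range (b + 1), W j ^ 2 * ‖(dq volume h h ^ j) (modeProj n w)‖ ^ 2 ≤
        4 * ∑ j ∈ Finset.range (b + 1), W j ^ 2 * ‖(dq volume h h ^ j) (modeProj n w₀)‖ ^ 2)
    (h' : ℝ) (a : ℕ) :
    W b ^ 2 * ‖(dq volume (((h' : AddCircle L), 0) : Channel L) h' ^ a)
        ((dq volume ((0, h) : Channel L) h ^ b) w)‖ ^ 2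
      ≤ 4 * ∑ j ∈ Finset.range (b + 1), W j ^ 2 * ‖v a j‖ ^ 2 := by
  set y := (dq volume ((0, h) : Channel L) h ^ b) w with hy
  set x := (dq volume (((h' : AddCircle L), 0) : Channel L) h' ^ a) y with hx
  have s1 := (hasSum_norm_modeProj_sq x).mul_left (W b ^ 2)
  have s2 : HasSum (fun n : ℤ => 4 * ∑ j ∈ Finset.range (b + 1), W j ^ 2 * ‖modeProj n (v a j)‖ ^ 2)
      (4 * ∑ j ∈ Finset.range (b + 1), W j ^ 2 * (L * ‖v a j‖ ^ 2)) :=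
    (hasSum_sum fun j _ => (hasSum_norm_modeProj_sq (v a j)).mul_left (W j ^ 2)).mul_left 4
  have hle : ∀ n : ℤ, W b ^ 2 * ‖modeProj n x‖ ^ 2 ≤
      4 * ∑ j ∈ Finset.range (b + 1), W j ^ 2 * ‖modeProj n (v a j)‖ ^ 2 := by
    intro n
    have hx1 : ‖modeProj n x‖ ≤ |waveNumber L n| ^ a * ‖(dq volume h h ^ b) (modeProj n w)‖ := by
      have := norm_modeProj_dq_fst_pow_le n h' a y
      rwa [hy, modeProj_dq_snd_pow] at this
    rcases eq_or_ne n 0 with rfl | hn0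
    · rw [h0, map_zero, norm_zero, mul_zero] at hx1
      rw [le_antisymm hx1 (norm_nonneg _)]
      have : 0 ≤ ∑ j ∈ Finset.range (b + 1), W j ^ 2 * ‖modeProj 0 (v a j)‖ ^ 2 := by positivity
      linarith
    -- The factor `|k|^a` of the horizontal difference quotients passes through the estimate for the
    -- mode and becomes the horizontal derivatives of the initial datum.
    · set q := |waveNumber L n| ^ a with hq
      have hv' : ∀ j, ‖modeProj n (v a j)‖ = q * ‖modeProj n (v 0 j)‖ := fun j => by
        rw [(hv 0 j).mode_dx_pow (hv a j) n, norm_smul, norm_pow, norm_mul, Complex.norm_I,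
          mul_one, Complex.norm_real, Real.norm_eq_abs]
      have e1 : W b ^ 2 * ‖(dq volume h h ^ b) (modeProj n w)‖ ^ 2 ≤
          4 * ∑ j ∈ Finset.range (b + 1), W j ^ 2 * ‖(dq volume h h ^ j) (modeProj n w₀)‖ ^ 2 :=
        (Finset.single_le_sum
          (f := fun j => W j ^ 2 * ‖(dq volume h h ^ j) (modeProj n w)‖ ^ 2)
          (fun j _ => by positivity) (Finset.self_mem_range_succ b)).trans (hn n hn0)
      calc W b ^ 2 * ‖modeProj n x‖ ^ 2
          ≤ W b ^ 2 * (q * ‖(dq volume h h ^ b) (modeProj n w)‖) ^ 2 := by gcongr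
        _ = q ^ 2 * (W b ^ 2 * ‖(dq volume h h ^ b) (modeProj n w)‖ ^ 2) := by ring
        _ ≤ q ^ 2 * (4 * ∑ j ∈ Finset.range (b + 1),
              W j ^ 2 * ‖(dq volume h h ^ j) (modeProj n w₀)‖ ^ 2) := by gcongr
        _ ≤ q ^ 2 * (4 * ∑ j ∈ Finset.range (b + 1), W j ^ 2 * ‖modeProj n (v 0 j)‖ ^ 2) := by
            gcongr with j
            exact norm_dq_pow_modeProj_le (hv 0) n h j
        _ = _ := by
            simp only [hv', Finset.mul_sum]
            refine Finset.sum_congr rfl fun j _ => by ring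
  have := hasSum_le hle s1 s2
  have hL0 := hL.out
  refine le_of_mul_le_mul_left ?_ hL0
  calc _ = W b ^ 2 * (L * ‖x‖ ^ 2) := by ring
    _ ≤ _ := this
    _ = _ := by
      simp only [Finset.mul_sum]
      refine Finset.sum_congr rfl fun j _ => by ring

end Summation

/-! ### Difference quotients of test functions -/

section Directional

/-- The difference quotient approximates the derivative to first order in the step. The step is
nonzero, as the quotient is `0` for `h = 0`. -/
lemma abs_fdq_sub_deriv_le {θ : ℝ → ℝ} (hθ : ContDiff ℝ ∞ θ) {C : ℝ}
    (hC : ∀ z, |deriv (deriv θ) z| ≤ C) {h : ℝ} (hh : h ≠ 0) (z : ℝ) :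
    |fdq h h θ z - deriv θ z| ≤ |h| * C := by
  have hC0 : 0 ≤ C := (abs_nonneg _).trans (hC 0)
  have hd := hθ.differentiable (by simp)
  have hd' := (contDiff_deriv hθ).differentiable (by simp)
  have h1 : ∀ y, |deriv θ y - deriv θ z| ≤ C * |y - z| := fun y =>
    Convex.norm_image_sub_le_of_norm_deriv_le (fun x _ => hd' x) (fun x _ => hC x)
      convex_univ (Set.mem_univ z) (Set.mem_univ y)
  have h2 : ∀ y ∈ Set.uIcc z (z + h), HasDerivWithinAt (fun y => θ y - deriv θ z * y)
      (deriv θ y - deriv θ z) (Set.uIcc z (z + h)) y := fun y _ => by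
    have := (hd y).hasDerivAt.sub ((hasDerivAt_id y).const_mul (deriv θ z))
    rw [mul_one] at this
    exact this.hasDerivWithinAt
  have h3 := Convex.norm_image_sub_le_of_norm_hasDerivWithin_le (C := C * |h|) h2 (fun y hy => by
    refine (h1 y).trans ?_
    have := Set.abs_sub_left_of_mem_uIcc hy
    rw [add_sub_cancel_left] at this
    gcongr) (convex_uIcc _ _) Set.left_mem_uIcc Set.right_mem_uIcc
  rw [add_sub_cancel_left, Real.norm_eq_abs, Real.norm_eq_abs] at h3
  have e : fdq h h θ z - deriv θ z
      = h⁻¹ * (θ (z + h) - deriv θ z * (z + h) - (θ z - deriv θ z * z)) := by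
    rw [fdq, smul_eq_mul]; field_simp; ring
  rw [e, abs_mul, abs_inv, inv_mul_le_iff₀ (by positivity)]
  linarith

lemma abs_iterate_fdq_sub_le {θ : ℝ → ℝ} (hθ : ContDiff ℝ ∞ θ) {C : ℝ} (b : ℕ)
    (hC : ∀ z, |iteratedDeriv (b + 1) θ z| ≤ C) {h : ℝ} (hh : h ≠ 0) (z : ℝ) :
    |(fdq h h)^[b] θ z - iteratedDeriv b θ z| ≤ b * (|h| * C) := by
  induction b generalizing θ z with
  | zero => simp
  | succ b ih =>
    have h1 := ih (contDiff_deriv hθ) (fun z => by rw [← iteratedDeriv_succ']; exact hC z)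
    set η : ℝ → ℝ := fun z => (fdq h h)^[b] θ z - iteratedDeriv b θ z with hη
    have s1 : ContDiff ℝ ∞ ((fdq h h)^[b] θ) := contDiff_iterate_fdq hθ h h b
    have s2 : ContDiff ℝ ∞ (iteratedDeriv b θ) := by
      rw [iteratedDeriv_eq_iterate]; exact hθ.iterate_deriv b
    have d1 := s1.differentiable (by simp)
    have d2 := s2.differentiable (by simp)
    have h2 : |fdq h h η z| ≤ b * (|h| * C) := by
      refine abs_fdq_le (d1.sub d2) (fun z => ?_) h z
      have : deriv η z = deriv ((fdq h h)^[b] θ) z - deriv (iteratedDeriv b θ) z :=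
        deriv_fun_sub (d1 z) (d2 z)
      change |deriv η z| ≤ _
      rw [this, deriv_iterate_fdq hθ, ← iteratedDeriv_succ, iteratedDeriv_succ']
      exact h1 z
    have h3 : |fdq h h (iteratedDeriv b θ) z - deriv (iteratedDeriv b θ) z| ≤ |h| * C :=
      abs_fdq_sub_deriv_le s2 (fun z => by
        rw [← iteratedDeriv_succ, ← iteratedDeriv_succ]; exact hC z) hh z
    have e : (fdq h h)^[b + 1] θ z - iteratedDeriv (b + 1) θ z = fdq h h η z
        + (fdq h h (iteratedDeriv b θ) z - deriv (iteratedDeriv b θ) z) := by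
      rw [Function.iterate_succ_apply', iteratedDeriv_succ]
      simp only [fdq, hη, smul_eq_mul]
      ring
    rw [e]
    refine (abs_add_le _ _).trans ?_
    push_cast
    linarith

variable {G : Type*} [AddCommGroup G]

/-- The derivative of `φ` along the one-parameter group `e`. -/
noncomputable def dirDeriv (e : ℝ →+ G) (φ : G → ℝ) (q : G) : ℝ :=
  deriv (fun s : ℝ => φ (q + e s)) 0

/-- The function `φ` is smooth along the orbits of the one-parameter group `e`. -/
def SmoothAlong (e : ℝ →+ G) (φ : G → ℝ) : Prop :=
  ∀ q, ContDiff ℝ ∞ fun s : ℝ => φ (q + e s)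

variable {e : ℝ →+ G} {φ : G → ℝ}

lemma dirDeriv_add (e : ℝ →+ G) (φ : G → ℝ) (q : G) (s : ℝ) :
    dirDeriv e φ (q + e s) = deriv (fun s : ℝ => φ (q + e s)) s := by
  have : (fun h : ℝ => φ (q + e s + e h)) = fun h => (fun s : ℝ => φ (q + e s)) (s + h) := by
    funext h
    change _ = φ (q + e (s + h))
    rw [e.map_add, add_assoc]
  rw [dirDeriv, this, deriv_comp_const_add (fun s : ℝ => φ (q + e s)) s 0, add_zero]

lemma iterate_dirDeriv_add (e : ℝ →+ G) (φ : G → ℝ) (i : ℕ) (q : G) (s : ℝ) :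
    (dirDeriv e)^[i] φ (q + e s) = iteratedDeriv i (fun s : ℝ => φ (q + e s)) s := by
  induction i generalizing φ with
  | zero => simp
  | succ i ih =>
    rw [Function.iterate_succ_apply, ih, iteratedDeriv_succ']
    simp_rw [dirDeriv_add]

lemma SmoothAlong.fdq (hφ : SmoothAlong e φ) (w : G) (h : ℝ) : SmoothAlong e (fdq w h φ) := by
  intro q
  have h1 := hφ (q + w)
  have h2 := hφ q
  have : (fun s : ℝ => InviscidDamping.fdq w h φ (q + e s))
      = fun s => h⁻¹ • (φ (q + w + e s) - φ (q + e s)) := by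
    funext s; rw [InviscidDamping.fdq, add_right_comm]
  rw [this]
  exact (h1.sub h2).const_smul _

lemma SmoothAlong.iterate_fdq (hφ : SmoothAlong e φ) (w : G) (h : ℝ) (i : ℕ) :
    SmoothAlong e ((InviscidDamping.fdq w h)^[i] φ) := by
  induction i with
  | zero => exact hφ
  | succ i ih => rw [Function.iterate_succ_apply']; exact ih.fdq w h

lemma SmoothAlong.dirDeriv (hφ : SmoothAlong e φ) : SmoothAlong e (dirDeriv e φ) := by
  intro q
  simp_rw [dirDeriv_add]
  exact contDiff_deriv (hφ q)

lemma SmoothAlong.dirDeriv_fdq (hφ : SmoothAlong e φ) (w : G) (h : ℝ) :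
    InviscidDamping.dirDeriv e (InviscidDamping.fdq w h φ)
      = InviscidDamping.fdq w h (InviscidDamping.dirDeriv e φ) := by
  funext q
  have h1 := ((hφ (q + w)).differentiable (by simp)) 0
  have h2 := ((hφ q).differentiable (by simp)) 0
  have : (fun s : ℝ => InviscidDamping.fdq w h φ (q + e s))
      = fun s => h⁻¹ • (φ (q + w + e s) - φ (q + e s)) := by
    funext s; rw [InviscidDamping.fdq, add_right_comm]
  rw [InviscidDamping.dirDeriv, this]
  exact ((h1.hasDerivAt.sub h2.hasDerivAt).const_smul h⁻¹).deriv

lemma SmoothAlong.dirDeriv_iterate_fdq (hφ : SmoothAlong e φ) (w : G) (h : ℝ) (i : ℕ) :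
    InviscidDamping.dirDeriv e ((InviscidDamping.fdq w h)^[i] φ)
      = (InviscidDamping.fdq w h)^[i] (InviscidDamping.dirDeriv e φ) := by
  induction i with
  | zero => rfl
  | succ i ih =>
    rw [Function.iterate_succ_apply', Function.iterate_succ_apply',
      (hφ.iterate_fdq w h i).dirDeriv_fdq, ih]

lemma SmoothAlong.iterate_dirDeriv_iterate_fdq (hφ : SmoothAlong e φ) (w : G) (h : ℝ) (i l : ℕ) :
    (InviscidDamping.dirDeriv e)^[l] ((InviscidDamping.fdq w h)^[i] φ)
      = (InviscidDamping.fdq w h)^[i] ((InviscidDamping.dirDeriv e)^[l] φ) := by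
  induction l generalizing φ with
  | zero => rfl
  | succ l ih =>
    rw [Function.iterate_succ_apply, Function.iterate_succ_apply, hφ.dirDeriv_iterate_fdq,
      ih hφ.dirDeriv]

lemma iterate_fdq_add (e : ℝ →+ G) (φ : G → ℝ) (h : ℝ) (i : ℕ) (q : G) (s : ℝ) :
    (fdq (e h) h)^[i] φ (q + e s) = (fdq h h)^[i] (fun s : ℝ => φ (q + e s)) s := by
  induction i generalizing φ with
  | zero => rfl
  | succ i ih =>
    rw [Function.iterate_succ_apply, Function.iterate_succ_apply, ih]
    refine congrFun (congrArg _ (funext fun s => ?_)) s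
    rw [fdq, fdq, e.map_add, add_assoc]

lemma SmoothAlong.abs_iterate_fdq_le (hφ : SmoothAlong e φ) {C : ℝ} (i : ℕ)
    (hC : ∀ q, |(InviscidDamping.dirDeriv e)^[i] φ q| ≤ C) (h : ℝ) (q : G) :
    |(InviscidDamping.fdq (e h) h)^[i] φ q| ≤ C := by
  have := InviscidDamping.abs_iterate_fdq_le (hφ q) i
    (fun s => by rw [← iterate_dirDeriv_add]; exact hC _) h 0
  rwa [← iterate_fdq_add, map_zero, add_zero] at this

lemma SmoothAlong.abs_iterate_fdq_sub_le (hφ : SmoothAlong e φ) {C : ℝ} (i : ℕ)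
    (hC : ∀ q, |(InviscidDamping.dirDeriv e)^[i + 1] φ q| ≤ C) {h : ℝ} (hh : h ≠ 0) (q : G) :
    |(InviscidDamping.fdq (e h) h)^[i] φ q - (InviscidDamping.dirDeriv e)^[i] φ q|
      ≤ i * (|h| * C) := by
  have := InviscidDamping.abs_iterate_fdq_sub_le (hφ q) i
    (fun s => by rw [← iterate_dirDeriv_add]; exact hC _) hh 0
  rwa [← iterate_fdq_add, ← iterate_dirDeriv_add, map_zero, add_zero] at this

/-- Mixed difference quotients converge to the mixed derivative, uniformly and at a rate. -/
lemma abs_fdq_fdq_sub_le {e' : ℝ →+ G} {a b : ℕ} (hφ : SmoothAlong e φ)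
    (hφ' : ∀ l, SmoothAlong e' ((dirDeriv e)^[l] φ)) {C C' : ℝ}
    (hC : ∀ q, |(dirDeriv e')^[a] ((dirDeriv e)^[b + 1] φ) q| ≤ C)
    (hC' : ∀ q, |(dirDeriv e')^[a + 1] ((dirDeriv e)^[b] φ) q| ≤ C') {h : ℝ} (hh : h ≠ 0) (q : G) :
    |(fdq (e h) h)^[b] ((fdq (e' h) h)^[a] φ) q - (dirDeriv e')^[a] ((dirDeriv e)^[b] φ) q|
      ≤ |h| * (b * C + a * C') := by
  have h1 := (hφ.iterate_fdq (e' h) h a).abs_iterate_fdq_sub_le b (C := C) (fun q => by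
    rw [hφ.iterate_dirDeriv_iterate_fdq]
    exact (hφ' (b + 1)).abs_iterate_fdq_le a hC h q) hh q
  rw [hφ.iterate_dirDeriv_iterate_fdq] at h1
  have h2 := (hφ' b).abs_iterate_fdq_sub_le a hC' hh q
  have h3 := abs_sub_le ((fdq (e h) h)^[b] ((fdq (e' h) h)^[a] φ) q)
    ((fdq (e' h) h)^[a] ((dirDeriv e)^[b] φ) q) ((dirDeriv e')^[a] ((dirDeriv e)^[b] φ) q)
  linarith

end Directional

/-! ### Weak compactness -/

/-- A bounded sequence in a Hilbert space has a weak limit point of no larger norm. -/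
lemma exists_weak_limit {H : Type*} [NormedAddCommGroup H] [InnerProductSpace ℂ H]
    [CompleteSpace H] {y : ℕ → H} {N : ℝ} (hy : ∀ n, ‖y n‖ ≤ N) :
    ∃ v : H, ‖v‖ ≤ N ∧ ∀ (x : H) (c : ℂ),
      Filter.Tendsto (fun n => inner ℂ x (y n)) Filter.atTop (nhds c) → inner ℂ x v = c := by
  have hK := WeakDual.isCompact_closedBall (𝕜 := ℂ) (0 : StrongDual ℂ H) N
  let Y : ℕ → WeakDual ℂ H := fun n =>
    StrongDual.toWeakDual (InnerProductSpace.toDual ℂ H (y n))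
  obtain ⟨F, hF, hlim⟩ := hK.ultrafilter_le_nhds ((Filter.hyperfilter ℕ).map Y) (by
    rw [Filter.le_principal_iff, Ultrafilter.coe_map]
    refine Filter.mem_map.2 (Filter.univ_mem' fun n => ?_)
    simp only [Set.mem_preimage, Metric.mem_closedBall, dist_zero_right]
    exact ((InnerProductSpace.toDual ℂ H).norm_map (y n)).trans_le (hy n))
  refine ⟨(InnerProductSpace.toDual ℂ H).symm (WeakDual.toStrongDual F), ?_, fun x c hc => ?_⟩
  · rw [LinearIsometryEquiv.norm_map]
    simpa [Metric.mem_closedBall, dist_zero_right] using hF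
  · have h1 : Filter.Tendsto (fun n => Y n x) (Filter.hyperfilter ℕ : Filter ℕ) (nhds (F x)) :=
      ((WeakDual.eval_continuous x).tendsto F).comp hlim
    have h2 := (Complex.continuous_conj.tendsto _).comp (hc.mono_left Nat.hyperfilter_le_atTop)
    have h3 : F x = (starRingEnd ℂ) c := by
      refine tendsto_nhds_unique h1 (h2.congr fun n => ?_)
      exact inner_conj_symm _ _
    rw [← inner_conj_symm, InnerProductSpace.toDual_symm_apply]
    exact (congrArg _ h3).trans (Complex.conj_conj c)

/-! ### Test functions on the channel -/

section ChannelTests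

variable {L : ℝ} {φ : Channel L → ℝ}

/-- The horizontal translations of the channel. -/
def horizontal (L : ℝ) : ℝ →+ Channel L :=
  (AddMonoidHom.inl (AddCircle L) ℝ).comp (QuotientAddGroup.mk' (AddSubgroup.zmultiples L))

/-- The vertical translations of the channel. -/
def vertical (L : ℝ) : ℝ →+ Channel L := AddMonoidHom.inr (AddCircle L) ℝ

lemma horizontal_apply (h : ℝ) : horizontal L h = ((h : AddCircle L), 0) := rfl

lemma vertical_apply (h : ℝ) : vertical L h = (0, h) := rfl

lemma pdx_eq_dirDeriv : (pdx : (Channel L → ℝ) → _) = dirDeriv (horizontal L) := by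
  funext φ q
  unfold pdx dirDeriv
  congr 1
  funext h
  rw [horizontal_apply, Prod.add_def, add_zero]

lemma pdz_eq_dirDeriv : (pdz : (Channel L → ℝ) → _) = dirDeriv (vertical L) := by
  funext φ q
  unfold pdz dirDeriv
  have : (fun s : ℝ => φ (q + vertical L s)) = fun s => (fun z => φ (q.1, z)) (q.2 + s) := by
    funext s
    rw [vertical_apply, Prod.add_def, add_zero]
  rw [this, deriv_comp_const_add (fun z => φ (q.1, z)), add_zero]

/-- The universal cover of the channel. -/
lemma isOpenQuotientMap_cover :
    IsOpenQuotientMap fun q : ℝ × ℝ => (((q.1 : AddCircle L), q.2) : Channel L) :=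
  IsOpenQuotientMap.prodMap QuotientAddGroup.isOpenQuotientMap_mk IsOpenQuotientMap.id

lemma IsTest.continuous (h : IsTest φ) : Continuous φ :=
  isOpenQuotientMap_cover.continuous_comp_iff.1 h.1.continuous

lemma IsTest.exists_abs_le (h : IsTest φ) : ∃ C, ∀ q, |φ q| ≤ C := by
  simpa using h.2.exists_bound_of_continuous h.continuous

lemma IsTest.smoothAlong_horizontal (h : IsTest φ) : SmoothAlong (horizontal L) φ := by
  rintro ⟨x, z⟩
  obtain ⟨x, rfl⟩ := QuotientAddGroup.mk_surjective x
  have : (fun s : ℝ => φ ((((x : ℝ) : AddCircle L), z) + horizontal L s))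
      = (fun q : ℝ × ℝ => φ ((q.1 : AddCircle L), q.2)) ∘ fun s => (x + s, z) := by
    funext s
    simp [horizontal_apply]
  exact this ▸ h.1.comp (by fun_prop)

lemma IsTest.smoothAlong_vertical (h : IsTest φ) : SmoothAlong (vertical L) φ := by
  rintro ⟨x, z⟩
  obtain ⟨x, rfl⟩ := QuotientAddGroup.mk_surjective x
  have : (fun s : ℝ => φ ((((x : ℝ) : AddCircle L), z) + vertical L s))
      = (fun q : ℝ × ℝ => φ ((q.1 : AddCircle L), q.2)) ∘ fun s => (x, z + s) := by
    funext s
    simp [vertical_apply]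
  exact this ▸ h.1.comp (by fun_prop)

lemma hasCompactSupport_dirDeriv (h : HasCompactSupport φ) {e : ℝ →+ Channel L}
    (he : Continuous e) : HasCompactSupport (dirDeriv e φ) := by
  refine HasCompactSupport.intro h fun q hq => ?_
  have h1 : φ =ᶠ[nhds q] 0 := notMem_tsupport_iff_eventuallyEq.1 hq
  have h2 : Filter.Tendsto (fun s : ℝ => q + e s) (nhds 0) (nhds q) := by
    have : Continuous fun s : ℝ => q + e s := continuous_const.add he
    simpa using this.tendsto 0
  have h3 : (fun s : ℝ => φ (q + e s)) =ᶠ[nhds 0] fun _ => 0 := h2.eventually h1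
  rw [dirDeriv, h3.deriv_eq, deriv_const]

lemma continuous_horizontal : Continuous (horizontal L) :=
  (continuous_quotient_mk'.prodMk continuous_const : Continuous fun h : ℝ =>
    (((h : AddCircle L), 0) : Channel L))

lemma continuous_vertical : Continuous (vertical L) :=
  (continuous_const.prodMk continuous_id : Continuous fun h : ℝ => ((0, h) : Channel L))

lemma IsTest.dirDeriv_horizontal (h : IsTest φ) : IsTest (dirDeriv (horizontal L) φ) := by
  refine ⟨?_, hasCompactSupport_dirDeriv h.2 continuous_horizontal⟩
  set Φ : ℝ × ℝ → ℝ := fun q => φ ((q.1 : AddCircle L), q.2) with hΦ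
  have h1 : (fun q : ℝ × ℝ => dirDeriv (horizontal L) φ ((q.1 : AddCircle L), q.2))
      = fun q => fderiv ℝ Φ q (1, 0) := by
    funext q
    have hd : HasFDerivAt Φ (fderiv ℝ Φ q) q := (h.1.differentiable (by simp) q).hasFDerivAt
    have hl := hd.hasLineDerivAt (1, 0)
    refine Eq.trans ?_ (HasDerivAt.deriv hl)
    unfold dirDeriv
    congr 1
    funext s
    simp [hΦ, horizontal_apply]
  rw [h1]
  exact (h.1.fderiv_right (m := ∞) (by simp)).clm_apply contDiff_const

lemma IsTest.dirDeriv_vertical (h : IsTest φ) : IsTest (dirDeriv (vertical L) φ) := by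
  refine ⟨?_, hasCompactSupport_dirDeriv h.2 continuous_vertical⟩
  set Φ : ℝ × ℝ → ℝ := fun q => φ ((q.1 : AddCircle L), q.2) with hΦ
  have h1 : (fun q : ℝ × ℝ => dirDeriv (vertical L) φ ((q.1 : AddCircle L), q.2))
      = fun q => fderiv ℝ Φ q (0, 1) := by
    funext q
    have hd : HasFDerivAt Φ (fderiv ℝ Φ q) q := (h.1.differentiable (by simp) q).hasFDerivAt
    have hl := hd.hasLineDerivAt (0, 1)
    refine Eq.trans ?_ (HasDerivAt.deriv hl)
    unfold dirDeriv
    congr 1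
    funext s
    simp [hΦ, vertical_apply]
  rw [h1]
  exact (h.1.fderiv_right (m := ∞) (by simp)).clm_apply contDiff_const

lemma IsTest.iterate_dirDeriv (h : IsTest φ) (a b : ℕ) :
    IsTest ((dirDeriv (horizontal L))^[a] ((dirDeriv (vertical L))^[b] φ)) := by
  have h1 : IsTest ((dirDeriv (vertical L))^[b] φ) := by
    induction b with
    | zero => exact h
    | succ b ih => rw [Function.iterate_succ_apply']; exact ih.dirDeriv_vertical
  induction a with
  | zero => exact h1
  | succ a ih => rw [Function.iterate_succ_apply']; exact ih.dirDeriv_horizontal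

/-- Difference quotients enlarge the vertical extent of the support by at most the shift. -/
lemma iterate_fdq_eq_zero {R r : ℝ} (hφ : ∀ q, R < |q.2| → φ q = 0) {w : Channel L}
    (hr : |w.2| ≤ r) (h : ℝ) (i : ℕ) : ∀ q, R + i * r < |q.2| → (fdq w h)^[i] φ q = 0 := by
  have hr0 : 0 ≤ r := (abs_nonneg _).trans hr
  induction i with
  | zero => simpa using hφ
  | succ i ih =>
    intro q hq
    push_cast at hq
    have h1 : R + i * r < |q.2| := by linarith
    have h2 : R + i * r < |(q + w).2| := by
      have : |q.2| ≤ |(q + w).2| + |w.2| := by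
        have := abs_sub (q.2 + w.2) w.2
        rwa [add_sub_cancel_right] at this
      linarith
    rw [Function.iterate_succ_apply', fdq, ih _ h1, ih _ h2, sub_zero, smul_zero]

lemma exists_vertical_bound (h : HasCompactSupport φ) : ∃ R, 0 ≤ R ∧ ∀ q, R < |q.2| → φ q = 0 := by
  have h1 : IsCompact (Prod.snd '' tsupport φ) := h.isCompact.image continuous_snd
  obtain ⟨R, hR⟩ := h1.isBounded.exists_norm_le
  refine ⟨max R 0, le_max_right _ _, fun q hq => image_eq_zero_of_notMem_tsupport fun hq' => ?_⟩
  exact absurd ((hR _ ⟨q, hq', rfl⟩).trans (le_max_left R 0)) (not_le.2 hq)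

lemma continuous_iterate_fdq (h : Continuous φ) (w : Channel L) (t : ℝ) (i : ℕ) :
    Continuous ((fdq w t)^[i] φ) := by
  induction i with
  | zero => exact h
  | succ i ih =>
    rw [Function.iterate_succ_apply']
    unfold fdq
    fun_prop

lemma hasCompactSupport_iterate_fdq (h : HasCompactSupport φ) (w : Channel L) (t : ℝ) (i : ℕ) :
    HasCompactSupport ((fdq w t)^[i] φ) := by
  induction i with
  | zero => exact h
  | succ i ih =>
    rw [Function.iterate_succ_apply']
    unfold fdq
    exact HasCompactSupport.mul_left (f := fun _ => t⁻¹)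
      ((ih.comp_homeomorph (Homeomorph.addRight w)).sub ih)

end ChannelTests

section Channel

variable {L : ℝ} [hL : Fact (0 < L)] {φ : Channel L → ℝ}

/-- Summation by parts. -/
lemma integral_smul_dq (h1 : Continuous φ) (h2 : HasCompactSupport φ) (w : Channel L) (t : ℝ)
    (u : L2 L) :
    ∫ q, φ q • dq volume w t u q = -∫ q, fdq (-w) (-t) φ q • u q := by
  have h1' : Continuous fun q => φ (q - w) := by fun_prop
  have h2' : HasCompactSupport fun q => φ (q - w) := h2.comp_homeomorph (Homeomorph.subRight w)
  have e1 : ∫ q, φ q • trans volume w u q = ∫ q, φ (q - w) • u q := by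
    rw [← integral_add_right_eq_self (fun q => φ (q - w) • u q) w]
    apply integral_congr_ae
    filter_upwards [trans_coe w u] with q hq
    rw [hq, add_sub_cancel_right]
  have i1 := integrable_smul_Lp h1 h2 (trans volume w u)
  have i2 := integrable_smul_Lp h1 h2 u
  have i3 := integrable_smul_Lp h1' h2' u
  have e2 : ∫ q, φ q • dq volume w t u q
      = (t : ℂ)⁻¹ * ((∫ q, φ q • trans volume w u q) - ∫ q, φ q • u q) := by
    rw [← integral_sub i1 i2, ← integral_const_mul]
    apply integral_congr_ae
    rw [dq_apply]
    filter_upwards [Lp.coeFn_smul (t : ℂ)⁻¹ (trans volume w u - u),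
      Lp.coeFn_sub (trans volume w u) u] with q a1 a2
    rw [a1, Pi.smul_apply, a2, Pi.sub_apply]
    simp only [smul_eq_mul, Complex.real_smul]
    ring
  rw [e2, e1, ← integral_sub i3 i2, ← integral_const_mul, ← integral_neg]
  refine integral_congr_ae (Filter.Eventually.of_forall fun q => ?_)
  simp only [fdq, smul_eq_mul, Complex.real_smul, ← sub_eq_add_neg]
  push_cast
  rw [inv_neg]
  ring

lemma integral_smul_dq_pow (h1 : Continuous φ) (h2 : HasCompactSupport φ) (w : Channel L) (t : ℝ)
    (i : ℕ) (u : L2 L) :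
    ∫ q, φ q • (dq volume w t ^ i) u q = (-1) ^ i * ∫ q, (fdq (-w) (-t))^[i] φ q • u q := by
  induction i generalizing u with
  | zero => simp
  | succ i ih =>
    rw [pow_succ, mul_apply_eq_comp, ih, integral_smul_dq (continuous_iterate_fdq h1 _ _ i)
      (hasCompactSupport_iterate_fdq h2 _ _ i), Function.iterate_succ_apply']
    ring

/-- Uniform bounds for all mixed difference quotients give a weak derivative with the same bound. -/
lemma exists_hasWeakDeriv_of_norm_dq_le {u : L2 L} {a b : ℕ} {N : ℝ}
    (hN : ∀ t : ℝ, ‖(dq volume (((t : AddCircle L), 0) : Channel L) t ^ a)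
        ((dq volume ((0, t) : Channel L) t ^ b) u)‖ ≤ N) :
    ∃ v : L2 L, HasWeakDeriv a b u v ∧ ‖v‖ ≤ N := by
  set t : ℕ → ℝ := fun n => 1 / ((n : ℝ) + 1) with ht
  have ht0 : ∀ n, 0 < t n := fun n => by rw [ht]; positivity
  have ht1 : ∀ n, t n ≤ 1 := fun n => by
    rw [ht]
    exact (div_le_one (by positivity)).2 (by linarith [n.cast_nonneg (α := ℝ)])
  have htl : Filter.Tendsto t Filter.atTop (nhds 0) := tendsto_one_div_add_atTop_nhds_zero_nat
  -- With negative steps, summation by parts puts forward difference quotients on the test function.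
  obtain ⟨v, hv, hlim⟩ := exists_weak_limit (fun n => hN (-t n))
  refine ⟨v, fun φ hφ => ?_, hv⟩
  rw [pdx_eq_dirDeriv, pdz_eq_dirDeriv]
  set ℓ := (dirDeriv (horizontal L))^[a] ((dirDeriv (vertical L))^[b] φ) with hℓ
  have hℓt : IsTest ℓ := hφ.iterate_dirDeriv a b
  obtain ⟨C, hC⟩ := (hφ.iterate_dirDeriv a (b + 1)).exists_abs_le
  obtain ⟨C', hC'⟩ := (hφ.iterate_dirDeriv (a + 1) b).exists_abs_le
  obtain ⟨R₁, hR₁0, hR₁⟩ := exists_vertical_bound hφ.2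
  obtain ⟨R₂, hR₂0, hR₂⟩ := exists_vertical_bound hℓt.2
  set F : ℕ → Channel L → ℝ := fun n =>
    (fdq (vertical L (t n)) (t n))^[b] ((fdq (horizontal L (t n)) (t n))^[a] φ) with hF
  have hFc : ∀ n, Continuous (F n) := fun n =>
    continuous_iterate_fdq (continuous_iterate_fdq hφ.continuous _ _ a) _ _ b
  have hFs : ∀ n, HasCompactSupport (F n) := fun n =>
    hasCompactSupport_iterate_fdq (hasCompactSupport_iterate_fdq hφ.2 _ _ a) _ _ b
  -- All difference quotients of `φ` of order `b` with steps at most `1`, and the derivative `ℓ`, are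
  -- supported in `K`. There they converge uniformly, while `u` is integrable over `K`.
  set R := R₁ + b + R₂ with hR
  set K : Set (Channel L) := Set.univ ×ˢ Set.Icc (-R) R with hK
  have hKc : IsCompact K := isCompact_univ.prod isCompact_Icc
  have hKm : MeasurableSet K := MeasurableSet.univ.prod measurableSet_Icc
  set B := b * C + a * C' with hB
  have hdiff : ∀ n q, |F n q - ℓ q| ≤ t n * B := fun n q => by
    have := abs_fdq_fdq_sub_le (e := vertical L) (e' := horizontal L) (a := a) (b := b)
      hφ.smoothAlong_vertical (fun l => (hφ.iterate_dirDeriv 0 l).smoothAlong_horizontal)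
      hC hC' (ht0 n).ne' q
    rwa [abs_of_pos (ht0 n)] at this
  have hzero : ∀ n q, q ∉ K → F n q - ℓ q = 0 := fun n q hq => by
    have hq' : R < |q.2| := by
      by_contra hcon
      exact hq ⟨trivial, abs_le.1 (not_lt.1 hcon)⟩
    have z1 := iterate_fdq_eq_zero hR₁ (w := horizontal L (t n)) (r := 0)
      (by simp [horizontal_apply]) (t n) a
    have z2 := iterate_fdq_eq_zero z1 (w := vertical L (t n)) (r := 1)
      (by rw [vertical_apply, abs_of_pos (ht0 n)]; exact ht1 n) (t n) b
    have z3 : F n q = 0 := z2 q (by rw [hR] at hq'; linarith)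
    rw [z3, hR₂ q (by rw [hR] at hq'; linarith [b.cast_nonneg (α := ℝ)]), sub_zero]
  have hKi : Integrable (K.indicator fun q => ‖u q‖) := by
    rw [integrable_indicator_iff hKm]
    exact (((Lp.memLp u).locallyIntegrable (by norm_num)).integrableOn_isCompact hKc).norm
  have conv : Filter.Tendsto (fun n => ∫ q, F n q • u q) Filter.atTop
      (nhds (∫ q, ℓ q • u q)) := by
    rw [tendsto_iff_norm_sub_tendsto_zero]
    refine squeeze_zero (g := fun n => t n * (B * ∫ q, K.indicator (fun q => ‖u q‖) q))
      (fun n => norm_nonneg _) (fun n => ?_) (by simpa using htl.mul_const _)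
    rw [← integral_sub (integrable_smul_Lp (hFc n) (hFs n) u)
      (integrable_smul_Lp hℓt.continuous hℓt.2 u), ← integral_const_mul, ← integral_const_mul]
    refine norm_integral_le_of_norm_le ((hKi.const_mul _).const_mul _)
      (Filter.Eventually.of_forall fun q => ?_)
    rw [← sub_smul, norm_smul]
    by_cases hq : q ∈ K
    · rw [Set.indicator_of_mem hq, ← mul_assoc]
      exact mul_le_mul_of_nonneg_right (hdiff n q) (norm_nonneg _)
    · rw [hzero n q hq, Set.indicator_of_notMem hq]
      simp
  have hm : MemLp (fun q => (φ q : ℂ)) 2 (volume : Measure (Channel L)) :=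
    (Complex.continuous_ofReal.comp hφ.continuous).memLp_of_hasCompactSupport
      (hφ.2.comp_left (g := Complex.ofReal) rfl)
  have hinner : ∀ y : L2 L, inner ℂ (hm.toLp _) y = ∫ q, φ q • y q := fun y => by
    rw [inner_eq_integral]
    apply integral_congr_ae
    filter_upwards [hm.coeFn_toLp] with q hq
    rw [hq, Complex.conj_ofReal, Complex.real_smul, mul_comm]
  have hy : ∀ n, inner ℂ (hm.toLp _)
      ((dq volume (((-t n : ℝ) : AddCircle L), 0) (-t n) ^ a)
        ((dq volume ((0, -t n) : Channel L) (-t n) ^ b) u))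
      = (-1) ^ (a + b) * ∫ q, F n q • u q := fun n => by
    have w1 : -((((-t n : ℝ) : AddCircle L), 0) : Channel L) = horizontal L (t n) := by
      rw [← horizontal_apply, map_neg, neg_neg]
    have w2 : -((0, -t n) : Channel L) = vertical L (t n) := by
      rw [← vertical_apply, map_neg, neg_neg]
    rw [hinner, integral_smul_dq_pow hφ.continuous hφ.2, integral_smul_dq_pow
      (continuous_iterate_fdq hφ.continuous _ _ a) (hasCompactSupport_iterate_fdq hφ.2 _ _ a),
      w1, w2, neg_neg, ← mul_assoc, ← pow_add]
  have hres := hlim (hm.toLp _) ((-1) ^ (a + b) * ∫ q, ℓ q • u q) (by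
    simp_rw [hy]
    exact conv.const_mul _)
  rw [hinner] at hres
  rw [hres, Complex.real_smul, ← mul_assoc]
  push_cast
  rw [← mul_pow]
  simp

end Channel

/-! ### Coefficients in a Gevrey class -/

section GevreyCoefficients

/-- Bounds for the derivatives of `f`: the Gevrey bounds, improved to `η` for `f` and `f'`. -/
noncomputable def coeffBound (D s η : ℝ) (i : ℕ) : ℝ :=
  if i ≤ 1 then min η (gevreyBound D s i) else gevreyBound D s i

lemma coeffBound_le (D s η : ℝ) (i : ℕ) : coeffBound D s η i ≤ gevreyBound D s i := by
  unfold coeffBound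
  split_ifs
  · exact min_le_right _ _
  · exact le_rfl

lemma coeffBound_le_of_le_one (D s η : ℝ) {i : ℕ} (hi : i ≤ 1) : coeffBound D s η i ≤ η := by
  unfold coeffBound
  rw [if_pos hi]
  exact min_le_left _ _

lemma contDiff_of_cNorm_le {h : ℝ → ℝ} {D s : ℝ} (hD : 0 < D)
    (hj : ∀ j, cNorm j h ≤ ENNReal.ofReal (gevreyBound D s j)) : ContDiff ℝ ∞ h :=
  contDiff_infty.2 fun j => (of_cNorm_le (gevreyBound_pos hD s j).le (hj j)).1

/-- The coefficients of a bilipschitz shear flow satisfy the hypotheses of the mode estimate, with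
`f` and `f'` bounded by `c / L`. -/
lemma IsBilipschitz.coeffBounds {κ : ℝ≥0} {U : ℝ → ℝ} (hκ : IsBilipschitz κ U)
    (hU : ContDiff ℝ 2 U) {D s c L : ℝ} (hD : 0 < D) (hL : 0 < L)
    (hs : wOneInftyNorm (coeffF U) * ENNReal.ofReal L < ENNReal.ofReal c)
    (hC : ∀ j, cNorm j (coeffF U) + cNorm j (coeffG U) ≤ ENNReal.ofReal (gevreyBound D s j)) :
    CoeffBounds (coeffF U) (fun z => coeffG U z ^ 2) (coeffBound D s (c / L))
      (fun i => if i = 0 then gevreyBound D s 0 ^ 2 else 2 * coeffBound D s (c / L) (i - 1))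
      ((max (κ : ℝ) 1)⁻¹ ^ 2) := by
  have hCf := fun j => (le_self_add.trans (hC j) : cNorm j (coeffF U) ≤ _)
  have hCg := fun j => (le_add_self.trans (hC j) : cNorm j (coeffG U) ≤ _)
  have hf := contDiff_of_cNorm_le hD hCf
  have hg := contDiff_of_cNorm_le hD hCg
  have hf_le : ∀ i z, |iteratedDeriv i (coeffF U) z| ≤ coeffBound D s (c / L) i := by
    intro i z
    have h1 := (of_cNorm_le (gevreyBound_pos hD s i).le (hCf i)).2 z
    unfold coeffBound
    split_ifs with hi
    · refine le_min ?_ h1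
      have h2 := abs_le_of_wOneInftyNorm_mul_lt hf hL hs z
      interval_cases i
      · simpa using h2.1
      · simpa using h2.2
    · exact h1
  refine ⟨hf, hg.pow 2, hf_le, fun i z => ?_, fun z => ?_⟩
  · cases i with
    | zero =>
      have h1 := (of_cNorm_le (gevreyBound_pos hD s 0).le (hCg 0)).2 z
      rw [iteratedDeriv_zero] at h1 ⊢
      rw [if_pos rfl, abs_pow]
      gcongr
    | succ i =>
      rw [iteratedDeriv_sq_succ (hg.differentiable (by simp)) (hκ.coeffG_mul_deriv hU) hf,
        abs_mul, abs_of_pos (by norm_num : (0 : ℝ) < 2), if_neg (Nat.succ_ne_zero i),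
        Nat.add_sub_cancel]
      exact mul_le_mul_of_nonneg_left (hf_le i z) (by norm_num)
  · have h1 := hκ.inv_le_abs_coeffG hU z
    have h2 : (max (κ : ℝ) 1)⁻¹ ≤ (κ : ℝ)⁻¹ := inv_anti₀ hκ.pos (le_max_left _ _)
    rw [← sq_abs (coeffG U z)]
    have := h2.trans h1
    gcongr

/-- In a thin channel the nonzero wave numbers are large. -/
lemma inv_abs_waveNumber_le {L : ℝ} (hL : 0 < L) {n : ℤ} (hn : n ≠ 0) :
    waveNumber L n ≠ 0 ∧ 1 / |waveNumber L n| ≤ L := by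
  have hn1 : (1 : ℝ) ≤ |(n : ℝ)| := by exact_mod_cast Int.one_le_abs hn
  have h1 : 1 / L ≤ |waveNumber L n| := by
    rw [waveNumber, abs_div, abs_mul, abs_of_pos hL, abs_of_pos Real.two_pi_pos]
    gcongr
    nlinarith [Real.pi_gt_three]
  have h2 : 0 < |waveNumber L n| := (by positivity : 0 < 1 / L).trans_le h1
  refine ⟨abs_pos.1 h2, ?_⟩
  rw [div_le_iff₀ h2]
  rwa [div_le_iff₀' hL] at h1

/-- The smallness conditions of the mode estimate: the terms without commutators are small by the
choice of `c`, the others by the choice of the radius `ρ`. -/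
lemma smallness {ρ s D b ℓ c L q : ℝ} (hρ : 0 < ρ) (hb : 0 < b) (hℓ : 0 < ℓ)
    (hD : 0 < D) (hL : 0 < L) (hLℓ : L ≤ ℓ) (hq : 0 < q) (hqL : 1 / q ≤ L) (hc0 : 0 ≤ c)
    (hc : c * (80 * (1 + ℓ)) ≤ b)
    (hr : ∀ J : ℕ, ∑ i ∈ Finset.range J, gevreyWeight ρ s (i + 1) *
        (gevreyBound D s (i + 1) * ℓ + 2 * gevreyBound D s i) ≤ b / 8 ∧
      (∑ i ∈ Finset.range J, gevreyWeight ρ s (i + 1) *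
        (10 * (gevreyBound D s (i + 1) + gevreyBound D s (i + 2) * ℓ))) * (4 * ℓ / b) ≤ 1 / 2)
    (J : ℕ) :
    ∑ i ∈ Finset.range (J + 1), gevreyWeight ρ s i * (coeffBound D s (c / L) i / q + if i = 0 then 0
      else if i = 0 then gevreyBound D s 0 ^ 2 else 2 * coeffBound D s (c / L) (i - 1)) ≤ b / 4 ∧
    (∑ i ∈ Finset.range (J + 1), gevreyWeight ρ s i *
      (10 * (coeffBound D s (c / L) i + coeffBound D s (c / L) (i + 1) / q))) * (4 / (q * b)) ≤ 1 := by
  obtain ⟨r1, r2⟩ := hr J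
  have hη : 0 ≤ c / L := by positivity
  have f0 := coeffBound_le_of_le_one D s (c / L) (zero_le_one (α := ℕ))
  have f1 := coeffBound_le_of_le_one D s (c / L) (le_refl 1)
  have hcL : c / L * L = c := by field_simp
  have hdiv : ∀ {x y : ℝ}, x ≤ y → 0 ≤ y → ∀ {M : ℝ}, L ≤ M → x / q ≤ y * M :=
    fun {x y} hxy hy {M} hM => by
      calc x / q ≤ y / q := by gcongr
        _ = y * (1 / q) := by ring
        _ ≤ y * M := by gcongr; exact hqL.trans hM
  have hB : ∀ i, 0 ≤ gevreyBound D s i := fun i => (gevreyBound_pos hD s i).le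
  have hW : ∀ i, 0 ≤ gevreyWeight ρ s i := fun i => (gevreyWeight_pos hρ s i).le
  constructor
  · rw [Finset.sum_range_succ', gevreyWeight_zero, if_pos rfl, add_zero, one_mul]
    have h0 : coeffBound D s (c / L) 0 / q ≤ b / 8 := by
      refine (hdiv f0 hη le_rfl).trans ?_
      rw [hcL]
      nlinarith
    have h1 : ∑ i ∈ Finset.range J, gevreyWeight ρ s (i + 1) *
        (coeffBound D s (c / L) (i + 1) / q + if i + 1 = 0 then 0
          else if i + 1 = 0 then gevreyBound D s 0 ^ 2
          else 2 * coeffBound D s (c / L) (i + 1 - 1)) ≤ b / 8 := by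
      refine le_trans (Finset.sum_le_sum fun i _ => mul_le_mul_of_nonneg_left ?_ (hW _)) r1
      rw [if_neg (Nat.succ_ne_zero i), if_neg (Nat.succ_ne_zero i), Nat.add_sub_cancel]
      have := hdiv (coeffBound_le D s (c / L) (i + 1)) (hB _) hLℓ
      have := coeffBound_le D s (c / L) i
      linarith
    linarith
  · have h4 : 4 / (q * b) ≤ 4 * L / b := by
      rw [show 4 / (q * b) = 4 * (1 / q) / b by field_simp]
      gcongr
    have h4' : 4 * L / b ≤ 4 * ℓ / b := by gcongr
    have h40 : 0 < 4 / (q * b) := by positivity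
    rw [Finset.sum_range_succ', gevreyWeight_zero, one_mul, add_mul]
    have h0 : (10 * (coeffBound D s (c / L) 0 + coeffBound D s (c / L) (0 + 1) / q))
        * (4 / (q * b)) ≤ 1 / 2 := by
      calc _ ≤ (10 * (c / L + c / L * L)) * (4 / (q * b)) := by
            have := hdiv f1 hη le_rfl
            gcongr
        _ ≤ (10 * (c / L + c / L * L)) * (4 * L / b) := by gcongr
        _ = c * (40 * (1 + L)) / b := by field_simp; ring
        _ ≤ c * (40 * (1 + ℓ)) / b := by gcongr
        _ ≤ 1 / 2 := by rw [div_le_iff₀ hb]; linarith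
    have h1 : (∑ i ∈ Finset.range J, gevreyWeight ρ s (i + 1) *
        (10 * (coeffBound D s (c / L) (i + 1) + coeffBound D s (c / L) (i + 1 + 1) / q)))
        * (4 / (q * b)) ≤ 1 / 2 := by
      refine le_trans (mul_le_mul (Finset.sum_le_sum fun i _ => mul_le_mul_of_nonneg_left ?_ (hW _))
        (h4.trans h4') h40.le ?_) r2
      · have h5 := hdiv (coeffBound_le D s (c / L) (i + 1 + 1)) (hB _) hLℓ
        have h6 := coeffBound_le D s (c / L) (i + 1)
        linarith
      · refine Finset.sum_nonneg fun i _ => mul_nonneg (hW _) ?_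
        have := hB (i + 1)
        have := mul_nonneg (hB (i + 2)) hℓ.le
        linarith
    linarith

end GevreyCoefficients

/-! ### Sobolev norms -/

section Sobolev

variable {L : ℝ} [hL : Fact (0 < L)]

/-- A bound for the Sobolev norm provides weak derivatives. The factor two leaves room for the
infimum, which avoids an appeal to the uniqueness of weak derivatives. -/
lemma exists_hasWeakDeriv_of_sobolevNorm_le {u : L2 L} {a b : ℕ} {B : ℝ} (hB : 0 < B)
    (h : sobolevNorm (a + b) u ≤ ENNReal.ofReal B) :
    ∃ v : L2 L, HasWeakDeriv a b u v ∧ ‖v‖ ≤ 2 * B := by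
  set T : ℕ × ℕ → ℝ≥0∞ := fun ab => ⨅ v : L2 L, ⨅ _ : HasWeakDeriv ab.1 ab.2 u v, ‖v‖ₑ ^ 2 with hT
  have h1 : T (a, b) ≤ ENNReal.ofReal B ^ 2 := by
    have h2 : T (a, b) ≤ ∑ m ∈ Finset.range (a + b + 1),
        ∑ ab ∈ Finset.HasAntidiagonal.antidiagonal m, T ab :=
      (Finset.single_le_sum (f := T) (fun _ _ => zero_le)
        (Finset.HasAntidiagonal.mem_antidiagonal.2 rfl)).trans
      (Finset.single_le_sum
        (f := fun m => ∑ ab ∈ Finset.HasAntidiagonal.antidiagonal m, T ab)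
        (fun _ _ => zero_le) (Finset.self_mem_range_succ (a + b)))
    have h3 := ENNReal.rpow_le_rpow h (by norm_num : (0 : ℝ) ≤ 2)
    rw [sobolevNorm, ← ENNReal.rpow_mul, ENNReal.rpow_two] at h3
    norm_num at h3
    exact h2.trans h3
  have h2 : ENNReal.ofReal B ^ 2 < ENNReal.ofReal (2 * B) ^ 2 := by
    rw [← ENNReal.ofReal_pow hB.le, ← ENNReal.ofReal_pow (by positivity),
      ENNReal.ofReal_lt_ofReal_iff (by positivity)]
    nlinarith
  obtain ⟨v, hv⟩ := iInf_lt_iff.1 (h1.trans_lt h2)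
  obtain ⟨hd, hv⟩ := iInf_lt_iff.1 hv
  refine ⟨v, hd, ?_⟩
  have h3 : ‖v‖ₑ ≤ ENNReal.ofReal (2 * B) := by
    by_contra hcon
    exact absurd hv (not_lt.2 (by gcongr; exact (not_le.1 hcon).le))
  rwa [← ofReal_norm, ENNReal.ofReal_le_ofReal_iff (by positivity)] at h3

/-- There are at most `(j + 1)²` weak derivatives of order at most `j`. -/
lemma sobolevNorm_le_of_hasWeakDeriv {u : L2 L} {j : ℕ} {N : ℝ}
    (h : ∀ a b, a + b ≤ j → ∃ v : L2 L, HasWeakDeriv a b u v ∧ ‖v‖ ≤ N) :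
    sobolevNorm j u ≤ ENNReal.ofReal (((j : ℝ) + 1) * N) := by
  have h1 : ∑ m ∈ Finset.range (j + 1), ∑ ab ∈ Finset.HasAntidiagonal.antidiagonal m,
      ⨅ v : L2 L, ⨅ _ : HasWeakDeriv ab.1 ab.2 u v, ‖v‖ₑ ^ 2
      ≤ ENNReal.ofReal (((j : ℝ) + 1) * N) ^ 2 := by
    calc _ ≤ ∑ m ∈ Finset.range (j + 1), ∑ ab ∈ Finset.HasAntidiagonal.antidiagonal m,
          ENNReal.ofReal N ^ 2 := by
          refine Finset.sum_le_sum fun m hm => Finset.sum_le_sum fun ab hab => ?_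
          rw [Finset.HasAntidiagonal.mem_antidiagonal] at hab
          rw [Finset.mem_range] at hm
          obtain ⟨v, hv, hvN⟩ := h ab.1 ab.2 (by omega)
          refine (iInf₂_le v hv).trans ?_
          gcongr
          rw [← ofReal_norm]
          exact ENNReal.ofReal_le_ofReal hvN
      _ ≤ ∑ m ∈ Finset.range (j + 1), ((j + 1 : ℕ) : ℝ≥0∞) * ENNReal.ofReal N ^ 2 := by
          refine Finset.sum_le_sum fun m hm => ?_
          rw [Finset.sum_const, nsmul_eq_mul, Finset.Nat.card_antidiagonal]
          rw [Finset.mem_range] at hm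
          gcongr
          omega
      _ = ENNReal.ofReal (((j : ℝ) + 1) * N) ^ 2 := by
          rw [Finset.sum_const, Finset.card_range, nsmul_eq_mul, ENNReal.ofReal_mul (by positivity),
            show ((j : ℝ) + 1) = ((j + 1 : ℕ) : ℝ) by push_cast; ring, ENNReal.ofReal_natCast]
          ring
  rw [sobolevNorm]
  calc _ ≤ (ENNReal.ofReal (((j : ℝ) + 1) * N) ^ 2) ^ (1 / 2 : ℝ) :=
        ENNReal.rpow_le_rpow h1 (by norm_num)
    _ = _ := by
        rw [← ENNReal.rpow_two, ← ENNReal.rpow_mul]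
        norm_num

/-- Weighted bounds by the initial data turn into Gevrey bounds of radius `ρ`. -/
lemma le_of_weighted_sum_le {ρ s D X : ℝ} (hs : 0 ≤ s) (hD : 0 < D) (hρ : 0 < ρ) (hρ1 : ρ ≤ 1)
    (hρK : ρ * (D * Real.exp s * 2 ^ s) ≤ 1 / 2) {a b j : ℕ} (hab : a + b ≤ j) {V : ℕ → ℝ}
    (hV0 : ∀ i, 0 ≤ V i) (hV : ∀ i, V i ≤ 2 * gevreyBound D s (a + i))
    (h : gevreyWeight ρ s b ^ 2 * X ^ 2 ≤
      4 * ∑ i ∈ Finset.range (b + 1), gevreyWeight ρ s i ^ 2 * V i ^ 2) :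
    X ≤ 6 * (D * Real.exp s) * ρ⁻¹ ^ j * (1 + (j : ℝ)) ^ ((j : ℝ) * s) := by
  have hfac : ∀ i : ℕ, (0 : ℝ) < (i.factorial : ℝ) ^ s := fun i => by
    have : (0 : ℝ) < i.factorial := by exact_mod_cast i.factorial_pos
    positivity
  set E := D * Real.exp s with hE
  set K := E * 2 ^ s with hK
  have hE0 : 0 < E := by positivity
  have hK0 : 0 < K := by positivity
  set A := 2 * E * K ^ a * (a.factorial : ℝ) ^ s with hA
  have hA0 : 0 < A := by have := hfac a; positivity
  have h1 : ∀ i, gevreyWeight ρ s i * V i ≤ A * (ρ * K) ^ i := fun i => by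
    have h2 := hV i
    have h3 := gevreyBound_add_le hD hs a i
    have h4 : V i ≤ 2 * (E * K ^ (a + i) * ((a.factorial : ℝ) ^ s * (i.factorial : ℝ) ^ s)) := by
      linarith
    calc _ ≤ gevreyWeight ρ s i *
          (2 * (E * K ^ (a + i) * ((a.factorial : ℝ) ^ s * (i.factorial : ℝ) ^ s))) :=
          mul_le_mul_of_nonneg_left h4 (gevreyWeight_pos hρ s i).le
      _ = _ := by
          have := (hfac i).ne'
          unfold gevreyWeight
          rw [hA, pow_add, mul_pow ρ]
          field_simp
  have h2 : ∑ i ∈ Finset.range (b + 1), gevreyWeight ρ s i ^ 2 * V i ^ 2 ≤ A ^ 2 * 2 := by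
    calc _ ≤ ∑ i ∈ Finset.range (b + 1), A ^ 2 * (1 / 2 : ℝ) ^ i := by
          refine Finset.sum_le_sum fun i _ => ?_
          rw [← mul_pow]
          have h3 : gevreyWeight ρ s i * V i ≤ A * (1 / 2) ^ i := (h1 i).trans (by gcongr)
          have h4 : 0 ≤ gevreyWeight ρ s i * V i := mul_nonneg (gevreyWeight_pos hρ s i).le (hV0 i)
          have h5 : (1 / 2 : ℝ) ^ i ≤ 1 := pow_le_one₀ (by norm_num) (by norm_num)
          calc _ ≤ (A * (1 / 2) ^ i) ^ 2 := by gcongr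
            _ = A ^ 2 * ((1 / 2) ^ i * (1 / 2) ^ i) := by ring
            _ ≤ A ^ 2 * ((1 / 2) ^ i * 1) := by gcongr
            _ = _ := by ring
      _ ≤ A ^ 2 * 2 := by
          rw [← Finset.mul_sum]
          gcongr
          exact sum_geometric_two_le _
  have hWb := gevreyWeight_pos hρ s b
  have h3 : gevreyWeight ρ s b * X ≤ 3 * A := by
    refine abs_le_of_sq_le_sq' ?_ (by positivity) |>.2
    rw [mul_pow]
    nlinarith
  have hKρ : K ≤ ρ⁻¹ := by
    rw [le_inv_comm₀ hK0 hρ, ← one_div, le_div_iff₀ hK0]; linarith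
  have hρi : 1 ≤ ρ⁻¹ := (one_le_inv₀ hρ).2 hρ1
  have h4 : X ≤ 3 * A / gevreyWeight ρ s b := by rwa [le_div_iff₀' hWb]
  calc X ≤ 3 * A / gevreyWeight ρ s b := h4
    _ = 6 * E * (K ^ a * ρ⁻¹ ^ b) * ((a.factorial : ℝ) ^ s * (b.factorial : ℝ) ^ s) := by
        have := (hfac b).ne'
        unfold gevreyWeight
        rw [hA, inv_pow]
        field_simp
        norm_num
    _ ≤ 6 * E * (ρ⁻¹ ^ a * ρ⁻¹ ^ b) * ((a.factorial : ℝ) ^ s * (b.factorial : ℝ) ^ s) := by gcongr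
    _ ≤ 6 * E * ρ⁻¹ ^ j * (1 + (j : ℝ)) ^ ((j : ℝ) * s) := by
        rw [← pow_add]
        gcongr
        exact factorial_rpow_mul_le hs hab

end Sobolev

end InviscidDamping

open InviscidDamping in
theorem theorem1 (κ : ℝ≥0) (L₀ : ℝ) :
    ∃ c : ℝ, 0 < c ∧
      ∀ s : ℝ, 1 ≤ s → ∀ D₁ D₂ : ℝ, 0 < D₁ → 0 < D₂ →
        ∃ C : ℝ, 0 < C ∧
          ∀ (L : ℝ) [Fact (0 < L)], L ≤ L₀ →
          ∀ U : ℝ → ℝ, ContDiff ℝ 2 U → IsBilipschitz κ U →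
            wOneInftyNorm (coeffF U) * ENNReal.ofReal L < ENNReal.ofReal c →
            (∀ j : ℕ, cNorm j (coeffF U) + cNorm j (coeffG U) ≤
              ENNReal.ofReal (D₁ ^ (1 + j) * (1 + (j : ℝ)) ^ ((j : ℝ) * s))) →
          ∀ w : ℝ → L2 L, IsSolution (coeffF U) (coeffG U) w → HasZeroMean (w 0) →
            (∀ j : ℕ, sobolevNorm j (w 0) ≤
              ENNReal.ofReal (D₂ ^ (1 + j) * (1 + (j : ℝ)) ^ ((j : ℝ) * s))) →
            ∀ (j : ℕ) (t : ℝ), 0 ≤ t →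
              sobolevNorm j (w t) ≤
                ENNReal.ofReal (C ^ (1 + j) * (1 + (j : ℝ)) ^ ((j : ℝ) * s)) := by
  -- The ellipticity constant `b ≤ κ⁻²`; the maximum ensures `b ≤ 1` for every `κ`.
  set b : ℝ := (max (κ : ℝ) 1)⁻¹ ^ 2 with hb
  set ℓ : ℝ := |L₀| + 1 with hℓ
  have hmax : 1 ≤ max (κ : ℝ) 1 := le_max_right _ _
  have hb0 : 0 < b := by positivity
  have hb1 : b ≤ 1 := pow_le_one₀ (by positivity) (inv_le_one_of_one_le₀ hmax)
  have hℓ0 : 0 < ℓ := by positivity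
  refine ⟨b / (80 * (1 + ℓ)), by positivity, fun s hs D₁ D₂ hD₁ hD₂ => ?_⟩
  have hs0 : 0 ≤ s := by linarith
  have hc : b / (80 * (1 + ℓ)) * (80 * (1 + ℓ)) ≤ b := by
    rw [div_mul_cancel₀ _ (by positivity)]
  have hc0 : 0 < b / (80 * (1 + ℓ)) := by positivity
  generalize b / (80 * (1 + ℓ)) = c at hc hc0
  -- The radius depends on `D₂` as well: the weighted norm of the initial datum has to be finite.
  obtain ⟨ρ, hρ, hρ1, hρK, hr⟩ := exists_radius hs0 hD₁ hb0 hℓ0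
    (D₂ * Real.exp s * 2 ^ s) (by positivity)
  refine ⟨6 * (D₂ * Real.exp s) + 2 * ρ⁻¹, by positivity, ?_⟩
  intro L hL hLL U hU hκ hsmall hcoef w hw hmean hinit j t ht
  have hL0 : 0 < L := hL.out
  have hLℓ : L ≤ ℓ := by linarith [le_abs_self L₀]
  have hcb := hκ.coeffBounds hU hD₁ hL0 hsmall hcoef
  have hg : Differentiable ℝ (coeffG U) := fun z => (hκ.hasDerivAt_coeffG hU z).differentiableAt
  have hfm := memLp_of_bound hcb.f_smooth hcb.f_le
  have hmm := memLp_of_bound hcb.m_smooth hcb.m_le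
  have hfg := hκ.coeffG_mul_deriv hU
  have hfc := hcb.f_smooth.continuous
  have hzero := hw.modeProj_zero hg hfc hfg hfm hmm hmean ht
  have hv : ∀ a i, ∃ v : L2 L, HasWeakDeriv a i (w 0) v ∧ ‖v‖ ≤ 2 * gevreyBound D₂ s (a + i) :=
    fun a i => exists_hasWeakDeriv_of_sobolevNorm_le (gevreyBound_pos hD₂ s (a + i)) (hinit (a + i))
  choose v hv hvn using hv
  have hder : ∀ a i, a + i ≤ j → ∃ u : L2 L, HasWeakDeriv a i (w t) u ∧
      ‖u‖ ≤ 6 * (D₂ * Real.exp s) * ρ⁻¹ ^ j * (1 + (j : ℝ)) ^ ((j : ℝ) * s) := by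
    intro a i hai
    refine exists_hasWeakDeriv_of_norm_dq_le fun h => ?_
    refine le_of_weighted_sum_le hs0 hD₂ hρ hρ1 hρK hai (V := fun i => ‖v a i‖)
      (fun i => norm_nonneg _) (hvn a) ?_
    refine norm_sq_dq_dq_le hv hzero (fun n hn => ?_) h a
    obtain ⟨hk, hkL⟩ := inv_abs_waveNumber_le hL0 hn
    obtain ⟨hell, hfor⟩ := smallness hρ hb0 hℓ0 hD₁ hL0 hLℓ (abs_pos.2 hk) hkL hc0.le hc hr i
    exact (hw.mode hg hfc hfg hfm hmm n).sum_norm_dq_le hcb hb0 hb1 hk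
      (fun i => (gevreyWeight_pos hρ s i).le) (choose_mul_gevreyWeight_le hρ hs) i hell hfor h ht
  refine (sobolevNorm_le_of_hasWeakDeriv hder).trans (ENNReal.ofReal_le_ofReal ?_)
  -- The number of derivatives is absorbed by the factor `2` in `2 ρ⁻¹`.
  have hj : (j : ℝ) + 1 ≤ 2 ^ j := by exact_mod_cast Nat.lt_two_pow_self (n := j)
  have hρi : 0 < ρ⁻¹ := inv_pos.2 hρ
  calc ((j : ℝ) + 1) * (6 * (D₂ * Real.exp s) * ρ⁻¹ ^ j * (1 + (j : ℝ)) ^ ((j : ℝ) * s))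
      ≤ 2 ^ j * (6 * (D₂ * Real.exp s) * ρ⁻¹ ^ j * (1 + (j : ℝ)) ^ ((j : ℝ) * s)) := by gcongr
    _ = 6 * (D₂ * Real.exp s) * (2 * ρ⁻¹) ^ j * (1 + (j : ℝ)) ^ ((j : ℝ) * s) := by
        rw [mul_pow]; ring
    _ ≤ (6 * (D₂ * Real.exp s) + 2 * ρ⁻¹) * (6 * (D₂ * Real.exp s) + 2 * ρ⁻¹) ^ j
          * (1 + (j : ℝ)) ^ ((j : ℝ) * s) := by
        gcongr
        · exact le_add_of_nonneg_right (by positivity)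
        · exact le_add_of_nonneg_left (by positivity)
    _ = _ := by rw [pow_add, pow_one]
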